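/- Let $\beta>1$, $b=\lceil\beta\rceil$, $A=\{0,1,\dots,b-1\}$, and let $w^\beta\in A^{\mathbb N}$ be the lexicographically largest sequence that does not end in zeros only and satisfies $\sum_{j\ge1}w^\beta_j\beta^{-j}=1$ (the greedy expansion of $1$, unless that one ends in zeros only). Let $\sigma$ be the shift and $\Sigma_\beta=\{x\in A^{\mathbb N}:\sigma^k x\preceq w^\beta \text{ for all }k\ge0\}$ ($\preceq$ lexicographic), with language $\mathcal L=\{w : [w]\ne\emptyset\}$, where $[w]$ is the set of points of $\Sigma_\beta$ beginning with the word $w$. For $\varphi\in C(\Sigma_\beta)$ put $S_n\varphi=\sum_{k<n}\varphi\circ\sigma^k$, $\varphi_n(w)=\sup_{[w]}S_n\varphi$ for $|w|=n$, $\Lambda_n(\mathcal D,\varphi)=\sum_{w\in\mathcal D\cap\mathcal L,\,|w|=n}e^{\varphi_n(w)}$ and $P(\varphi)=\limsup_n\frac1n\log\Lambda_n(\mathcal L,\varphi)$. A potential $\varphi$ has the Bowen property on $\mathcal D\subset\mathcal L$ if $|S_n\varphi(x)-S_n\varphi(y)|$ is bounded uniformly over $n$, $w\in\mathcal D$ with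 $|w|=n$, and $x,y\in[w]$. Let $\mathcal F=\{0^nz\in\mathcal L: n\ge0,\ z\in A\setminus\{0\}\}$ be the set of minimal words of $\mathcal L$ that are not words of the subshift $\{0\}=\{000\cdots\}$. Let $\varphi=\varphi_r+\varphi_0$, where $\varphi_r\in C(\Sigma_\beta)$ has the Bowen property on $\mathcal L$ and $\varphi_0=\sum_{w\in\mathcal F}a_w\mathbf 1_{[w]}$ with real $a_w$ that depend only on $|w|$ and satisfy $\max_{w\in\mathcal F,|w|=n}|a_w|\to0$ as $n\to\infty$. Assume $P(\varphi)>\varphi(0)$, the value at the fixed point $000\cdots$. Let $\Gamma_\beta$ be the labelled directed graph with vertices $v_1,v_2,\dots$, an edge $v_i\to v_{i+1}$ labelled $w^\beta_i$ for each $i$, and an edge $v_i\to v_1$ labelled $c$ for each letter $c<w^\beta_i$. Let $\mathcal G$ be the set of words that label a path from $v_1$ to $v_1$ and are empty or have nonzero last letter, or that label a path from $v_1$ to $v_2$. Let $\mathcal C^s$ be the set of words of $\mathcal L$ of one of the forms $w^\beta_1\cdots w^\beta_m\,c\,0^\ell$, $w^\beta_2\cdots w^\beta_m\,c\,0^\ell$,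 $0^\ell$ with $m\ge1$, $c\in A$, $\ell\ge0$ (for $m=1$ the second form is $c\,0^\ell$). Put $\mathcal G(M)=\{vs\in\mathcal L: v\in\mathcal G,\ s\in\mathcal C^s,\ |s|\le M\}$. Then: 1. $\mathcal G,\mathcal C^s\subset\mathcal L$, and every word of $\mathcal L$ is a concatenation $vs$ with $v\in\mathcal G$, $s\in\mathcal C^s$. For every $M$ there is $t\in\mathbb N$ such that any $w^1,\dots,w^m\in\mathcal G(M)$ ($m\ge 1$) can be joined by words $u^i\in\mathcal L$ of length exactly $t$ to a word $x=w^1u^1w^2\cdots u^{m-1}w^m\in\mathcal L$ for which $[x]$ contains a point $p$ with $\sigma^{|x|+t}p=p$. The potential $\varphi$ has the Bowen property on $\mathcal G$, and $\sum_{n\ge1}\Lambda_n(\mathcal C^s,\varphi)e^{-nP(\varphi)}<\infty$. 2. $\varphi$ has a unique equilibrium state $\mu$: there is exactly one $\sigma$-invariant Borel probability measure on $\Sigma_\beta$ that maximises $h(\nu)+\int\varphi\,d\nu$ over all $\sigma$-invariant Borel probability measures $\nu$, where $h$ is the measure-theoretic entropy. 3. $\mu$ has the weak Gibbs property: there are $K'>0$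 and $K_M>0$ ($M\in\mathbb N$) such that for all $M$, $n$ and all $w\in\mathcal G(M)$ with $|w|=n$, $$K_M\le\frac{\mu([w])}{e^{-nP(\varphi)+\varphi_n(w)}}\le K'.$$ 4. $\mu$ is the weak* limit, as $n\to\infty$, of the periodic orbit measures $\bigl(\sum_{x\in\mathrm{Per}_n}e^{S_n\varphi(x)}\bigr)^{-1}\sum_{x\in\mathrm{Per}_n}e^{S_n\varphi(x)}\delta_x$, where $\mathrm{Per}_n=\{x\in\Sigma_\beta:\sigma^nx=x\}$. -/

import Mathlib

open Set Filter Topology MeasureTheory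
open SymbolicDynamics.FullShift (Subshift shift)

namespace BetaShift

section SymbolicSpaces

variable {A : Type*} [TopologicalSpace A]

/-- The shift map of a one-sided subshift `X ⊆ A^ℕ`, as a self-map of `X`. -/
noncomputable def shiftMap (X : Subshift A ℕ) : X.carrier → X.carrier :=
  fun x => ⟨shift 1 x.1, X.mapsTo 1 x.2⟩

/-- The cylinder `[w]`: the points of `X` that begin with the word `w`. -/
noncomputable def cylinder (X : Subshift A ℕ) (w : List A) : Set X.carrier :=
  {x | ∀ (i : ℕ) (hi : i < w.length), x.1 i = w[i]}

/-- The language of `X`: the finite words with nonempty cylinder. -/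
noncomputable def language (X : Subshift A ℕ) : Set (List A) :=
  {w | (cylinder X w).Nonempty}

/-- `φ_n(w)`, the supremum of the Birkhoff sum `S_n φ` over `[w]`, where `n = |w|`. -/
noncomputable def supBirkhoff (X : Subshift A ℕ) (φ : C(X.carrier, ℝ)) (w : List A) : ℝ :=
  sSup ((fun x => birkhoffSum (shiftMap X) φ w.length x) '' cylinder X w)

/-- `Λ_n(D, φ)`, the sum of `exp (φ_n(w))` over the words `w` of length `n` of the language that
belong to the collection `D`. -/
noncomputable def partitionSum [Fintype A] (X : Subshift A ℕ) (φ : C(X.carrier, ℝ)) (D : Set (List A))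
    (n : ℕ) : ℝ :=
  ∑ u : Fin n → A,
    (D ∩ language X).indicator (fun w => Real.exp (supBirkhoff X φ w)) (List.ofFn u)

/-- The topological pressure `P(X, φ) = limsup (1/n) log Λ_n(L, φ)`, `L` the language of `X`. -/
noncomputable def pressure [Fintype A] (X : Subshift A ℕ) (φ : C(X.carrier, ℝ)) : ℝ :=
  limsup (fun n : ℕ => Real.log (partitionSum X φ (language X) n) / n) atTop

/-- The Bowen property on a collection `G` of words: `|S_n φ(x) - S_n φ(y)|` is bounded,
uniformly in `n`, `w ∈ G` of length `n`, and `x, y ∈ [w]`. -/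
noncomputable def BowenOn (X : Subshift A ℕ) (φ : C(X.carrier, ℝ)) (G : Set (List A)) : Prop :=
  ∃ V : ℝ, ∀ w ∈ G, ∀ x ∈ cylinder X w, ∀ y ∈ cylinder X w,
    |birkhoffSum (shiftMap X) φ w.length x - birkhoffSum (shiftMap X) φ w.length y| ≤ V

end SymbolicSpaces

section Entropy

variable {Ω : Type*} [MeasurableSpace Ω]

/-- The Shannon entropy of the `n`-th refinement `ξ ∨ T⁻¹ξ ∨ ⋯ ∨ T^{-(n-1)}ξ` of the finite
partition of `Ω` into the level sets of `ξ : Ω → Fin k`. -/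
noncomputable def refinedEntropy (μ : Measure Ω) (T : Ω → Ω) {k : ℕ} (ξ : Ω → Fin k) (n : ℕ) : ℝ :=
  ∑ c : Fin n → Fin k, Real.negMulLog (μ.real {x | ∀ i : Fin n, ξ (T^[i] x) = c i})

/-- The entropy of `T` relative to the partition given by `ξ`. -/
noncomputable def partitionEntropy (μ : Measure Ω) (T : Ω → Ω) {k : ℕ} (ξ : Ω → Fin k) : ℝ :=
  limsup (fun n : ℕ => refinedEntropy μ T ξ n / n) atTop

/-- The measure-theoretic (Kolmogorov--Sinai) entropy: the supremum of the entropies relative to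
all finite measurable partitions. -/
noncomputable def measureEntropy (μ : Measure Ω) (T : Ω → Ω) : EReal :=
  ⨆ (k : ℕ) (ξ : Ω → Fin k) (_ : Measurable ξ), (partitionEntropy μ T ξ : EReal)

end Entropy

section Measures

variable {A : Type*} [TopologicalSpace A] [MeasurableSpace A]

/-- Shift-invariant (Borel) probability measures on `X`. -/
noncomputable def IsInvariantProbability (X : Subshift A ℕ) (μ : Measure X.carrier) : Prop :=
  IsProbabilityMeasure μ ∧ MeasurePreserving (shiftMap X) μ μ

/-- `μ` is an equilibrium state for `φ`: it maximises `h(ν) + ∫ φ dν` among the shift-invariant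
probability measures `ν`. -/
noncomputable def IsEquilibriumState (X : Subshift A ℕ) (φ : C(X.carrier, ℝ)) (μ : Measure X.carrier) : Prop :=
  IsInvariantProbability X μ ∧
    ∀ ν : Measure X.carrier, IsInvariantProbability X ν →
      measureEntropy ν (shiftMap X) + ((∫ x, φ x ∂ν : ℝ) : EReal) ≤
        measureEntropy μ (shiftMap X) + ((∫ x, φ x ∂μ : ℝ) : EReal)

/-- The periodic points of period `n` (not necessarily of least period `n`). -/
noncomputable def periodicPoints (X : Subshift A ℕ) (n : ℕ) : Set X.carrier :=
  {x | (shiftMap X)^[n] x = x}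

/-- The periodic orbit measure: the measure on the points of period `n` with weights proportional
to `exp (S_n φ(x))`, normalised to total mass one. -/
noncomputable def periodicMeasure (X : Subshift A ℕ) (φ : C(X.carrier, ℝ)) (n : ℕ) : Measure X.carrier :=
  (∑' x : periodicPoints X n,
      ENNReal.ofReal (Real.exp (birkhoffSum (shiftMap X) φ n x.1)))⁻¹ •
    Measure.sum fun x : periodicPoints X n =>
      ENNReal.ofReal (Real.exp (birkhoffSum (shiftMap X) φ n x.1)) • Measure.dirac x.1

/-- Weak* convergence of a sequence of measures on `X`. -/
noncomputable def WeakStarTendsto (X : Subshift A ℕ) (m : ℕ → Measure X.carrier) (μ : Measure X.carrier) : Prop :=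
  ∀ g : C(X.carrier, ℝ), Tendsto (fun n => ∫ x, g x ∂(m n)) atTop (𝓝 (∫ x, g x ∂μ))

end Measures

section Decompositions

variable {A : Type*} [TopologicalSpace A]

/-- The words of the language of the form `u v s` with `u ∈ Cp`, `v ∈ G`, `s ∈ Cs`. -/
noncomputable def concatWords (X : Subshift A ℕ) (Cp G Cs : Set (List A)) : Set (List A) :=
  {w ∈ language X | ∃ u ∈ Cp, ∃ v ∈ G, ∃ s ∈ Cs, w = u ++ v ++ s}

/-- `G(M)`: the words of the language of the form `u v s` with `u ∈ Cp`, `v ∈ G`, `s ∈ Cs`,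
`|u| ≤ M` and `|s| ≤ M`. -/
noncomputable def fattened (X : Subshift A ℕ) (Cp G Cs : Set (List A)) (M : ℕ) : Set (List A) :=
  {w ∈ language X | ∃ u ∈ Cp, ∃ v ∈ G, ∃ s ∈ Cs,
    w = u ++ v ++ s ∧ u.length ≤ M ∧ s.length ≤ M}

/-- Specification with periodic points on a collection `D` of words, for some gap size `t`: any
words `w⁰, …, w^m ∈ D` can be joined by words of the language of length exactly `t` to a word
`x = w⁰ v⁰ w¹ v¹ ⋯ v^{m-1} w^m` of the language such that `[x]` contains a point of period
`|x| + t`. -/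
noncomputable def PerSpecification (X : Subshift A ℕ) (D : Set (List A)) : Prop :=
  ∃ t : ℕ, ∀ (m : ℕ) (w : Fin (m + 1) → List A), (∀ i, w i ∈ D) →
    ∃ v : Fin m → List A, (∀ i, v i ∈ language X ∧ (v i).length = t) ∧
      ∃ x : List A, x = w 0 ++ (List.ofFn fun i : Fin m => v i ++ w i.succ).flatten ∧
        x ∈ language X ∧ ∃ p ∈ cylinder X x, (shiftMap X)^[x.length + t] p = p

/-- `Cp G Cs` is a decomposition of the language such that every `G(M)` has specification with
periodic points, `φ` has the Bowen property on `G`, and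
`∑_{n ≥ 1} Λ_n(Cp ∪ Cs, φ) exp (-n P(X, φ)) < ∞`. -/
structure IsGoodDecomposition [Fintype A] (X : Subshift A ℕ) (φ : C(X.carrier, ℝ))
    (Cp G Cs : Set (List A)) : Prop where
  prefix_subset : Cp ⊆ language X
  good_subset : G ⊆ language X
  suffix_subset : Cs ⊆ language X
  decomposition : concatWords X Cp G Cs = language X
  specification : ∀ M, PerSpecification X (fattened X Cp G Cs M)
  bowen : BowenOn X φ G
  summable : Summable fun n : ℕ =>
    partitionSum X φ (Cp ∪ Cs) (n + 1) * Real.exp (-((n + 1 : ℕ) * pressure X φ))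

/-- The weak Gibbs property of `μ` with respect to the decomposition `Cp G Cs`: the upper constant
`K'` is uniform, the lower constant `K M` may depend on `M`. -/
noncomputable def WeakGibbs [Fintype A] [MeasurableSpace A] (X : Subshift A ℕ) (φ : C(X.carrier, ℝ))
    (μ : Measure X.carrier) (Cp G Cs : Set (List A)) : Prop :=
  ∃ (K' : ℝ) (K : ℕ → ℝ), 0 < K' ∧ (∀ M, 0 < K M) ∧
    ∀ M, ∀ w ∈ fattened X Cp G Cs M,
      K M ≤ μ.real (cylinder X w) /
          Real.exp (-(w.length * pressure X φ) + supBirkhoff X φ w) ∧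
        μ.real (cylinder X w) /
          Real.exp (-(w.length * pressure X φ) + supBirkhoff X φ w) ≤ K'

end Decompositions

section GridFunctions

variable {A : Type*} [TopologicalSpace A]

/-- The minimal words of the language of `X` that do not belong to the language of `Y`. -/
noncomputable def minimalForbidden (X Y : Subshift A ℕ) : Set (List A) :=
  {w | w ∈ language X ∧ w ∉ language Y ∧ w.dropLast ∈ language Y}

/-- The coefficients of a grid function tend to `0`, uniformly over words of the same length, as
the length of the word tends to infinity. -/
noncomputable def GridCoefficients (X Y : Subshift A ℕ) (a : List A → ℝ) : Prop :=
  ∀ ε > 0, ∃ N : ℕ, ∀ w ∈ minimalForbidden X Y, N ≤ w.length → |a w| < ε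

/-- The grid function `∑_w a_w 1_{[w]}`, the sum being over the minimal forbidden words. -/
noncomputable def gridFunction (X Y : Subshift A ℕ) (a : List A → ℝ) (x : X.carrier) : ℝ :=
  ∑' w : minimalForbidden X Y, (cylinder X w.1).indicator (fun _ => a w.1) x

end GridFunctions

section Beta

/-- The points of the orbit of `1` in the expansion algorithm with digits `⌈β r⌉ - 1`. They stay
in `(0, 1]`. -/
noncomputable def betaRemainder (β : ℝ) : ℕ → ℝ
  | 0 => 1
  | n + 1 => β * betaRemainder β n - (⌈β * betaRemainder β n⌉ - 1 : ℤ)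

theorem betaRemainder_pos (β : ℝ) (n : ℕ) : 0 < betaRemainder β n := by
  cases n with
  | zero => simp [betaRemainder]
  | succ n =>
    have := Int.ceil_lt_add_one (β * betaRemainder β n)
    simp only [betaRemainder]; push_cast; linarith

theorem betaRemainder_le_one (β : ℝ) (n : ℕ) : betaRemainder β n ≤ 1 := by
  cases n with
  | zero => simp [betaRemainder]
  | succ n =>
    have := Int.le_ceil (β * betaRemainder β n)
    simp only [betaRemainder]; push_cast; linarith

/-- The alphabet `{0, 1, …, ⌈β⌉ - 1}`. -/
abbrev BetaAlphabet (β : ℝ) : Type := Fin (⌈β⌉₊ - 1 + 1)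

/-- The sequence `w^β` (with indices from `0`): the lexicographically largest expansion
`∑_{j ≥ 0} w_j β^{-(j+1)} = 1` with digits in `{0, …, ⌈β⌉ - 1}` that does not end in zeros only.
It is the greedy expansion of `1` except when the latter ends in zeros only. -/
noncomputable def betaExpansion (β : ℝ) (n : ℕ) : BetaAlphabet β :=
  ⟨⌈β * betaRemainder β n⌉₊ - 1, by
    have h0 := betaRemainder_pos β n
    have h1 := betaRemainder_le_one β n
    have h : ⌈β * betaRemainder β n⌉₊ ≤ ⌈β⌉₊ := by
      rcases le_total 0 β with hβ | hβ
      · exact Nat.ceil_mono (by nlinarith)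
      · rw [Nat.ceil_eq_zero.2 (by nlinarith)]; exact Nat.zero_le _
    omega⟩

/-- Sets of sequences bounded above in the lexicographic order are closed. -/
theorem isClosed_lex_le {b : ℕ} (w : ℕ → Fin b) : IsClosed {x : ℕ → Fin b | toLex x ≤ toLex w} := by
  have key : {x : ℕ → Fin b | toLex x ≤ toLex w}ᶜ =
      ⋃ n : ℕ, (⋂ i ∈ Finset.range n, {x : ℕ → Fin b | x i = w i}) ∩ {x | w n < x n} := by
    ext x
    simp only [mem_compl_iff, mem_ofPred_eq, not_le, mem_iUnion, mem_inter_iff, mem_iInter,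
      Finset.mem_range]
    constructor
    · rintro ⟨n, h1, h2⟩
      exact ⟨n, fun i hi => (h1 i hi).symm, h2⟩
    · rintro ⟨n, h1, h2⟩
      exact ⟨n, fun i hi => (h1 i hi).symm, h2⟩
  rw [← isOpen_compl_iff, key]
  refine isOpen_iUnion fun n => IsOpen.inter ?_ ?_
  · refine isOpen_biInter_finset fun i _ => ?_
    exact (isOpen_discrete {w i}).preimage (continuous_apply (A := fun _ : ℕ => Fin b) i)
  · exact (isOpen_discrete {c | w n < c}).preimage (continuous_apply (A := fun _ : ℕ => Fin b) n)

/-- The `β`-shift: the sequences all of whose shifts are lexicographically at most `w^β`. -/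
noncomputable def betaShift (β : ℝ) : Subshift (BetaAlphabet β) ℕ where
  carrier := {x | ∀ k : ℕ, toLex (shift k x) ≤ toLex (betaExpansion β)}
  isClosed := by
    rw [ofPred_forall]
    exact isClosed_iInter fun k =>
      (isClosed_lex_le _).preimage (SymbolicDynamics.FullShift.continuous_shift k)
  mapsTo := by
    intro g x hx k
    have h : shift k (shift g x) = shift (g + k) x := by
      funext n; simp [add_assoc]
    rw [h]; exact hx _

/-- The fixed point `0 = 000⋯` of the `β`-shift. -/
noncomputable def zeroPoint (β : ℝ) : (betaShift β).carrier :=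
  ⟨fun _ => 0, fun _ => Pi.toLex_monotone fun _ => Fin.zero_le _⟩

/-- The subshift `{0}` consisting of the fixed point `000⋯`. -/
noncomputable def zeroShift (β : ℝ) : Subshift (BetaAlphabet β) ℕ where
  carrier := {fun _ => 0}
  isClosed := isClosed_singleton
  mapsTo := by
    rintro g x rfl
    rfl

/-- `BetaPath β i u j`: the word `u` labels a path from vertex `i` to vertex `j` in the graph with
vertex set `ℕ` (vertex `0` is the base vertex) that has an edge `i → i + 1` labelled `w^β_i` and,
for every letter `c < w^β_i`, an edge `i → 0` labelled `c`. -/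
inductive BetaPath (β : ℝ) : ℕ → List (BetaAlphabet β) → ℕ → Prop
  | nil (i : ℕ) : BetaPath β i [] i
  | up {i j : ℕ} {u : List (BetaAlphabet β)} :
      BetaPath β (i + 1) u j → BetaPath β i (betaExpansion β i :: u) j
  | back {i j : ℕ} {c : BetaAlphabet β} {u : List (BetaAlphabet β)} :
      c < betaExpansion β i → BetaPath β 0 u j → BetaPath β i (c :: u) j

/-- The good words: those labelling a path that begins and ends at the base vertex and, unless the
word is empty, with last letter not `0`, or a path from the base vertex to the next vertex. -/
noncomputable def betaGood (β : ℝ) : Set (List (BetaAlphabet β)) :=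
  {u | (BetaPath β 0 u 0 ∧ u.getLast? ≠ some 0) ∨ BetaPath β 0 u 1}

/-- The suffix words: the words of the language of one of the forms `w^β_1 ⋯ w^β_m c 0^ℓ`,
`w^β_2 ⋯ w^β_m c 0^ℓ`, `0^ℓ` (with indices of `w^β` from `1`) with `m ≥ 1`, `ℓ ≥ 0` and `c` a
letter. -/
noncomputable def betaSuffix (β : ℝ) : Set (List (BetaAlphabet β)) :=
  {u ∈ language (betaShift β) |
    (∃ m ≥ 1, ∃ (c : BetaAlphabet β) (l : ℕ),
      u = (List.range m).map (betaExpansion β) ++ c :: List.replicate l 0) ∨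
    (∃ m ≥ 1, ∃ (c : BetaAlphabet β) (l : ℕ),
      u = ((List.range m).map (betaExpansion β)).tail ++ c :: List.replicate l 0) ∨
    ∃ l : ℕ, u = List.replicate l 0}

end Beta

end BetaShift

open BetaShift

/-! Loops at the base vertex of the graph can be combined freely: every word of the language labels
a path from the base vertex, so it may follow any loop, and a nonempty loop repeats to a periodic
point. A word is good for parameters `T`, `V` if `T` more letters close it to a loop and the
Birkhoff sum oscillates by at most `V` on its cylinder. The abstract half,
`exists_unique_equilibriumState`, needs only a loop system, a fixed point and `TailSmall`: for
suitable parameters the words of length `n` that are not good weigh at most `ε * exp (n P)`,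
uniformly in `n`.

Loop sums are supermultiplicative and partition sums are submultiplicative, so both are comparable
to `exp (n P)`. Counting periodic points in cylinders (`exists_eventually_gibbs`) then gives every
limit of the periodic orbit measures an upper Gibbs bound on all words and a lower one on good
words. The upper bound forces entropy plus integral up to the pressure, which is the maximum by the
variational inequality. The lower bound on joined good words gives a mixing estimate, hence
ergodicity. An entropy estimate that weighs a set of words against its complement shows that any
measure reaching the pressure is absolutely continuous with respect to the limit, hence equal to it.
So all limits agree, and the periodic orbit measures converge.

For the `β`-shift the tail has to be controlled. The grid part of the potential depends only on the
letters up to the first nonzero one, so it is constant in Birkhoff sums over words ending in a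
nonzero letter; this gives the Bowen property on the good collection. Suffix words follow `w^β` and
then zeros, so their weight decays relative to the pressure once the Birkhoff sums along `w^β` grow
at a rate below `P` (`exists_birkhoffSum_expansion_le_pressure`). If `w^β` has few nonzero letters
up to `n`, those sums are close to `n φ(0)`, and `φ(0) < P`. If it has many, most of them follow a
short run of zeros and can be lowered independently at bounded cost; the exponentially many words so
obtained push the pressure above the growth along `w^β`. -/

namespace BetaShift

/-! ### Words, cylinders and sums over words -/

section Words

variable {b : ℕ} {X : Subshift (Fin b) ℕ}

instance compactSpace_carrier : CompactSpace X.carrier :=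
  isCompact_iff_compactSpace.1 X.isClosed.isCompact

/-- The word formed by the first `n` letters of `x`. -/
def initialWord (x : ℕ → Fin b) (n : ℕ) : List (Fin b) := List.ofFn fun i : Fin n => x i

@[simp] theorem length_initialWord (x : ℕ → Fin b) (n : ℕ) : (initialWord x n).length = n := by
  simp [initialWord]

theorem initialWord_eq_iff {x y : ℕ → Fin b} {n : ℕ} :
    initialWord x n = initialWord y n ↔ ∀ i < n, x i = y i := by
  rw [initialWord, initialWord, List.ofFn_inj, funext_iff]
  exact ⟨fun h i hi => h ⟨i, hi⟩, fun h i => h i i.2⟩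

theorem initialWord_eq_ofFn_iff {x : ℕ → Fin b} {n : ℕ} {u : Fin n → Fin b} :
    initialWord x n = List.ofFn u ↔ (fun i : Fin n => x i) = u := by
  rw [initialWord, List.ofFn_inj]

theorem initialWord_add (x : ℕ → Fin b) (n m : ℕ) :
    initialWord x (n + m) = initialWord x n ++ initialWord (shift n x) m := by
  rw [initialWord, initialWord, initialWord, ← List.ofFn_fin_append]
  congr 1
  funext i
  refine Fin.addCases (fun j => ?_) (fun j => ?_) i <;> simp

theorem mem_cylinder_iff {w : List (Fin b)} {x : X.carrier} :
    x ∈ cylinder X w ↔ initialWord x.1 w.length = w := by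
  constructor
  · intro h
    refine List.ext_getElem (by simp) fun i h1 h2 => ?_
    simpa [initialWord] using h i h2
  · intro h i hi
    have := congrArg (fun l => l[i]?) h
    simpa [initialWord, hi] using this

theorem mem_cylinder_ofFn {n : ℕ} {u : Fin n → Fin b} {x : X.carrier} :
    x ∈ cylinder X (List.ofFn u) ↔ (fun i : Fin n => x.1 i) = u := by
  rw [mem_cylinder_iff, ← initialWord_eq_ofFn_iff]
  simp

theorem mem_cylinder_initialWord (x : X.carrier) (n : ℕ) :
    x ∈ cylinder X (initialWord x.1 n) := by
  rw [mem_cylinder_iff, length_initialWord]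

theorem initialWord_mem_language (x : X.carrier) (n : ℕ) : initialWord x.1 n ∈ language X :=
  ⟨x, mem_cylinder_initialWord x n⟩

theorem exists_of_mem_language {w : List (Fin b)} (hw : w ∈ language X) :
    ∃ x : X.carrier, initialWord x.1 w.length = w := by
  obtain ⟨x, hx⟩ := hw
  exact ⟨x, mem_cylinder_iff.1 hx⟩

theorem shiftMap_iterate_val (x : X.carrier) (n : ℕ) :
    ((shiftMap X)^[n] x).1 = shift n x.1 := by
  induction n generalizing x with
  | zero => funext i; simp
  | succ n ih =>
    rw [Function.iterate_succ_apply, ih]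
    funext i
    simp [shiftMap, ← add_assoc, add_comm 1 n]

theorem shiftMap_iterate_apply (x : X.carrier) (n i : ℕ) :
    ((shiftMap X)^[n] x).1 i = x.1 (n + i) := by
  rw [shiftMap_iterate_val]; rfl

theorem continuous_shiftMap : Continuous (shiftMap X) :=
  ((SymbolicDynamics.FullShift.continuous_shift 1).comp continuous_subtype_val).subtype_mk _

theorem mem_cylinder_append {u v : List (Fin b)} {x : X.carrier} :
    x ∈ cylinder X (u ++ v) ↔ x ∈ cylinder X u ∧ (shiftMap X)^[u.length] x ∈ cylinder X v := by
  rw [mem_cylinder_iff, mem_cylinder_iff, mem_cylinder_iff, List.length_append, initialWord_add,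
    shiftMap_iterate_val]
  constructor
  · intro h
    exact List.append_inj h (by simp)
  · rintro ⟨h1, h2⟩
    rw [h1, h2]

theorem left_mem_language {u v : List (Fin b)} (h : u ++ v ∈ language X) : u ∈ language X :=
  let ⟨x, hx⟩ := h
  ⟨x, (mem_cylinder_append.1 hx).1⟩

theorem right_mem_language {u v : List (Fin b)} (h : u ++ v ∈ language X) : v ∈ language X :=
  let ⟨_, hx⟩ := h
  ⟨_, (mem_cylinder_append.1 hx).2⟩

theorem isClopen_cylinder (w : List (Fin b)) : IsClopen (cylinder X w) := by
  have h : cylinder X w = ⋂ i : Fin w.length, (fun x : X.carrier => x.1 i) ⁻¹' {w[i]} := by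
    ext x
    simp only [cylinder, mem_ofPred_eq, mem_iInter, mem_preimage, mem_singleton_iff]
    exact ⟨fun h i => h i i.2, fun h i hi => h ⟨i, hi⟩⟩
  rw [h]
  refine isClopen_iInter_of_finite fun i => (isClopen_discrete _).preimage ?_
  exact (continuous_apply (A := fun _ : ℕ => Fin b) (i : ℕ)).comp continuous_subtype_val

theorem measurableSet_cylinder (w : List (Fin b)) : MeasurableSet (cylinder X w) :=
  (isClopen_cylinder w).isOpen.measurableSet

/-- The sum of `f` over all words of length `n`. -/
noncomputable def wordSum (n : ℕ) (f : List (Fin b) → ℝ) : ℝ :=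
  ∑ u : Fin n → Fin b, f (List.ofFn u)

theorem wordSum_add (n m : ℕ) (f : List (Fin b) → ℝ) :
    wordSum (n + m) f = wordSum n fun u => wordSum m fun v => f (u ++ v) := by
  simp only [wordSum]
  rw [← Finset.sum_product', ← (Fin.appendEquiv (α := Fin b) n m).sum_comp]
  refine Finset.sum_congr rfl fun p _ => ?_
  rw [← List.ofFn_fin_append]
  rfl

theorem wordSum_mono {n : ℕ} {f g : List (Fin b) → ℝ} (h : ∀ w, w.length = n → f w ≤ g w) :
    wordSum n f ≤ wordSum n g :=
  Finset.sum_le_sum fun _ _ => h _ (by simp)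

theorem wordSum_congr {n : ℕ} {f g : List (Fin b) → ℝ} (h : ∀ w, w.length = n → f w = g w) :
    wordSum n f = wordSum n g :=
  Finset.sum_congr rfl fun _ _ => h _ (by simp)

theorem wordSum_nonneg {n : ℕ} {f : List (Fin b) → ℝ} (h : ∀ w, 0 ≤ f w) : 0 ≤ wordSum n f :=
  Finset.sum_nonneg fun _ _ => h _

theorem le_wordSum {f : List (Fin b) → ℝ} (h : ∀ w, 0 ≤ f w) (w : List (Fin b)) :
    f w ≤ wordSum w.length f := by
  have := Finset.single_le_sum (f := fun u : Fin w.length → Fin b => f (List.ofFn u))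
    (fun u _ => h _) (Finset.mem_univ w.get)
  simpa [wordSum] using this

theorem wordSum_mul_left (n : ℕ) (c : ℝ) (f : List (Fin b) → ℝ) :
    wordSum n (fun w => c * f w) = c * wordSum n f := by
  simp [wordSum, Finset.mul_sum]

theorem wordSum_mul_right (n : ℕ) (c : ℝ) (f : List (Fin b) → ℝ) :
    wordSum n (fun w => f w * c) = wordSum n f * c := by
  simp [wordSum, Finset.sum_mul]

theorem wordSum_add_fun (n : ℕ) (f g : List (Fin b) → ℝ) :
    wordSum n (fun w => f w + g w) = wordSum n f + wordSum n g :=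
  Finset.sum_add_distrib

theorem wordSum_zero (f : List (Fin b) → ℝ) : wordSum 0 f = f [] := by
  simp [wordSum]

end Words

/-! ### Extreme values of Birkhoff sums on cylinders -/

section Birkhoff

variable {b : ℕ} {X : Subshift (Fin b) ℕ} (φ : C(X.carrier, ℝ))

/-- The infimum of the Birkhoff sum `S_n φ` over `[w]`, where `n = |w|`. -/
noncomputable def infBirkhoff (X : Subshift (Fin b) ℕ) (φ : C(X.carrier, ℝ))
    (w : List (Fin b)) : ℝ :=
  sInf ((fun x => birkhoffSum (shiftMap X) φ w.length x) '' cylinder X w)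

theorem abs_birkhoffSum_le (n : ℕ) (x : X.carrier) :
    |birkhoffSum (shiftMap X) φ n x| ≤ n * ‖φ‖ := by
  rw [birkhoffSum]
  refine (Finset.abs_sum_le_sum_abs _ _).trans ?_
  have : ∀ i ∈ Finset.range n, |φ ((shiftMap X)^[i] x)| ≤ ‖φ‖ := fun i _ => φ.norm_coe_le_norm _
  simpa using Finset.sum_le_sum this

variable {φ}

theorem birkhoffSum_le_supBirkhoff {w : List (Fin b)} {x : X.carrier} (hx : x ∈ cylinder X w) :
    birkhoffSum (shiftMap X) φ w.length x ≤ supBirkhoff X φ w := by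
  refine le_csSup ⟨w.length * ‖φ‖, ?_⟩ (mem_image_of_mem _ hx)
  rintro _ ⟨y, -, rfl⟩
  exact (abs_le.1 (abs_birkhoffSum_le φ _ y)).2

theorem infBirkhoff_le_birkhoffSum {w : List (Fin b)} {x : X.carrier} (hx : x ∈ cylinder X w) :
    infBirkhoff X φ w ≤ birkhoffSum (shiftMap X) φ w.length x := by
  refine csInf_le ⟨-(w.length * ‖φ‖), ?_⟩ (mem_image_of_mem _ hx)
  rintro _ ⟨y, -, rfl⟩
  exact (abs_le.1 (abs_birkhoffSum_le φ _ y)).1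

theorem supBirkhoff_le {w : List (Fin b)} (hw : w ∈ language X) {c : ℝ}
    (h : ∀ x ∈ cylinder X w, birkhoffSum (shiftMap X) φ w.length x ≤ c) :
    supBirkhoff X φ w ≤ c :=
  csSup_le (hw.image _) (by rintro _ ⟨x, hx, rfl⟩; exact h x hx)

theorem le_infBirkhoff {w : List (Fin b)} (hw : w ∈ language X) {c : ℝ}
    (h : ∀ x ∈ cylinder X w, c ≤ birkhoffSum (shiftMap X) φ w.length x) :
    c ≤ infBirkhoff X φ w :=
  le_csInf (hw.image _) (by rintro _ ⟨x, hx, rfl⟩; exact h x hx)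

theorem infBirkhoff_le_supBirkhoff {w : List (Fin b)} (hw : w ∈ language X) :
    infBirkhoff X φ w ≤ supBirkhoff X φ w :=
  let ⟨_, hx⟩ := hw
  (infBirkhoff_le_birkhoffSum hx).trans (birkhoffSum_le_supBirkhoff hx)

theorem supBirkhoff_append_le {u v : List (Fin b)} (h : u ++ v ∈ language X) :
    supBirkhoff X φ (u ++ v) ≤ supBirkhoff X φ u + supBirkhoff X φ v := by
  refine supBirkhoff_le h fun x hx => ?_
  rw [List.length_append, birkhoffSum_add]
  exact add_le_add (birkhoffSum_le_supBirkhoff (mem_cylinder_append.1 hx).1)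
    (birkhoffSum_le_supBirkhoff (mem_cylinder_append.1 hx).2)

theorem infBirkhoff_add_le {u v : List (Fin b)} (h : u ++ v ∈ language X) :
    infBirkhoff X φ u + infBirkhoff X φ v ≤ infBirkhoff X φ (u ++ v) := by
  refine le_infBirkhoff h fun x hx => ?_
  rw [List.length_append, birkhoffSum_add]
  exact add_le_add (infBirkhoff_le_birkhoffSum (mem_cylinder_append.1 hx).1)
    (infBirkhoff_le_birkhoffSum (mem_cylinder_append.1 hx).2)

theorem supBirkhoff_le_mul_norm {w : List (Fin b)} (hw : w ∈ language X) :
    supBirkhoff X φ w ≤ w.length * ‖φ‖ :=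
  supBirkhoff_le hw fun x _ => (abs_le.1 (abs_birkhoffSum_le φ _ x)).2

theorem neg_mul_norm_le_infBirkhoff {w : List (Fin b)} (hw : w ∈ language X) :
    -(w.length * ‖φ‖) ≤ infBirkhoff X φ w :=
  le_infBirkhoff hw fun x _ => (abs_le.1 (abs_birkhoffSum_le φ _ x)).1

theorem infBirkhoff_sub_le_append {u v : List (Fin b)} (h : u ++ v ∈ language X) :
    infBirkhoff X φ u - v.length * ‖φ‖ ≤ infBirkhoff X φ (u ++ v) := by
  have h1 := infBirkhoff_add_le (φ := φ) h
  have h2 := neg_mul_norm_le_infBirkhoff (φ := φ) (right_mem_language h)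
  linarith

end Birkhoff

/-! ### Partition sums and pressure -/

section Pressure

variable {b : ℕ} {X : Subshift (Fin b) ℕ} {φ : C(X.carrier, ℝ)}

/-- The weight `exp (φ_n(w))` of a word of `D` in the language, and `0` for other words. -/
noncomputable def upperWeight (X : Subshift (Fin b) ℕ) (φ : C(X.carrier, ℝ)) (D : Set (List (Fin b))) :
    List (Fin b) → ℝ :=
  (D ∩ language X).indicator fun w => Real.exp (supBirkhoff X φ w)

/-- The analogue of `upperWeight` with the infimum of the Birkhoff sum. -/
noncomputable def lowerWeight (X : Subshift (Fin b) ℕ) (φ : C(X.carrier, ℝ)) (D : Set (List (Fin b))) :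
    List (Fin b) → ℝ :=
  (D ∩ language X).indicator fun w => Real.exp (infBirkhoff X φ w)

theorem partitionSum_eq (D : Set (List (Fin b))) (n : ℕ) :
    partitionSum X φ D n = wordSum n (upperWeight X φ D) := rfl

theorem upperWeight_nonneg (D : Set (List (Fin b))) (w : List (Fin b)) : 0 ≤ upperWeight X φ D w :=
  indicator_nonneg (fun _ _ => (Real.exp_pos _).le) _

theorem lowerWeight_nonneg (D : Set (List (Fin b))) (w : List (Fin b)) : 0 ≤ lowerWeight X φ D w :=
  indicator_nonneg (fun _ _ => (Real.exp_pos _).le) _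

theorem upperWeight_of_mem {D : Set (List (Fin b))} {w : List (Fin b)} (h : w ∈ D)
    (hL : w ∈ language X) : upperWeight X φ D w = Real.exp (supBirkhoff X φ w) :=
  indicator_of_mem (by exact ⟨h, hL⟩) _

theorem lowerWeight_of_mem {D : Set (List (Fin b))} {w : List (Fin b)} (h : w ∈ D)
    (hL : w ∈ language X) : lowerWeight X φ D w = Real.exp (infBirkhoff X φ w) :=
  indicator_of_mem (by exact ⟨h, hL⟩) _

theorem upperWeight_of_notMem {D : Set (List (Fin b))} {w : List (Fin b)}
    (h : ¬(w ∈ D ∧ w ∈ language X)) : upperWeight X φ D w = 0 :=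
  indicator_of_notMem (by exact h) _

theorem lowerWeight_of_notMem {D : Set (List (Fin b))} {w : List (Fin b)}
    (h : ¬(w ∈ D ∧ w ∈ language X)) : lowerWeight X φ D w = 0 :=
  indicator_of_notMem (by exact h) _

theorem partitionSum_nonneg (D : Set (List (Fin b))) (n : ℕ) : 0 ≤ partitionSum X φ D n :=
  wordSum_nonneg (upperWeight_nonneg D)

theorem upperWeight_mono {D E : Set (List (Fin b))} {w : List (Fin b)}
    (h : w ∈ D → w ∈ language X → w ∈ E) : upperWeight X φ D w ≤ upperWeight X φ E w := by
  by_cases hw : w ∈ D ∧ w ∈ language X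
  · rw [upperWeight_of_mem hw.1 hw.2, upperWeight_of_mem (h hw.1 hw.2) hw.2]
  · rw [upperWeight_of_notMem hw]; exact upperWeight_nonneg E w

theorem partitionSum_mono {D E : Set (List (Fin b))} (h : D ⊆ E) (n : ℕ) :
    partitionSum X φ D n ≤ partitionSum X φ E n :=
  wordSum_mono fun _ _ => upperWeight_mono fun h1 _ => h h1

theorem partitionSum_union_le (D E : Set (List (Fin b))) (n : ℕ) :
    partitionSum X φ (D ∪ E) n ≤ partitionSum X φ D n + partitionSum X φ E n := by
  simp only [partitionSum_eq]
  rw [← wordSum_add_fun]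
  refine wordSum_mono fun w _ => ?_
  have h1 := upperWeight_nonneg (φ := φ) D w
  have h2 := upperWeight_nonneg (φ := φ) E w
  by_cases hL : w ∈ language X
  · by_cases hD : w ∈ D
    · rw [upperWeight_of_mem (Or.inl hD) hL, upperWeight_of_mem hD hL]; linarith
    · by_cases hE : w ∈ E
      · rw [upperWeight_of_mem (Or.inr hE) hL, upperWeight_of_mem hE hL]; linarith
      · rw [upperWeight_of_notMem fun h => h.1.elim hD hE]; linarith
  · rw [upperWeight_of_notMem fun h => hL h.2]; linarith

theorem partitionSum_language_add_le (n m : ℕ) :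
    partitionSum X φ (language X) (n + m) ≤
      partitionSum X φ (language X) n * partitionSum X φ (language X) m := by
  simp only [partitionSum_eq]
  rw [wordSum_add, ← wordSum_mul_right]
  refine wordSum_mono fun u _ => ?_
  rw [← wordSum_mul_left]
  refine wordSum_mono fun v _ => ?_
  by_cases h : u ++ v ∈ language X
  · have hu := left_mem_language h
    have hv := right_mem_language h
    rw [upperWeight_of_mem h h, upperWeight_of_mem hu hu, upperWeight_of_mem hv hv, ← Real.exp_add]
    exact Real.exp_le_exp.2 (supBirkhoff_append_le h)
  · rw [upperWeight_of_notMem fun h' => h h'.1]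
    exact mul_nonneg (upperWeight_nonneg _ _) (upperWeight_nonneg _ _)

theorem exp_neg_le_partitionSum [Nonempty X.carrier] (n : ℕ) :
    Real.exp (-(n * ‖φ‖)) ≤ partitionSum X φ (language X) n := by
  obtain ⟨x⟩ := ‹Nonempty X.carrier›
  have hw := initialWord_mem_language x n
  have h := le_wordSum (upperWeight_nonneg (φ := φ) (language X)) (initialWord x.1 n)
  rw [upperWeight_of_mem hw hw, length_initialWord] at h
  refine le_trans (Real.exp_le_exp.2 ?_) h
  have h2 := neg_mul_norm_le_infBirkhoff (φ := φ) hw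
  have h3 := infBirkhoff_le_supBirkhoff (φ := φ) hw
  rw [length_initialWord] at h2
  linarith

theorem partitionSum_language_pos [Nonempty X.carrier] (n : ℕ) :
    0 < partitionSum X φ (language X) n :=
  (Real.exp_pos _).trans_le (exp_neg_le_partitionSum n)

theorem subadditive_log_partitionSum [Nonempty X.carrier] :
    Subadditive fun n => Real.log (partitionSum X φ (language X) n) := fun m n => by
  rw [← Real.log_mul (partitionSum_language_pos m).ne' (partitionSum_language_pos n).ne']
  exact Real.log_le_log (partitionSum_language_pos _) (partitionSum_language_add_le m n)

theorem bddBelow_log_partitionSum [Nonempty X.carrier] :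
    BddBelow (range fun n : ℕ => Real.log (partitionSum X φ (language X) n) / n) := by
  refine ⟨-‖φ‖, ?_⟩
  rintro _ ⟨n, rfl⟩
  rcases n.eq_zero_or_pos with rfl | hn
  · simp
  · have hn' : (0 : ℝ) < n := by exact_mod_cast hn
    change _ ≤ Real.log _ / _
    rw [le_div_iff₀ hn', Real.le_log_iff_exp_le (partitionSum_language_pos n)]
    refine le_trans (Real.exp_le_exp.2 ?_) (exp_neg_le_partitionSum n)
    linarith

theorem tendsto_log_partitionSum [Nonempty X.carrier] :
    Tendsto (fun n : ℕ => Real.log (partitionSum X φ (language X) n) / n) atTop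
      (𝓝 (pressure X φ)) := by
  have h := (subadditive_log_partitionSum (φ := φ)).tendsto_lim bddBelow_log_partitionSum
  rw [pressure, h.limsup_eq]
  exact h

/-- In Fekete's lemma the limit of a subadditive sequence is also the infimum of its averages, so
the bound holds for each `n` without any constant. -/
theorem exp_pressure_le_partitionSum [Nonempty X.carrier] (n : ℕ) :
    Real.exp (n * pressure X φ) ≤ partitionSum X φ (language X) n := by
  rcases n.eq_zero_or_pos with rfl | hn
  · simpa using exp_neg_le_partitionSum (φ := φ) 0
  · have hn' : (0 : ℝ) < n := by exact_mod_cast hn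
    rw [← Real.le_log_iff_exp_le (partitionSum_language_pos n), mul_comm, ← le_div_iff₀ hn']
    have h := (subadditive_log_partitionSum (φ := φ)).tendsto_lim bddBelow_log_partitionSum
    rw [pressure, h.limsup_eq]
    exact Subadditive.lim_le_div _ bddBelow_log_partitionSum hn.ne'

/-- The growth rate along the multiples of `n` is already `P`. This turns supermultiplicativity into
an upper bound with no constant, dual to `exp_pressure_le_partitionSum`. -/
theorem le_exp_pressure_of_pow_le [Nonempty X.carrier] {n : ℕ} {a : ℝ} (ha : 0 ≤ a)
    (h : ∀ k : ℕ, a ^ k ≤ partitionSum X φ (language X) (k * n)) :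
    a ≤ Real.exp (n * pressure X φ) := by
  rcases n.eq_zero_or_pos with rfl | hn
  -- For `n = 0` the right side of `h` does not depend on `k`, so the powers of `a` stay bounded.
  · by_contra! h1
    simp only [Nat.cast_zero, zero_mul, Real.exp_zero] at h1
    obtain ⟨k, hk⟩ := pow_unbounded_of_one_lt (partitionSum X φ (language X) 0) h1
    have := h k
    rw [mul_zero] at this
    linarith
  rcases ha.eq_or_lt with rfl | ha
  · positivity
  rw [← Real.log_le_iff_le_exp ha]
  have hn' : (0 : ℝ) < n := by exact_mod_cast hn
  have h1 : Tendsto (fun k : ℕ => Real.log (partitionSum X φ (language X) (k * n)) / (k * n : ℕ))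
      atTop (𝓝 (pressure X φ)) :=
    tendsto_log_partitionSum.comp (tendsto_id.atTop_mul_const' hn)
  rw [mul_comm, ← div_le_iff₀ hn']
  refine ge_of_tendsto h1 (eventually_atTop.2 ⟨1, fun k hk => ?_⟩)
  have hk' : (0 : ℝ) < k := by exact_mod_cast hk
  push_cast
  rw [div_le_div_iff₀ hn' (by positivity)]
  have h2 := Real.log_le_log (pow_pos ha k) (h k)
  rw [Real.log_pow] at h2
  nlinarith

end Pressure

end BetaShift

namespace BetaShift

/-! ### Loop systems, good words and uniform counting bounds -/

section Loops

variable {b : ℕ} {X : Subshift (Fin b) ℕ} {φ : C(X.carrier, ℝ)} {Lp : Set (List (Fin b))}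

/-- A collection of words that can be followed freely by any word of the language, and repeated
periodically. -/
structure IsLoopSystem (X : Subshift (Fin b) ℕ) (Lp : Set (List (Fin b))) : Prop where
  nil_mem : [] ∈ Lp
  append_mem : ∀ u ∈ Lp, ∀ v ∈ Lp, u ++ v ∈ Lp
  append_mem_language : ∀ u ∈ Lp, ∀ v ∈ language X, u ++ v ∈ language X
  exists_periodic : ∀ u ∈ Lp, u ≠ [] → ∃ p ∈ cylinder X u, (shiftMap X)^[u.length] p = p

/-- The words of the language that can be completed to a loop by a word of length `T` and on whose
cylinder the Birkhoff sum oscillates by at most `V`. -/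
def goodWords (X : Subshift (Fin b) ℕ) (φ : C(X.carrier, ℝ)) (Lp : Set (List (Fin b))) (T : ℕ)
    (V : ℝ) : Set (List (Fin b)) :=
  {w ∈ language X | (∃ u : List (Fin b), u.length = T ∧ w ++ u ∈ Lp) ∧
    supBirkhoff X φ w - infBirkhoff X φ w ≤ V}

/-- The sum of `exp (inf S_n φ)` over the loops of length `n`. -/
noncomputable def loopSum (X : Subshift (Fin b) ℕ) (φ : C(X.carrier, ℝ)) (Lp : Set (List (Fin b)))
    (n : ℕ) : ℝ :=
  wordSum n (lowerWeight X φ Lp)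

theorem loopSum_nonneg (n : ℕ) : 0 ≤ loopSum X φ Lp n := wordSum_nonneg (lowerWeight_nonneg Lp)

theorem nil_mem_language [Nonempty X.carrier] : [] ∈ language X :=
  let ⟨x⟩ := ‹Nonempty X.carrier›
  ⟨x, by simp [cylinder]⟩

theorem IsLoopSystem.subset_language [Nonempty X.carrier] (h : IsLoopSystem X Lp) :
    Lp ⊆ language X := fun u hu => by
  simpa using h.append_mem_language u hu [] nil_mem_language

/-- Loops concatenate to loops, and infima of Birkhoff sums are superadditive. This is why loop sums
use the infimum while partition sums use the supremum. -/
theorem loopSum_mul_le [Nonempty X.carrier] (h : IsLoopSystem X Lp) (n m : ℕ) :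
    loopSum X φ Lp n * loopSum X φ Lp m ≤ loopSum X φ Lp (n + m) := by
  rw [loopSum, loopSum, loopSum, wordSum_add, ← wordSum_mul_right]
  refine wordSum_mono fun u _ => ?_
  rw [← wordSum_mul_left]
  refine wordSum_mono fun v _ => ?_
  by_cases huv : u ∈ Lp ∧ v ∈ Lp
  · have hu := h.subset_language huv.1
    have hv := h.subset_language huv.2
    have hw := h.append_mem u huv.1 v huv.2
    rw [lowerWeight_of_mem huv.1 hu, lowerWeight_of_mem huv.2 hv,
      lowerWeight_of_mem hw (h.subset_language hw), ← Real.exp_add]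
    exact Real.exp_le_exp.2 (infBirkhoff_add_le (h.subset_language hw))
  · have h0 : lowerWeight X φ Lp u * lowerWeight X φ Lp v = 0 := by
      by_cases hu : u ∈ Lp
      · rw [lowerWeight_of_notMem (w := v) fun hv => huv ⟨hu, hv.1⟩, mul_zero]
      · rw [lowerWeight_of_notMem (w := u) fun hv => hu hv.1, zero_mul]
    rw [h0]
    exact lowerWeight_nonneg _ _

theorem loopSum_le_partitionSum (n : ℕ) :
    loopSum X φ Lp n ≤ partitionSum X φ (language X) n := by
  refine wordSum_mono fun w _ => ?_
  by_cases hw : w ∈ Lp ∧ w ∈ language X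
  · rw [lowerWeight_of_mem hw.1 hw.2]
    refine le_trans (Real.exp_le_exp.2 (infBirkhoff_le_supBirkhoff hw.2)) ?_
    exact (upperWeight_of_mem hw.2 hw.2).ge
  · rw [lowerWeight_of_notMem hw]
    exact upperWeight_nonneg (language X) w

theorem loopSum_le_exp [Nonempty X.carrier] (h : IsLoopSystem X Lp) (n : ℕ) :
    loopSum X φ Lp n ≤ Real.exp (n * pressure X φ) := by
  refine le_exp_pressure_of_pow_le (loopSum_nonneg n) fun k => ?_
  refine le_trans ?_ (loopSum_le_partitionSum (Lp := Lp) _)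
  induction k with
  | zero =>
    rw [zero_mul, pow_zero, loopSum, wordSum_zero,
      lowerWeight_of_mem h.nil_mem nil_mem_language]
    refine Real.one_le_exp (le_infBirkhoff nil_mem_language fun x _ => ?_)
    simp
  | succ k ih =>
    rw [pow_succ, add_mul, one_mul]
    exact (mul_le_mul_of_nonneg_right ih (loopSum_nonneg n)).trans (loopSum_mul_le h _ _)

/-- Every good word can be completed to a loop, at bounded cost. -/
theorem partitionSum_goodWords_le_loopSum [Nonempty X.carrier] (h : IsLoopSystem X Lp) (T : ℕ)
    (V : ℝ) (n : ℕ) :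
    partitionSum X φ (goodWords X φ Lp T V) n ≤
      Real.exp (V + T * ‖φ‖) * loopSum X φ Lp (n + T) := by
  rw [partitionSum_eq, loopSum, wordSum_add, ← wordSum_mul_left]
  refine wordSum_mono fun w _ => ?_
  by_cases hw : w ∈ goodWords X φ Lp T V
  · have hw' := hw
    obtain ⟨hL, ⟨u, hu, hwu⟩, hV⟩ := hw'
    rw [upperWeight_of_mem hw hL]
    have h1 := le_wordSum (f := fun v => lowerWeight X φ Lp (w ++ v))
      (fun v => lowerWeight_nonneg _ _) u
    rw [hu] at h1
    refine le_trans ?_ (mul_le_mul_of_nonneg_left h1 (Real.exp_pos _).le)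
    rw [lowerWeight_of_mem hwu (h.subset_language hwu), ← Real.exp_add]
    refine Real.exp_le_exp.2 ?_
    have h2 := infBirkhoff_sub_le_append (φ := φ) (h.subset_language hwu)
    rw [hu] at h2
    linarith
  · rw [upperWeight_of_notMem fun h' => hw h'.1]
    exact mul_nonneg (Real.exp_pos _).le (wordSum_nonneg fun v => lowerWeight_nonneg _ _)

theorem partitionSum_goodWords_le [Nonempty X.carrier] (h : IsLoopSystem X Lp) (T : ℕ) (V : ℝ) :
    ∃ C > 0, ∀ n : ℕ, partitionSum X φ (goodWords X φ Lp T V) n ≤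
      C * Real.exp (n * pressure X φ) := by
  refine ⟨Real.exp (V + T * ‖φ‖) * Real.exp (T * pressure X φ), by positivity, fun n => ?_⟩
  refine (partitionSum_goodWords_le_loopSum h T V n).trans ?_
  rw [mul_assoc]
  refine mul_le_mul_of_nonneg_left ((loopSum_le_exp h _).trans (le_of_eq ?_)) (Real.exp_pos _).le
  rw [← Real.exp_add]
  push_cast
  ring_nf

/-- The words of the language that are not good for large parameters carry a small part of the
partition sums. -/
def TailSmall (X : Subshift (Fin b) ℕ) (φ : C(X.carrier, ℝ)) (Lp : Set (List (Fin b))) : Prop :=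
  ∀ ε > 0, ∃ (T : ℕ) (V : ℝ), ∀ n : ℕ,
    partitionSum X φ (goodWords X φ Lp T V)ᶜ n ≤ ε * Real.exp (n * pressure X φ)

theorem partitionSum_language_le_add (D : Set (List (Fin b))) (n : ℕ) :
    partitionSum X φ (language X) n ≤ partitionSum X φ D n + partitionSum X φ Dᶜ n := by
  refine le_trans (partitionSum_mono (E := D ∪ Dᶜ) ?_ n) (partitionSum_union_le D Dᶜ n)
  rw [union_compl_self]
  exact subset_univ _

/-- Good words weigh at most a constant times `exp (n P)`, being completable to loops, and the
remaining words do so by the tail assumption. -/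
theorem exists_partitionSum_language_le [Nonempty X.carrier] (h : IsLoopSystem X Lp)
    (hT : TailSmall X φ Lp) :
    ∃ Q > 0, ∀ n : ℕ, partitionSum X φ (language X) n ≤ Q * Real.exp (n * pressure X φ) := by
  obtain ⟨T, V, hTV⟩ := hT 1 one_pos
  obtain ⟨C, hC, hCn⟩ := partitionSum_goodWords_le (φ := φ) h T V
  refine ⟨C + 1, by positivity, fun n => ?_⟩
  have := partitionSum_language_le_add (φ := φ) (goodWords X φ Lp T V) n
  linarith [hCn n, hTV n]

theorem exists_le_loopSum [Nonempty X.carrier] (h : IsLoopSystem X Lp) (hT : TailSmall X φ Lp) :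
    ∃ c > 0, ∃ N : ℕ, ∀ n ≥ N, c * Real.exp (n * pressure X φ) ≤ loopSum X φ Lp n := by
  -- The whole partition sum is at least `exp (m P)`, so good words keep at least half of that;
  -- completing them by `T` letters turns it into a lower bound for loops of length `m + T`.
  obtain ⟨T, V, hTV⟩ := hT (1 / 2) (by norm_num)
  refine ⟨Real.exp (-(V + T * ‖φ‖)) * (1 / 2) * Real.exp (-(T * pressure X φ)), by positivity, T,
    fun n hn => ?_⟩
  obtain ⟨m, rfl⟩ := Nat.exists_eq_add_of_le' hn
  have h1 := partitionSum_goodWords_le_loopSum (φ := φ) h T V m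
  have h2 := partitionSum_language_le_add (φ := φ) (goodWords X φ Lp T V) m
  have h3 := exp_pressure_le_partitionSum (φ := φ) m
  have h4 : (1 / 2) * Real.exp (m * pressure X φ) ≤
      Real.exp (V + T * ‖φ‖) * loopSum X φ Lp (m + T) := by linarith [hTV m]
  have h5 := mul_le_mul_of_nonneg_left h4 (Real.exp_pos (-(V + T * ‖φ‖))).le
  rw [← mul_assoc _ (Real.exp (V + T * ‖φ‖)), ← Real.exp_add, neg_add_cancel, Real.exp_zero,
    one_mul] at h5
  refine le_trans (le_of_eq ?_) h5
  rw [mul_assoc _ (Real.exp (-(T * pressure X φ))), ← Real.exp_add, mul_assoc]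
  push_cast
  ring_nf

/-- Good words can be joined. -/
theorem goodWords_append {T : ℕ} {V : ℝ} {w u v : List (Fin b)} (h : IsLoopSystem X Lp)
    (hw : w ∈ goodWords X φ Lp T V) (hu : u.length = T) (hwu : w ++ u ∈ Lp)
    (hv : v ∈ goodWords X φ Lp T V) :
    w ++ u ++ v ∈ goodWords X φ Lp T (2 * V + 2 * (T * ‖φ‖)) := by
  obtain ⟨hvL, ⟨u', hu', hvu'⟩, hvV⟩ := hv
  have hL := h.append_mem_language _ hwu v hvL
  refine ⟨hL, ⟨u', hu', by simpa using h.append_mem _ hwu _ hvu'⟩, ?_⟩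
  have hwuL := left_mem_language hL
  have h1 := supBirkhoff_append_le (φ := φ) hL
  have h2 := supBirkhoff_append_le (φ := φ) hwuL
  have h3 := supBirkhoff_le_mul_norm (φ := φ) (right_mem_language hwuL)
  have h4 := infBirkhoff_add_le (φ := φ) hL
  have h5 := infBirkhoff_sub_le_append (φ := φ) hwuL
  -- Each of `w`, `v` contributes `V` to the oscillation, and `u` at most `T * ‖φ‖` to the supremum
  -- and as much to the infimum, which leaves room in the stated bound.
  have h6 := hw.2.2
  rw [hu] at h3 h5
  linarith

end Loops

end BetaShift

namespace BetaShift

/-! ### Shannon entropy of finite-valued maps -/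

section FiniteEntropy

open scoped symmDiff

variable {Ω ι κ : Type*} [MeasurableSpace Ω] {μ : Measure Ω}

/-- The distribution of a finite-valued map. -/
noncomputable def law (μ : Measure Ω) (Y : Ω → ι) (i : ι) : ℝ := μ.real (Y ⁻¹' {i})

theorem law_nonneg (Y : Ω → ι) (i : ι) : 0 ≤ law μ Y i := measureReal_nonneg

variable [Fintype ι] [Fintype κ]

/-- The Shannon entropy of a finite-valued map. -/
noncomputable def finiteEntropy (μ : Measure Ω) (Y : Ω → ι) : ℝ := ∑ i, Real.negMulLog (law μ Y i)

theorem finiteEntropy_nonneg [IsProbabilityMeasure μ] (Y : Ω → ι) : 0 ≤ finiteEntropy μ Y :=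
  Finset.sum_nonneg fun _ _ => Real.negMulLog_nonneg (law_nonneg _ _) measureReal_le_one

theorem ae_law_ne_zero [IsFiniteMeasure μ] (Y : Ω → ι) : ∀ᵐ x ∂μ, law μ Y (Y x) ≠ 0 := by
  have h : ∀ i, ∀ᵐ x ∂μ, law μ Y i = 0 → Y x ≠ i := by
    intro i
    by_cases hi : law μ Y i = 0
    · have : μ (Y ⁻¹' {i}) = 0 := (measureReal_eq_zero_iff (measure_ne_top _ _)).1 hi
      filter_upwards [measure_eq_zero_iff_ae_notMem.1 this] with x hx _ h
      exact hx h
    · exact Eventually.of_forall fun x h => absurd h hi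
  filter_upwards [ae_all_iff.2 h] with x hx h0
  exact hx _ h0 rfl

variable [MeasurableSpace ι] [MeasurableSingletonClass ι] [MeasurableSpace κ]
  [MeasurableSingletonClass κ]

theorem integrable_comp_finite [IsFiniteMeasure μ] {Y : Ω → ι} (hY : Measurable Y) (g : ι → ℝ) :
    Integrable (fun x => g (Y x)) μ :=
  (Integrable.of_finite (μ := μ.map Y) (f := g)).comp_measurable hY

theorem integral_comp_finite [IsFiniteMeasure μ] {Y : Ω → ι} (hY : Measurable Y) (g : ι → ℝ) :
    ∫ x, g (Y x) ∂μ = ∑ i, law μ Y i * g i := by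
  rw [← integral_map hY.aemeasurable (f := g) (measurable_of_finite g).aestronglyMeasurable,
    integral_fintype (Integrable.of_finite)]
  refine Finset.sum_congr rfl fun i _ => ?_
  rw [map_measureReal_apply hY (measurableSet_singleton i), law, smul_eq_mul]

theorem sum_law [IsProbabilityMeasure μ] {Y : Ω → ι} (hY : Measurable Y) : ∑ i, law μ Y i = 1 := by
  have := integral_comp_finite (μ := μ) hY fun _ => 1
  simpa using this.symm

theorem finiteEntropy_eq_integral [IsFiniteMeasure μ] {Y : Ω → ι} (hY : Measurable Y) :
    finiteEntropy μ Y = -∫ x, Real.log (law μ Y (Y x)) ∂μ := by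
  rw [integral_comp_finite hY fun i => Real.log (law μ Y i), ← Finset.sum_neg_distrib]
  exact Finset.sum_congr rfl fun i _ => by rw [Real.negMulLog]; ring

/-- This is `log t ≤ t - 1` at `t = q / p`. The correction `q - p` disappears when probability
vectors are summed, which is how Gibbs' inequality follows. -/
theorem negMulLog_le {p q : ℝ} (hp : 0 ≤ p) (hq : 0 ≤ q) (h : q = 0 → p = 0) :
    Real.negMulLog p ≤ -(p * Real.log q) + (q - p) := by
  rcases hp.eq_or_lt with rfl | hp
  · simpa using hq
  · have hq' : 0 < q := lt_of_le_of_ne hq fun h' => hp.ne' (h h'.symm)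
    have h1 := Real.log_le_sub_one_of_pos (div_pos hq' hp)
    rw [Real.log_div hq'.ne' hp.ne'] at h1
    have h2 := mul_le_mul_of_nonneg_left h1 hp.le
    have h3 : p * (q / p - 1) = q - p := by field_simp
    rw [Real.negMulLog]
    linarith

/-- Gibbs' inequality. -/
theorem finiteEntropy_le_integral [IsProbabilityMeasure μ] {Y : Ω → ι} (hY : Measurable Y)
    {q : ι → ℝ} (hq : ∀ i, 0 ≤ q i) (hsum : ∑ i, q i ≤ 1) (h : ∀ i, q i = 0 → law μ Y i = 0) :
    finiteEntropy μ Y ≤ -∫ x, Real.log (q (Y x)) ∂μ := by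
  rw [integral_comp_finite hY fun i => Real.log (q i)]
  have h1 := Finset.sum_le_sum fun i (_ : i ∈ Finset.univ) =>
    negMulLog_le (law_nonneg (μ := μ) Y i) (hq i) (h i)
  rw [Finset.sum_add_distrib, Finset.sum_neg_distrib, Finset.sum_sub_distrib, sum_law hY] at h1
  rw [finiteEntropy]
  linarith

theorem finiteEntropy_prod_le [IsProbabilityMeasure μ] {Y : Ω → ι} {Z : Ω → κ} (hY : Measurable Y)
    (hZ : Measurable Z) :
    finiteEntropy μ (fun x => (Y x, Z x)) ≤ finiteEntropy μ Y + finiteEntropy μ Z := by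
  have h := finiteEntropy_le_integral (μ := μ) (hY.prodMk hZ)
    (q := fun p => law μ Y p.1 * law μ Z p.2) (fun p => mul_nonneg (law_nonneg _ _) (law_nonneg _ _))
    (by rw [Fintype.sum_prod_type]; simp [← Finset.mul_sum, sum_law hY, sum_law hZ]) (by
      rintro ⟨i, j⟩ h0
      refine le_antisymm ?_ (law_nonneg _ _)
      rcases mul_eq_zero.1 h0 with h0 | h0
      · refine le_trans (measureReal_mono ?_) h0.le
        intro x hx
        exact congrArg Prod.fst hx
      · refine le_trans (measureReal_mono ?_) h0.le
        intro x hx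
        exact congrArg Prod.snd hx)
  refine h.trans (le_of_eq ?_)
  rw [finiteEntropy_eq_integral hY, finiteEntropy_eq_integral hZ, ← neg_add,
    ← integral_add (integrable_comp_finite hY fun i => Real.log (law μ Y i))
      (integrable_comp_finite hZ fun i => Real.log (law μ Z i))]
  congr 1
  refine integral_congr_ae ?_
  filter_upwards [ae_law_ne_zero (μ := μ) Y, ae_law_ne_zero (μ := μ) Z] with x h1 h2
  exact Real.log_mul h1 h2

theorem finiteEntropy_comp_le [IsFiniteMeasure μ] {Y : Ω → ι} (hY : Measurable Y) {f : ι → κ}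
    (hf : Measurable f) : finiteEntropy μ (fun x => f (Y x)) ≤ finiteEntropy μ Y := by
  rw [finiteEntropy_eq_integral hY, finiteEntropy_eq_integral (Y := fun x => f (Y x)) (hf.comp hY)]
  refine neg_le_neg (integral_mono_ae
    (integrable_comp_finite hY fun i => Real.log (law μ Y i))
    (integrable_comp_finite hY fun i => Real.log (law μ (fun x => f (Y x)) (f i))) ?_)
  filter_upwards [ae_law_ne_zero (μ := μ) Y] with x hx
  refine Real.log_le_log (lt_of_le_of_ne (law_nonneg _ _) hx.symm) (measureReal_mono ?_)
  intro y hy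
  exact congrArg f hy

/-- The entropy of `ξ, ξ ∘ T, …, ξ ∘ T^{n-1}` is bounded by that of `W` plus `n` times the
conditional entropy of `ξ` given `A`, if `A, A ∘ T, …, A ∘ T^{n-1}` are functions of `W`. -/
theorem refinedEntropy_le_add [IsProbabilityMeasure μ] {T : Ω → Ω} (hT : MeasurePreserving T μ μ)
    {k n : ℕ} {ξ : Ω → Fin k} (hξ : Measurable ξ) {A : Ω → ι} (hA : Measurable A) {W : Ω → κ}
    (hW : Measurable W) (a : Fin n → κ → ι) (ha : ∀ i x, a i (W x) = A (T^[i] x)) :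
    refinedEntropy μ T ξ n ≤ finiteEntropy μ W +
      n * (finiteEntropy μ (fun x => (A x, ξ x)) - finiteEntropy μ A) := by
  set Y : Ω → (Fin n → Fin k) := fun x i => ξ (T^[i] x) with hYdef
  have hY : Measurable Y := measurable_pi_iff.2 fun i => hξ.comp (hT.measurable.iterate i)
  have hAξ : Measurable fun x => (A x, ξ x) := hA.prodMk hξ
  have h0 : refinedEntropy μ T ξ n = finiteEntropy μ Y := by
    refine Finset.sum_congr rfl fun c _ => ?_
    congr 2
    ext x
    simp [hYdef, funext_iff]
  -- `K v j` is the conditional probability of `ξ = j` given `A = v`. Division by zero gives `0` at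
  -- null values of `A`, so the rows sum to at most one rather than exactly one.
  set K : ι → Fin k → ℝ := fun v j => law μ (fun x => (A x, ξ x)) (v, j) / law μ A v with hK
  have hK0 : ∀ v j, 0 ≤ K v j := fun v j => div_nonneg (law_nonneg _ _) (law_nonneg _ _)
  have hmarg : ∀ v, ∑ j, law μ (fun x => (A x, ξ x)) (v, j) = law μ A v := by
    intro v
    have h := measureReal_biUnion_finset (μ := μ) (s := Finset.univ)
      (f := fun j => (fun x => (A x, ξ x)) ⁻¹' {(v, j)}) ?_ ?_
    · refine h.symm.trans ?_
      rw [law]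
      congr 1
      ext x
      simp
    · intro i _ j _ hij
      refine disjoint_left.2 fun x hx hy => hij ?_
      exact (congrArg Prod.snd hx).symm.trans (congrArg Prod.snd hy)
    · exact fun j _ => hAξ (measurableSet_singleton _)
  have hK1 : ∀ v, ∑ j, K v j ≤ 1 := by
    intro v
    rw [← Finset.sum_div, hmarg]
    exact div_self_le_one _
  have hKae : ∀ᵐ x ∂μ, K (A x) (ξ x) ≠ 0 := by
    filter_upwards [ae_law_ne_zero (μ := μ) A, ae_law_ne_zero (μ := μ) fun x => (A x, ξ x)]
      with x h1 h2
    exact div_ne_zero h2 h1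
  have hKiter : ∀ᵐ x ∂μ, ∀ i : Fin n, K (A (T^[i] x)) (ξ (T^[i] x)) ≠ 0 :=
    ae_all_iff.2 fun i => (hT.iterate i).quasiMeasurePreserving.ae hKae
  -- Gibbs' inequality against the model in which `W` has its own law and, given `W`, the values of
  -- `ξ` at the `n` times are drawn independently from the conditional laws given `A`. By invariance
  -- each time then contributes the same conditional entropy.
  have hq := finiteEntropy_le_integral (μ := μ) (hW.prodMk hY)
    (q := fun p => law μ W p.1 * ∏ i, K (a i p.1) (p.2 i))
    (fun p => mul_nonneg (law_nonneg _ _) (Finset.prod_nonneg fun i _ => hK0 _ _)) (by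
      rw [Fintype.sum_prod_type]
      calc ∑ w, ∑ c : Fin n → Fin k, law μ W w * ∏ i, K (a i w) (c i)
          = ∑ w, law μ W w * ∏ i, ∑ j, K (a i w) j := by
            refine Finset.sum_congr rfl fun w _ => ?_
            rw [← Finset.mul_sum, Finset.prod_univ_sum, Fintype.piFinset_univ]
        _ ≤ ∑ w, law μ W w * 1 := by
            refine Finset.sum_le_sum fun w _ => mul_le_mul_of_nonneg_left ?_ (law_nonneg _ _)
            exact Finset.prod_le_one (fun i _ => Finset.sum_nonneg fun j _ => hK0 _ _)
              fun i _ => hK1 _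
        _ = 1 := by simp [sum_law hW]) (by
      rintro ⟨w, c⟩ h0
      have hnull : ∀ᵐ x ∂μ, (W x, Y x) ≠ (w, c) := by
        filter_upwards [hKiter, ae_law_ne_zero (μ := μ) W] with x h1 h2 h3
        obtain ⟨rfl, rfl⟩ := Prod.mk.inj h3
        refine mul_ne_zero h2 (Finset.prod_ne_zero_iff.2 fun i _ => ?_) h0
        have := h1 i
        rwa [← ha] at this
      have : μ ((fun x => (W x, Y x)) ⁻¹' {(w, c)}) = 0 :=
        measure_eq_zero_iff_ae_notMem.2 hnull
      simp [law, Measure.real, this])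
  rw [h0]
  refine (finiteEntropy_comp_le (hW.prodMk hY) measurable_snd).trans (hq.trans ?_)
  have hint : ∀ i : ℕ, Integrable (fun x => Real.log (K (A (T^[i] x)) (ξ (T^[i] x)))) μ := fun i =>
    (integrable_comp_finite (hAξ.comp (hT.measurable.iterate i)) fun p => Real.log (K p.1 p.2))
  have e1 : ∫ x, Real.log (law μ W (W x) * ∏ i, K (a i (W x)) (Y x i)) ∂μ =
      ∫ x, (Real.log (law μ W (W x)) + ∑ i : Fin n, Real.log (K (A (T^[i] x)) (ξ (T^[i] x)))) ∂μ := by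
    refine integral_congr_ae ?_
    filter_upwards [hKiter, ae_law_ne_zero (μ := μ) W] with x h1 h2
    simp only [ha, hYdef]
    rw [Real.log_mul h2 (Finset.prod_ne_zero_iff.2 fun i _ => h1 i), Real.log_prod fun i _ => h1 i]
  have e2 : ∀ i : ℕ, ∫ x, Real.log (K (A (T^[i] x)) (ξ (T^[i] x))) ∂μ =
      ∫ x, Real.log (K (A x) (ξ x)) ∂μ := by
    intro i
    have h1 := (hT.iterate i).map_eq
    have h2 := integral_map (μ := μ) (hT.measurable.iterate i).aemeasurable
      (f := fun x => Real.log (K (A x) (ξ x))) (by rw [h1]; exact (hint 0).aestronglyMeasurable)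
    rw [h1] at h2
    exact h2.symm
  have e3 : ∫ x, Real.log (K (A x) (ξ x)) ∂μ =
      finiteEntropy μ A - finiteEntropy μ (fun x => (A x, ξ x)) := by
    rw [finiteEntropy_eq_integral hA, finiteEntropy_eq_integral hAξ, sub_neg_eq_add, add_comm,
      ← sub_eq_add_neg, ← integral_sub
        (integrable_comp_finite hAξ fun p => Real.log (law μ (fun x => (A x, ξ x)) p))
        (integrable_comp_finite hA fun p => Real.log (law μ A p))]
    refine integral_congr_ae ?_
    filter_upwards [ae_law_ne_zero (μ := μ) A, ae_law_ne_zero (μ := μ) fun x => (A x, ξ x)]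
      with x h1 h2
    exact Real.log_div h2 h1
  refine le_of_eq ?_
  rw [e1, integral_add
    (g := fun x => ∑ i : Fin n, Real.log (K (A (T^[i] x)) (ξ (T^[i] x))))
    (integrable_comp_finite hW fun w => Real.log (law μ W w))
    (integrable_finsetSum _ fun i _ => hint i), integral_finsetSum
    (f := fun (i : Fin n) x => Real.log (K (A (T^[i] x)) (ξ (T^[i] x)))) _ fun i _ => hint i]
  simp only [e2, e3]
  rw [finiteEntropy_eq_integral hW]
  simp
  ring

/-- The right side is the tangent of slope `K`, touching at `exp (-1 - K)`. A steep tangent has a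
small value at zero, so mass on rare events costs `K` times that mass plus an arbitrarily small
error. -/
theorem negMulLog_le_linear (K : ℝ) {t : ℝ} (ht : 0 ≤ t) :
    Real.negMulLog t ≤ K * t + Real.exp (-1 - K) := by
  have := negMulLog_le ht (Real.exp_pos (-1 - K)).le fun h => absurd h (Real.exp_pos _).ne'
  rw [Real.log_exp] at this
  linarith

/-- The conditional entropy of `ξ` given `A` is small if the level sets of `ξ` are close to sets
determined by `A`. -/
theorem finiteEntropy_prod_sub_le [IsProbabilityMeasure μ] {k : ℕ} {ξ : Ω → Fin k}
    (hξ : Measurable ξ) {A : Ω → ι} (hA : Measurable A) {δ K : ℝ} (hK : 0 ≤ K)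
    (E : Fin k → Set ι) (hE : ∀ j, μ.real ((A ⁻¹' E j) ∆ (ξ ⁻¹' {j})) ≤ δ) :
    finiteEntropy μ (fun x => (A x, ξ x)) - finiteEntropy μ A ≤
      k * (δ + (K * δ + Real.exp (-1 - K))) := by
  classical
  have hAξ : Measurable fun x => (A x, ξ x) := hA.prodMk hξ
  set P : ι → Fin k → ℝ := fun v j => law μ (fun x => (A x, ξ x)) (v, j) with hP
  have hPle : ∀ v j, P v j ≤ law μ A v := fun v j =>
    measureReal_mono fun x hx => congrArg Prod.fst hx
  have hP0 : ∀ v j, 0 ≤ P v j := fun v j => law_nonneg _ _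
  have e1 : finiteEntropy μ (fun x => (A x, ξ x)) - finiteEntropy μ A =
      ∑ j, ∑ v, P v j * (Real.log (law μ A v) - Real.log (P v j)) := by
    rw [finiteEntropy_eq_integral hA, finiteEntropy_eq_integral hAξ, sub_neg_eq_add, add_comm,
      ← sub_eq_add_neg, ← integral_sub
        (integrable_comp_finite hA fun p => Real.log (law μ A p))
        (integrable_comp_finite hAξ fun p => Real.log (law μ (fun x => (A x, ξ x)) p)),
      integral_comp_finite hAξ fun p => Real.log (law μ A p.1) -
        Real.log (law μ (fun x => (A x, ξ x)) p), Fintype.sum_prod_type, Finset.sum_comm]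
  -- On `E j` the conditional probability of `ξ = j` should be near one, and the loss is bounded by
  -- the missing mass. Off `E j` it should be near zero, and the tangent of slope `K` applies. Both
  -- exceptional masses lie in the symmetric difference and are at most `δ`.
  have hterm : ∀ v j, P v j * (Real.log (law μ A v) - Real.log (P v j)) ≤
      (if v ∈ E j then law μ A v - P v j else K * P v j) + Real.exp (-1 - K) * law μ A v := by
    intro v j
    have hexp : 0 ≤ Real.exp (-1 - K) * law μ A v := mul_nonneg (Real.exp_pos _).le (law_nonneg _ _)
    rcases (hP0 v j).eq_or_lt with h0 | h0
    · rw [← h0, zero_mul]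
      have := law_nonneg (μ := μ) A v
      split_ifs <;> simp <;> linarith
    have hp : 0 < law μ A v := h0.trans_le (hPle v j)
    split_ifs
    · have := negMulLog_le h0.le hp.le fun h => absurd h hp.ne'
      rw [Real.negMulLog] at this
      linarith
    · have := mul_le_mul_of_nonneg_left
        (negMulLog_le_linear K (div_nonneg h0.le hp.le : 0 ≤ P v j / law μ A v)) hp.le
      rw [Real.negMulLog, Real.log_div h0.ne' hp.ne'] at this
      have e : law μ A v * (-(P v j / law μ A v) * (Real.log (P v j) - Real.log (law μ A v))) =
          P v j * (Real.log (law μ A v) - Real.log (P v j)) := by field_simp; ring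
      have e' : law μ A v * (K * (P v j / law μ A v) + Real.exp (-1 - K)) =
          K * P v j + Real.exp (-1 - K) * law μ A v := by field_simp
      linarith
  have hsum : ∀ (s : Finset ι) (j : Fin k), ∑ v ∈ s, P v j =
      μ.real ((A ⁻¹' s) ∩ (ξ ⁻¹' {j})) := by
    intro s j
    rw [show (A ⁻¹' (s : Set ι)) ∩ (ξ ⁻¹' {j}) = ⋃ v ∈ s, (fun x => (A x, ξ x)) ⁻¹' {(v, j)} by
      ext x; simp, measureReal_biUnion_finset]
    · rfl
    · intro i _ i' _ hij
      refine disjoint_left.2 fun x hx hy => hij ?_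
      exact (congrArg Prod.fst hx).symm.trans (congrArg Prod.fst hy)
    · exact fun v _ => hAξ (measurableSet_singleton _)
  have hsumA : ∀ s : Finset ι, ∑ v ∈ s, law μ A v = μ.real (A ⁻¹' s) := by
    intro s
    rw [show A ⁻¹' (s : Set ι) = ⋃ v ∈ s, A ⁻¹' {v} by ext x; simp, measureReal_biUnion_finset]
    · rfl
    · intro i _ i' _ hij
      refine disjoint_left.2 fun x hx hy => hij ?_
      exact Eq.symm hx |>.trans hy
    · exact fun v _ => hA (measurableSet_singleton _)
  have hδ : ∀ j, ∑ v, P v j * (Real.log (law μ A v) - Real.log (P v j)) ≤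
      δ + (K * δ + Real.exp (-1 - K)) := by
    intro j
    refine (Finset.sum_le_sum fun v _ => hterm v j).trans ?_
    rw [Finset.sum_add_distrib, ← Finset.mul_sum, sum_law hA, mul_one, Finset.sum_ite,
      Finset.sum_sub_distrib, ← Finset.mul_sum, hsum, hsum, hsumA, ← add_assoc]
    have hs : ∀ s : Finset ι, MeasurableSet (A ⁻¹' (s : Set ι)) := fun s => hA s.measurableSet
    have hj : MeasurableSet (ξ ⁻¹' {j}) := hξ (measurableSet_singleton j)
    have h1 : μ.real (A ⁻¹' (Finset.univ.filter (· ∈ E j) : Finset ι)) -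
        μ.real (A ⁻¹' (Finset.univ.filter (· ∈ E j) : Finset ι) ∩ ξ ⁻¹' {j}) ≤ δ := by
      rw [sub_le_iff_le_add', ← measureReal_inter_add_sdiff (s := A ⁻¹' _) hj]
      gcongr
      refine le_trans (measureReal_mono ?_) (hE j)
      intro x hx
      exact Or.inl ⟨by simpa using hx.1, hx.2⟩
    have h2 : μ.real (A ⁻¹' (Finset.univ.filter (· ∉ E j) : Finset ι) ∩ ξ ⁻¹' {j}) ≤ δ := by
      refine le_trans (measureReal_mono ?_) (hE j)
      intro x hx
      exact Or.inr ⟨hx.2, by simpa using hx.1⟩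
    have h3 := mul_le_mul_of_nonneg_left h2 hK
    linarith
  rw [e1]
  refine (Finset.sum_le_sum fun j _ => hδ j).trans ?_
  rw [Finset.sum_const, Finset.card_univ, Fintype.card_fin, nsmul_eq_mul]

end FiniteEntropy

end BetaShift

namespace BetaShift

/-! ### Entropy of invariant measures on a subshift -/

section SymbolicEntropy

open scoped symmDiff

variable {b : ℕ} {X : Subshift (Fin b) ℕ}

/-- The first `n` letters of a point. -/
def firstLetters (X : Subshift (Fin b) ℕ) (n : ℕ) (x : X.carrier) : Fin n → Fin b := fun i => x.1 i

theorem measurable_firstLetters (n : ℕ) : Measurable (firstLetters X n) :=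
  measurable_pi_iff.2 fun i => (measurable_pi_apply (i : ℕ)).comp measurable_subtype_coe

theorem preimage_firstLetters (n : ℕ) (u : Fin n → Fin b) :
    firstLetters X n ⁻¹' {u} = cylinder X (List.ofFn u) := by
  ext x
  rw [mem_cylinder_ofFn]
  rfl

theorem law_firstLetters (ν : Measure X.carrier) (n : ℕ) (u : Fin n → Fin b) :
    law ν (firstLetters X n) u = ν.real (cylinder X (List.ofFn u)) := by
  rw [law, preimage_firstLetters]

theorem ofFn_firstLetters (n : ℕ) (x : X.carrier) :
    List.ofFn (firstLetters X n x) = initialWord x.1 n := rfl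

/-- The entropy of the partition into cylinders of length `n`. -/
noncomputable def wordEntropy (ν : Measure X.carrier) (n : ℕ) : ℝ :=
  finiteEntropy ν (firstLetters X n)

theorem refinedEntropy_zero_letter (ν : Measure X.carrier) (n : ℕ) :
    refinedEntropy ν (shiftMap X) (fun x => x.1 0) n = wordEntropy ν n := by
  refine Finset.sum_congr rfl fun c _ => ?_
  rw [law]
  congr 2
  ext x
  simp [shiftMap_iterate_apply, firstLetters, funext_iff]

theorem wordEntropy_add_le {ν : Measure X.carrier} (hν : IsInvariantProbability X ν) (n m : ℕ) :
    wordEntropy ν (n + m) ≤ wordEntropy ν n + wordEntropy ν m := by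
  have := hν.1
  have hT := hν.2.iterate n
  have hm : Measurable fun x => firstLetters X m ((shiftMap X)^[n] x) :=
    (measurable_firstLetters m).comp hT.measurable
  have h1 := finiteEntropy_prod_le (μ := ν) (measurable_firstLetters n) hm
  have h2 := finiteEntropy_comp_le (μ := ν) ((measurable_firstLetters n).prodMk hm)
    (f := fun p => Fin.append p.1 p.2) (measurable_of_finite _)
  have h3 : (fun x => Fin.append (firstLetters X n x) (firstLetters X m ((shiftMap X)^[n] x))) =
      firstLetters X (n + m) := by
    funext x i
    refine Fin.addCases (fun j => ?_) (fun j => ?_) i <;>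
      simp [firstLetters, shiftMap_iterate_apply]
  have h4 : finiteEntropy ν (fun x => firstLetters X m ((shiftMap X)^[n] x)) =
      wordEntropy ν m := by
    refine Finset.sum_congr rfl fun u _ => ?_
    congr 1
    exact hT.measureReal_preimage
      (measurable_firstLetters m (measurableSet_singleton u)).nullMeasurableSet
  rw [h3] at h2
  rw [h4] at h1
  exact h2.trans h1

theorem wordEntropy_nonneg {ν : Measure X.carrier} [IsProbabilityMeasure ν] (n : ℕ) :
    0 ≤ wordEntropy ν n := finiteEntropy_nonneg _

theorem subadditive_wordEntropy {ν : Measure X.carrier} (hν : IsInvariantProbability X ν) :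
    Subadditive (wordEntropy ν) := wordEntropy_add_le hν

theorem bddBelow_wordEntropy {ν : Measure X.carrier} [IsProbabilityMeasure ν] :
    BddBelow (range fun n : ℕ => wordEntropy ν n / n) := by
  refine ⟨0, ?_⟩
  rintro _ ⟨n, rfl⟩
  exact div_nonneg (wordEntropy_nonneg n) n.cast_nonneg

/-- Sets determined by finitely many letters approximate measurable sets. -/
theorem exists_cylinder_approx (ρ : Measure X.carrier) [IsFiniteMeasure ρ] {B : Set X.carrier}
    (hB : MeasurableSet B) {ε : ℝ} (hε : 0 < ε) :
    ∃ m, ∀ n ≥ m, ∃ E : Set (Fin n → Fin b), ρ.real ((firstLetters X n ⁻¹' E) ∆ B) ≤ ε := by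
  set C : Set (Set X.carrier) := {s | ∃ m, ∃ E : Set (Fin m → Fin b), s = firstLetters X m ⁻¹' E}
    with hCdef
  have hup : ∀ {m n : ℕ}, m ≤ n → ∀ E : Set (Fin m → Fin b), ∃ F : Set (Fin n → Fin b),
      firstLetters X m ⁻¹' E = firstLetters X n ⁻¹' F := by
    intro m n hmn E
    exact ⟨{u | (fun i : Fin m => u (Fin.castLE hmn i)) ∈ E}, rfl⟩
  have hC : IsSetRing C := by
    refine ⟨⟨0, ∅, rfl⟩, ?_, ?_⟩
    · rintro _ _ ⟨m, E, rfl⟩ ⟨m', E', rfl⟩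
      obtain ⟨F, hF⟩ := hup (le_max_left m m') E
      obtain ⟨F', hF'⟩ := hup (le_max_right m m') E'
      exact ⟨_, F ∪ F', by rw [hF, hF']; rfl⟩
    · rintro _ _ ⟨m, E, rfl⟩ ⟨m', E', rfl⟩
      obtain ⟨F, hF⟩ := hup (le_max_left m m') E
      obtain ⟨F', hF'⟩ := hup (le_max_right m m') E'
      exact ⟨_, F \ F', by rw [hF, hF']; rfl⟩
  -- Coordinates generate the Borel sets, so the ring of sets determined by finitely many letters is
  -- dense in measure.
  have hgen : (inferInstance : MeasurableSpace X.carrier) = MeasurableSpace.generateFrom C := by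
    refine le_antisymm ?_ ?_
    · have : @Measurable _ _ (MeasurableSpace.generateFrom C) _
          (Subtype.val : X.carrier → ℕ → Fin b) := by
        refine @measurable_pi_iff _ _ _ (MeasurableSpace.generateFrom C) _ _ |>.2 fun i => ?_
        refine @measurable_to_countable' _ _ _ _ (MeasurableSpace.generateFrom C) _ fun c => ?_
        refine MeasurableSpace.measurableSet_generateFrom
          ⟨i + 1, {u | u (Fin.last i) = c}, ?_⟩
        ext x
        simp [firstLetters]
      exact this.comap_le
    · refine MeasurableSpace.generateFrom_le ?_
      rintro _ ⟨m, E, rfl⟩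
      exact measurable_firstLetters m (Set.toFinite E).measurableSet
  obtain ⟨t, ⟨m, E, rfl⟩, ht⟩ := exists_measure_symmDiff_lt_of_generateFrom_isSetRing (μ := ρ) hC
    ⟨{univ}, countable_singleton _, by rintro _ rfl; exact ⟨0, univ, rfl⟩, by simp⟩ hgen hB
    (ENNReal.ofReal_pos.2 hε)
  refine ⟨m, fun n hn => ?_⟩
  obtain ⟨F, hF⟩ := hup hn E
  refine ⟨F, ?_⟩
  rw [← hF]
  exact ENNReal.toReal_le_of_le_ofReal hε.le ht.le

/-- The partition into cylinders is generating: its entropy bounds that of all partitions. -/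
theorem measureEntropy_le {ν : Measure X.carrier} (hν : IsInvariantProbability X ν) {n : ℕ}
    (hn : 0 < n) : measureEntropy ν (shiftMap X) ≤ ((wordEntropy ν n / n : ℝ) : EReal) := by
  have := hν.1
  refine iSup_le fun k => iSup_le fun ξ => iSup_le fun hξ => ?_
  rw [EReal.coe_le_coe_iff]
  have hlim := (subadditive_wordEntropy hν).tendsto_lim bddBelow_wordEntropy
  refine le_trans ?_ ((subadditive_wordEntropy hν).lim_le_div bddBelow_wordEntropy hn.ne')
  refine le_of_forall_pos_le_add fun ε hε => ?_
  -- `K` is chosen before `δ`: the tangent error must be small first, and only then can the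
  -- approximation make `K * δ` small.
  obtain ⟨K, hK0, hK⟩ : ∃ K : ℝ, 0 ≤ K ∧ k * Real.exp (-1 - K) ≤ ε / 2 := by
    have h1 : Tendsto (fun K : ℝ => k * Real.exp (-1 - K)) atTop (𝓝 (k * 0)) := by
      refine (Real.tendsto_exp_atBot.comp ?_).const_mul _
      exact tendsto_atBot_add_const_left _ _ tendsto_neg_atTop_atBot
    rw [mul_zero] at h1
    obtain ⟨K, h2, h3⟩ := ((h1.eventually_le_const (half_pos hε)).and (eventually_ge_atTop 0)).exists
    exact ⟨K, h3, h2⟩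
  obtain ⟨δ, hδ0, hδ⟩ : ∃ δ : ℝ, 0 < δ ∧ k * ((1 + K) * δ) ≤ ε / 2 := by
    refine ⟨ε / 2 / ((k + 1) * (1 + K)), by positivity, ?_⟩
    rw [mul_div_assoc', mul_div_assoc', div_le_iff₀ (by positivity)]
    nlinarith [mul_pos hε (show (0 : ℝ) < 1 + K by positivity)]
  choose m hm using fun j : Fin k => exists_cylinder_approx (X := X) ν
    (hξ (measurableSet_singleton j)) hδ0
  set M := Finset.univ.sup m
  choose E hE using fun j : Fin k => hm j M (Finset.le_sup (Finset.mem_univ j))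
  have hcond := finiteEntropy_prod_sub_le (μ := ν) hξ (measurable_firstLetters (X := X) M) hK0 E hE
  set η := finiteEntropy ν (fun x => (firstLetters X M x, ξ x)) - finiteEntropy ν (firstLetters X M)
  have hη : η ≤ ε := by
    refine hcond.trans ?_
    calc (k : ℝ) * (δ + (K * δ + Real.exp (-1 - K)))
        = k * ((1 + K) * δ) + k * Real.exp (-1 - K) := by ring
      _ ≤ ε := by linarith
  have hb : ∀ l : ℕ, refinedEntropy ν (shiftMap X) ξ l / l ≤
      wordEntropy ν l / l + (wordEntropy ν M / l + ε) := by
    intro l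
    rcases l.eq_zero_or_pos with rfl | hl
    · simp [hε.le]
    have hl' : (0 : ℝ) < l := by exact_mod_cast hl
    -- The blocks of `M` letters read at the times `0, …, l - 1` are all contained in the first `l +
    -- M` letters. The extra `M` letters cost a fixed entropy, which vanishes after division by `l`.
    have h1 := refinedEntropy_le_add (μ := ν) hν.2 (n := l) hξ (measurable_firstLetters (X := X) M)
      (measurable_firstLetters (X := X) (l + M))
      (fun i u j => u ⟨i + j, by omega⟩) (fun i x => by
        funext j; simp [firstLetters, shiftMap_iterate_apply])
    have h2 := wordEntropy_add_le hν l M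
    rw [div_add' _ _ _ hl'.ne', div_le_div_iff_of_pos_right hl', add_mul,
      div_mul_cancel₀ _ hl'.ne']
    have h3 : (l : ℝ) * η ≤ l * ε := mul_le_mul_of_nonneg_left hη hl'.le
    change _ ≤ wordEntropy ν (l + M) + l * η at h1
    linarith
  have hlim2 : Tendsto (fun l : ℕ => wordEntropy ν l / l + (wordEntropy ν M / l + ε)) atTop
      (𝓝 ((subadditive_wordEntropy hν).lim + (0 + ε))) :=
    hlim.add ((tendsto_const_div_atTop_nhds_zero_nat _).add tendsto_const_nhds)
  rw [zero_add] at hlim2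
  rw [← hlim2.limsup_eq]
  refine limsup_le_limsup (Eventually.of_forall hb) ?_ hlim2.isBoundedUnder_le
  refine IsBoundedUnder.isCoboundedUnder_le ⟨0, ?_⟩
  refine eventually_map.2 (Eventually.of_forall fun l => div_nonneg ?_ l.cast_nonneg)
  exact Finset.sum_nonneg fun _ _ => Real.negMulLog_nonneg measureReal_nonneg measureReal_le_one

/-- A single partition suffices for a lower bound: the one by the letter at time zero, whose
refinements are the cylinders. The constant `C` vanishes after division by `n`. -/
theorem le_measureEntropy {ν : Measure X.carrier} (hν : IsInvariantProbability X ν) {c C : ℝ}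
    (h : ∀ n : ℕ, n * c - C ≤ wordEntropy ν n) : (c : EReal) ≤ measureEntropy ν (shiftMap X) := by
  have := hν.1
  have hmeas : Measurable fun x : X.carrier => x.1 0 :=
    (measurable_pi_apply 0).comp measurable_subtype_coe
  refine le_trans ?_ (le_iSup_of_le b (le_iSup_of_le (fun x => x.1 0) (le_iSup_of_le hmeas le_rfl)))
  rw [EReal.coe_le_coe_iff, partitionEntropy]
  have hlim := (subadditive_wordEntropy hν).tendsto_lim bddBelow_wordEntropy
  simp only [refinedEntropy_zero_letter]
  rw [hlim.limsup_eq]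
  have h2 : Tendsto (fun n : ℕ => c - C / n) atTop (𝓝 (c - 0)) :=
    tendsto_const_nhds.sub (tendsto_const_div_atTop_nhds_zero_nat _)
  rw [sub_zero] at h2
  refine le_of_tendsto_of_tendsto h2 hlim (eventually_atTop.2 ⟨1, fun n hn => ?_⟩)
  have hn' : (0 : ℝ) < n := by exact_mod_cast hn
  change c - C / n ≤ wordEntropy ν n / n
  rw [le_div_iff₀ hn']
  have h3 : (c - C / n) * n = n * c - C := by field_simp
  rw [h3]
  exact h n

end SymbolicEntropy

/-! ### The variational inequality -/

section Variational

variable {b : ℕ} {X : Subshift (Fin b) ℕ} {φ : C(X.carrier, ℝ)}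

theorem integral_birkhoffSum {ν : Measure X.carrier} (hν : IsInvariantProbability X ν) (n : ℕ) :
    ∫ x, birkhoffSum (shiftMap X) φ n x ∂ν = n * ∫ x, φ x ∂ν := by
  have := hν.1
  have hint : ∀ i : ℕ, Integrable (fun x => φ ((shiftMap X)^[i] x)) ν := fun i =>
    (φ.continuous.comp (continuous_shiftMap.iterate i)).integrable_of_hasCompactSupport
      (HasCompactSupport.of_compactSpace _)
  simp only [birkhoffSum]
  rw [integral_finsetSum _ fun i _ => hint i]
  have h : ∀ i : ℕ, ∫ x, φ ((shiftMap X)^[i] x) ∂ν = ∫ x, φ x ∂ν := by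
    intro i
    have h1 := (hν.2.iterate i).map_eq
    have h2 := integral_map (μ := ν) (hν.2.measurable.iterate i).aemeasurable (f := φ)
      φ.continuous.aestronglyMeasurable
    rw [h1] at h2
    exact h2.symm
  simp [h]

/-- Gibbs' inequality for a vector of total mass `s` that need not be one, compared with `a`
rescaled to mass `s`. It is applied to the restriction of a measure to a set of words. -/
theorem sum_negMulLog_add_le {ι : Type*} [Fintype ι] {p a : ι → ℝ} (hp : ∀ i, 0 ≤ p i)
    (ha : ∀ i, 0 ≤ a i) (h : ∀ i, a i = 0 → p i = 0) :
    ∑ i, Real.negMulLog (p i) + ∑ i, p i * Real.log (a i) ≤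
      (∑ i, p i) * Real.log (∑ i, a i) + Real.negMulLog (∑ i, p i) := by
  set s := ∑ i, p i with hs
  set A := ∑ i, a i with hA
  rcases (Finset.sum_nonneg fun i _ => hp i : 0 ≤ s).eq_or_lt with h0 | h0
  · have hz : ∀ i, p i = 0 := fun i =>
      (Finset.sum_eq_zero_iff_of_nonneg fun i _ => hp i).1 h0.symm i (Finset.mem_univ i)
    have hs0 : s = 0 := h0.symm
    simp [hz, hs0]
  obtain ⟨i, -, hi⟩ : ∃ i ∈ Finset.univ, 0 < p i := Finset.exists_lt_of_sum_lt (by simpa using h0)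
  have hai : 0 < a i := lt_of_le_of_ne (ha i) fun h' => hi.ne' (h i h'.symm)
  have hA0 : 0 < A := hai.trans_le (Finset.single_le_sum (fun j _ => ha j) (Finset.mem_univ i))
  have h1 : ∀ j, Real.negMulLog (p j) + p j * Real.log (a j) ≤
      p j * Real.log A - p j * Real.log s + (s / A * a j - p j) := by
    intro j
    have h2 := negMulLog_le (hp j) (mul_nonneg (div_pos h0 hA0).le (ha j)) fun h' =>
      h j ((mul_eq_zero.1 h').resolve_left (div_pos h0 hA0).ne')
    rcases (hp j).eq_or_lt with hj | hj
    · rw [← hj] at h2 ⊢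
      simpa using mul_nonneg (div_pos h0 hA0).le (ha j)
    · have haj : a j ≠ 0 := fun h' => hj.ne' (h j h')
      rw [Real.log_mul (div_pos h0 hA0).ne' haj, Real.log_div h0.ne' hA0.ne'] at h2
      linarith
  have h3 := Finset.sum_le_sum fun j (_ : j ∈ Finset.univ) => h1 j
  rw [Finset.sum_add_distrib, Finset.sum_add_distrib, Finset.sum_sub_distrib,
    Finset.sum_sub_distrib, ← Finset.sum_mul, ← Finset.sum_mul, ← Finset.mul_sum, ← hs, ← hA,
    div_mul_cancel₀ _ hA0.ne'] at h3
  rw [Real.negMulLog]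
  linarith

open Classical in
/-- Entropy plus integral is bounded by the partition sums over a set of words and over its
complement, weighted by the measures of these sets. -/
theorem wordEntropy_add_integral_le {ν : Measure X.carrier} (hν : IsInvariantProbability X ν)
    (D : Set (List (Fin b))) (n : ℕ) :
    wordEntropy ν n + n * ∫ x, φ x ∂ν ≤
      ν.real {x | initialWord x.1 n ∈ D} * Real.log (partitionSum X φ D n) +
        ν.real {x | initialWord x.1 n ∈ Dᶜ} * Real.log (partitionSum X φ Dᶜ n) + 2 := by
  have := hν.1
  set p : (Fin n → Fin b) → ℝ := law ν (firstLetters X n) with hp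
  have hmeas := measurable_firstLetters (X := X) n
  obtain ⟨q, hq⟩ : ∃ q : Set (List (Fin b)) → (Fin n → Fin b) → ℝ,
    q = fun E u => if List.ofFn u ∈ E then p u else 0 := ⟨_, rfl⟩
  have hsum : ∀ E : Set (List (Fin b)), ∑ u, q E u =
      ν.real {x | initialWord x.1 n ∈ E} := by
    intro E
    have h1 := integral_comp_finite (μ := ν) hmeas fun u => if List.ofFn u ∈ E then 1 else 0
    simp only [mul_ite, mul_one, mul_zero] at h1
    simp only [hq]
    rw [← h1]
    have h2 : MeasurableSet {x : X.carrier | initialWord x.1 n ∈ E} :=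
      hmeas (Set.toFinite {u : Fin n → Fin b | List.ofFn u ∈ E}).measurableSet
    rw [← integral_indicator_one h2]
    rfl
  have hpos : ∀ u, p u ≠ 0 → List.ofFn u ∈ language X := by
    intro u hu
    rw [hp, law_firstLetters] at hu
    by_contra h
    rw [not_nonempty_iff_eq_empty.1 h] at hu
    simp at hu
  have hE : ∀ E : Set (List (Fin b)),
      ∑ u, Real.negMulLog (q E u) +
        ∑ u, q E u * supBirkhoff X φ (List.ofFn u) ≤
      ν.real {x | initialWord x.1 n ∈ E} * Real.log (partitionSum X φ E n) + 1 := by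
    intro E
    have h1 := sum_negMulLog_add_le (p := q E)
      (a := fun u : Fin n → Fin b => upperWeight X φ E (List.ofFn u))
      (fun u => by rw [hq]; dsimp only; split_ifs; exacts [law_nonneg _ _, le_rfl])
      (fun u => upperWeight_nonneg _ _) (fun u hu => by
        rw [hq]
        dsimp only
        split_ifs with huE
        · by_contra hpu
          rw [upperWeight_of_mem huE (hpos u hpu)] at hu
          exact (Real.exp_pos _).ne' hu
        · rfl)
    rw [hsum] at h1
    have h2 : ∀ u : Fin n → Fin b, q E u *
        Real.log (upperWeight X φ E (List.ofFn u)) =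
        q E u * supBirkhoff X φ (List.ofFn u) := by
      intro u
      rw [hq]
      dsimp only
      split_ifs with huE
      · by_cases hpu : p u = 0
        · simp [hpu]
        · rw [upperWeight_of_mem huE (hpos u hpu), Real.log_exp]
      · simp
    simp only [h2] at h1
    refine h1.trans (add_le_add le_rfl ?_)
    -- The tangent of slope `-1` gives `negMulLog t ≤ 1 - t ≤ 1`. One such error for `D` and one for
    -- its complement make up the `2`.
    have h3 := negMulLog_le_linear (-1) (measureReal_nonneg (μ := ν)
      (s := {x : X.carrier | initialWord x.1 n ∈ E}))
    have h4 := measureReal_nonneg (μ := ν) (s := {x : X.carrier | initialWord x.1 n ∈ E})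
    norm_num at h3
    linarith
  have hD := hE D
  have hDc := hE Dᶜ
  have e1 : wordEntropy ν n = ∑ u, Real.negMulLog (q D u) +
      ∑ u, Real.negMulLog (q Dᶜ u) := by
    rw [← Finset.sum_add_distrib]
    refine Finset.sum_congr rfl fun u _ => ?_
    by_cases hu : List.ofFn u ∈ D <;> simp [hu, hp, hq]
  have e2 : n * ∫ x, φ x ∂ν ≤
      ∑ u, q D u * supBirkhoff X φ (List.ofFn u) +
      ∑ u, q Dᶜ u * supBirkhoff X φ (List.ofFn u) := by
    rw [← Finset.sum_add_distrib, ← integral_birkhoffSum hν]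
    have h1 := integral_comp_finite (μ := ν) hmeas fun u => supBirkhoff X φ (List.ofFn u)
    have h2 : ∑ u, p u * supBirkhoff X φ (List.ofFn u) =
        ∑ u, (q D u * supBirkhoff X φ (List.ofFn u) +
        q Dᶜ u * supBirkhoff X φ (List.ofFn u)) := by
      refine Finset.sum_congr rfl fun u _ => ?_
      by_cases hu : List.ofFn u ∈ D <;> simp [hu, hq]
    rw [← h2, ← h1]
    refine integral_mono ?_ (integrable_comp_finite hmeas fun u => supBirkhoff X φ (List.ofFn u)) ?_
    · refine Continuous.integrable_of_hasCompactSupport ?_ (HasCompactSupport.of_compactSpace _)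
      exact continuous_finsetSum _ fun i _ => φ.continuous.comp (continuous_shiftMap.iterate i)
    · intro x
      have := birkhoffSum_le_supBirkhoff (φ := φ) (mem_cylinder_initialWord x n)
      rw [length_initialWord] at this
      exact this
  linarith

theorem partitionSum_univ (n : ℕ) :
    partitionSum X φ univ n = partitionSum X φ (language X) n := by
  simp [partitionSum]

/-- The variational inequality. -/
theorem measureEntropy_add_integral_le [Nonempty X.carrier] {ν : Measure X.carrier}
    (hν : IsInvariantProbability X ν) :
    measureEntropy ν (shiftMap X) + ((∫ x, φ x ∂ν : ℝ) : EReal) ≤ (pressure X φ : EReal) := by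
  have := hν.1
  have h1 : ∀ n : ℕ, wordEntropy ν n + n * ∫ x, φ x ∂ν ≤
      Real.log (partitionSum X φ (language X) n) + 2 := by
    intro n
    have h := wordEntropy_add_integral_le (φ := φ) hν univ n
    simpa [partitionSum_univ] using h
  have h2 : measureEntropy ν (shiftMap X) ≤ ((pressure X φ - ∫ x, φ x ∂ν : ℝ) : EReal) := by
    have h3 : Tendsto (fun n : ℕ => Real.log (partitionSum X φ (language X) n) / n + 2 / n -
        ∫ x, φ x ∂ν) atTop (𝓝 (pressure X φ + 0 - ∫ x, φ x ∂ν)) :=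
      (tendsto_log_partitionSum.add (tendsto_const_div_atTop_nhds_zero_nat _)).sub_const _
    rw [add_zero] at h3
    refine ge_of_tendsto ((continuous_coe_real_ereal.tendsto _).comp h3)
      (eventually_atTop.2 ⟨1, fun n hn => ?_⟩)
    have hn' : (0 : ℝ) < n := by exact_mod_cast hn
    refine (measureEntropy_le hν hn).trans (EReal.coe_le_coe_iff.2 ?_)
    change wordEntropy ν n / n ≤ Real.log (partitionSum X φ (language X) n) / n + 2 / n -
      ∫ x, φ x ∂ν
    rw [← add_div, le_sub_iff_add_le, div_add' _ _ _ hn'.ne', div_le_div_iff_of_pos_right hn']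
    linarith [h1 n]
  refine (add_le_add_left h2 _).trans ?_
  rw [← EReal.coe_add, sub_add_cancel]

end Variational

end BetaShift

namespace BetaShift

/-! ### Periodic orbit measures and their Gibbs bounds -/

section Periodic

variable {b : ℕ} {X : Subshift (Fin b) ℕ} {φ : C(X.carrier, ℝ)} {Lp : Set (List (Fin b))}

theorem sum_le_sum_of_injOn {ι κ : Type*} [DecidableEq κ] {s : Finset ι} {t : Finset κ} {e : ι → κ}
    (he : Set.InjOn e s) (hmaps : ∀ i ∈ s, e i ∈ t) {f : ι → ℝ} {F : κ → ℝ}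
    (hf : ∀ i ∈ s, f i ≤ F (e i)) (hF : ∀ j ∈ t, 0 ≤ F j) : ∑ i ∈ s, f i ≤ ∑ j ∈ t, F j := by
  refine (Finset.sum_le_sum hf).trans ?_
  rw [← Finset.sum_image (f := F) he]
  exact Finset.sum_le_sum_of_subset_of_nonneg (Finset.image_subset_iff.2 hmaps)
    fun j hj _ => hF j hj

/-- A point of period `n` repeats its first `n` letters. Periodic points can therefore be counted by
words. -/
theorem eq_of_mem_periodicPoints {n : ℕ} (hn : 0 < n) {x y : X.carrier}
    (hx : x ∈ periodicPoints X n) (hy : y ∈ periodicPoints X n)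
    (h : initialWord x.1 n = initialWord y.1 n) : x = y := by
  have hper : ∀ z ∈ periodicPoints X n, ∀ i, z.1 (n + i) = z.1 i := fun z hz i => by
    rw [← shiftMap_iterate_apply, (show (shiftMap X)^[n] z = z from hz)]
  rw [initialWord_eq_iff] at h
  refine Subtype.ext (funext fun i => ?_)
  induction i using Nat.strong_induction_on with
  | _ i ih =>
    rcases lt_or_ge i n with hi | hi
    · exact h i hi
    · obtain ⟨j, rfl⟩ := Nat.exists_eq_add_of_le hi
      rw [hper x hx, hper y hy]
      exact ih j (by omega)

theorem finite_periodicPoints {n : ℕ} (hn : 0 < n) : (periodicPoints X n).Finite :=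
  Set.Finite.of_injOn (f := firstLetters X n) (t := univ) (mapsTo_univ _ _)
    (fun _ hx _ hy h => eq_of_mem_periodicPoints hn hx hy (by
      rw [← ofFn_firstLetters, ← ofFn_firstLetters, h])) (Set.toFinite _)

/-- The points of period `n`, as a finite set. -/
noncomputable def periodicFinset (X : Subshift (Fin b) ℕ) {n : ℕ} (hn : 0 < n) :
    Finset X.carrier := (finite_periodicPoints (X := X) hn).toFinset

theorem mem_periodicFinset {n : ℕ} {hn : 0 < n} {x : X.carrier} :
    x ∈ periodicFinset X hn ↔ (shiftMap X)^[n] x = x :=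
  Set.Finite.mem_toFinset _

/-- The sum of `exp (S_n φ) g` over the points of period `n`. -/
noncomputable def periodicSum (X : Subshift (Fin b) ℕ) (φ : C(X.carrier, ℝ)) {n : ℕ} (hn : 0 < n)
    (g : X.carrier → ℝ) : ℝ :=
  ∑ x ∈ periodicFinset X hn, Real.exp (birkhoffSum (shiftMap X) φ n x) * g x

theorem periodicMeasure_eq {n : ℕ} (hn : 0 < n) :
    periodicMeasure X φ n = (ENNReal.ofReal (periodicSum X φ hn fun _ => 1))⁻¹ •
      ∑ x ∈ periodicFinset X hn,
        ENNReal.ofReal (Real.exp (birkhoffSum (shiftMap X) φ n x)) • Measure.dirac x := by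
  have := (finite_periodicPoints (X := X) hn).fintype
  have hset : periodicFinset X hn = (periodicPoints X n).toFinset := by
    ext x
    simp [periodicFinset]
  rw [periodicMeasure, Measure.sum_fintype, tsum_fintype, periodicSum,
    ENNReal.ofReal_sum_of_nonneg fun x _ => by positivity, hset, ← Finset.sum_set_coe, ← Finset.sum_set_coe]
  simp only [mul_one]

theorem periodicSum_one_pos {n : ℕ} (hn : 0 < n) (h : ∃ x, x ∈ periodicFinset X hn) :
    0 < periodicSum X φ hn fun _ => 1 :=
  Finset.sum_pos (fun x _ => by positivity) h

theorem integral_periodicMeasure {n : ℕ} (hn : 0 < n) (g : X.carrier → ℝ) :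
    ∫ x, g x ∂(periodicMeasure X φ n) =
      periodicSum X φ hn g / periodicSum X φ hn fun _ => 1 := by
  have h0 : 0 ≤ periodicSum X φ hn fun _ => 1 := Finset.sum_nonneg fun x _ => by positivity
  rw [periodicMeasure_eq hn, integral_smul_measure, integral_finsetSum_measure fun x _ => ?_]
  · rw [ENNReal.toReal_inv, ENNReal.toReal_ofReal h0, smul_eq_mul, div_eq_inv_mul]
    congr 1
    refine Finset.sum_congr rfl fun x _ => ?_
    rw [integral_smul_measure, integral_dirac, ENNReal.toReal_ofReal (Real.exp_pos _).le,
      smul_eq_mul]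
  · exact Integrable.smul_measure (integrable_dirac (by finiteness)) ENNReal.ofReal_ne_top

theorem isProbabilityMeasure_periodicMeasure {n : ℕ} (hn : 0 < n)
    (h : ∃ x, x ∈ periodicFinset X hn) : IsProbabilityMeasure (periodicMeasure X φ n) := by
  have h0 := periodicSum_one_pos (φ := φ) hn h
  refine ⟨?_⟩
  rw [periodicMeasure_eq hn]
  simp only [Measure.smul_apply, Measure.coe_finsetSum, Finset.sum_apply, smul_eq_mul,
    measure_univ, mul_one]
  rw [← ENNReal.ofReal_sum_of_nonneg fun x _ => (Real.exp_pos _).le]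
  have h1 : ∑ x ∈ periodicFinset X hn, Real.exp (birkhoffSum (shiftMap X) φ n x) =
      periodicSum X φ hn fun _ => 1 := by simp [periodicSum]
  rw [h1]
  exact ENNReal.inv_mul_cancel (ENNReal.ofReal_pos.2 h0).ne' ENNReal.ofReal_ne_top

/-- The shift permutes the points of period `n`, and `S_n φ` is unchanged along the orbit because
`S_n φ(Tx) - S_n φ(x) = φ(Tⁿx) - φ(x) = 0`. Invariance of the limit measures rests on this. -/
theorem periodicSum_comp_shiftMap {n : ℕ} (hn : 0 < n) (g : X.carrier → ℝ) :
    periodicSum X φ hn (fun x => g (shiftMap X x)) = periodicSum X φ hn g := by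
  refine Finset.sum_nbij (shiftMap X) ?_ ?_ ?_ ?_
  · intro x hx
    rw [mem_periodicFinset] at hx ⊢
    rw [← Function.iterate_succ_apply, Function.iterate_succ_apply', hx]
  · intro x hx y hy hxy
    have hx' := mem_periodicFinset.1 hx
    have hy' := mem_periodicFinset.1 hy
    obtain ⟨m, rfl⟩ := Nat.exists_eq_add_of_le' hn
    rw [← hx', ← hy', Function.iterate_succ_apply, Function.iterate_succ_apply, hxy]
  · intro x hx
    have hx' := mem_periodicFinset.1 hx
    obtain ⟨m, rfl⟩ := Nat.exists_eq_add_of_le' hn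
    refine ⟨(shiftMap X)^[m] x, mem_periodicFinset.2 ?_, ?_⟩
    · rw [← Function.iterate_add_apply, add_comm, Function.iterate_add_apply, hx']
    · exact (Function.iterate_succ_apply' _ _ _).symm.trans hx'
  · intro x hx
    have h1 := birkhoffSum_apply_sub_birkhoffSum (shiftMap X) φ n x
    rw [mem_periodicFinset.1 hx, sub_self, sub_eq_zero] at h1
    rw [h1]

theorem wordSum_ite_eq (w : List (Fin b)) (c : ℝ) :
    wordSum w.length (fun u => if u = w then c else 0) = c := by
  rw [wordSum, Finset.sum_eq_single w.get]
  · simp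
  · intro u _ hu
    rw [if_neg fun h => hu ?_]
    apply List.ofFn_injective
    rw [h, List.ofFn_get]
  · simp

/-- Upper bound for the periodic sum over a cylinder. -/
theorem periodicSum_cylinder_le (w : List (Fin b)) {m : ℕ}
    (hn : 0 < w.length + m) :
    periodicSum X φ hn ((cylinder X w).indicator 1) ≤
      Real.exp (supBirkhoff X φ w) * partitionSum X φ (language X) m := by
  classical
  have h1 : wordSum (w.length + m) (fun w' => if w'.take w.length = w then
      Real.exp (supBirkhoff X φ w) * upperWeight X φ (language X) (w'.drop w.length) else 0) =
      Real.exp (supBirkhoff X φ w) * partitionSum X φ (language X) m := by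
    rw [wordSum_add, partitionSum_eq, ← wordSum_mul_left, ← wordSum_ite_eq w (wordSum m _)]
    refine wordSum_congr fun u hu => ?_
    split_ifs with h
    · refine wordSum_congr fun v _ => ?_
      rw [← hu, List.take_left, List.drop_left, if_pos (by rw [h])]
    · simp only [← hu, List.take_left]
      simp [wordSum, h]
  rw [← h1]
  refine sum_le_sum_of_injOn (e := firstLetters X (w.length + m)) ?_ (fun _ _ => Finset.mem_univ _)
    ?_ ?_
  · intro x hx y hy hxy
    exact eq_of_mem_periodicPoints hn (mem_periodicFinset.1 hx) (mem_periodicFinset.1 hy)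
      (by rw [← ofFn_firstLetters, ← ofFn_firstLetters, hxy])
  · intro x _
    rw [ofFn_firstLetters, initialWord_add]
    beta_reduce
    by_cases hxw : x ∈ cylinder X w
    · have h2 := mem_cylinder_iff.1 hxw
      rw [indicator_of_mem hxw, Pi.one_apply, mul_one, h2, List.take_left, List.drop_left,
        if_pos rfl, ← shiftMap_iterate_val,
        upperWeight_of_mem (initialWord_mem_language _ _) (initialWord_mem_language _ _),
        ← Real.exp_add, birkhoffSum_add]
      refine Real.exp_le_exp.2 (add_le_add (birkhoffSum_le_supBirkhoff hxw) ?_)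
      have h3 := birkhoffSum_le_supBirkhoff (φ := φ)
        (mem_cylinder_initialWord ((shiftMap X)^[w.length] x) m)
      rwa [length_initialWord] at h3
    · rw [indicator_of_notMem hxw, mul_zero]
      split_ifs
      · exact mul_nonneg (Real.exp_pos _).le (upperWeight_nonneg _ _)
      · exact le_rfl
  · intro u _
    beta_reduce
    split_ifs
    · exact mul_nonneg (Real.exp_pos _).le (upperWeight_nonneg _ _)
    · exact le_rfl

/-- Lower bound for the periodic sum over the cylinder of a word that can be completed to a
loop. -/
theorem le_periodicSum_cylinder [Nonempty X.carrier] (h : IsLoopSystem X Lp) {w u : List (Fin b)}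
    (hwu : w ++ u ∈ Lp) {n m : ℕ} (hn : 0 < n) (hnm : n = w.length + u.length + m) :
    Real.exp (infBirkhoff X φ w - u.length * ‖φ‖) * loopSum X φ Lp m ≤
      periodicSum X φ hn ((cylinder X w).indicator 1) := by
  classical
  -- Each loop `v` of length `m` makes `w ++ u ++ v` a loop of length `n`, hence yields a periodic
  -- point in `[w]` from which `v` can be read off. Words that are not loops get an arbitrary value.
  have hex : ∀ v : Fin m → Fin b, ∃ p : X.carrier, List.ofFn v ∈ Lp →
      p ∈ periodicFinset X hn ∧ p ∈ cylinder X (w ++ u ++ List.ofFn v) := by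
    intro v
    by_cases hv : List.ofFn v ∈ Lp
    · have hl : (w ++ u ++ List.ofFn v).length = n := by simp [hnm, add_assoc]
      obtain ⟨p, hp, hper⟩ := h.exists_periodic _ (h.append_mem _ hwu _ hv) (by
        rw [← List.length_pos_iff_ne_nil, hl]; exact hn)
      rw [hl] at hper
      exact ⟨p, fun _ => ⟨mem_periodicFinset.2 hper, hp⟩⟩
    · exact ⟨Classical.arbitrary _, fun h => absurd h hv⟩
  choose p hp using hex
  have hsum : loopSum X φ Lp m = ∑ v ∈ Finset.univ.filter fun v : Fin m → Fin b => List.ofFn v ∈ Lp,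
      lowerWeight X φ Lp (List.ofFn v) := by
    rw [loopSum, wordSum, Finset.sum_filter]
    refine Finset.sum_congr rfl fun v _ => ?_
    split_ifs with hv
    · rfl
    · exact lowerWeight_of_notMem fun h' => hv h'.1
  rw [hsum, Finset.mul_sum]
  refine sum_le_sum_of_injOn (e := p) ?_ ?_ ?_ ?_
  · intro v hv v' hv' hvv
    have h1 := mem_cylinder_append.1 (hp v (Finset.mem_filter.1 hv).2).2
    have h2 := mem_cylinder_append.1 (hp v' (Finset.mem_filter.1 hv').2).2
    rw [hvv] at h1
    have h3 := mem_cylinder_ofFn.1 h1.2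
    exact h3.symm.trans (mem_cylinder_ofFn.1 h2.2)
  · exact fun v hv => (hp v (Finset.mem_filter.1 hv).2).1
  · intro v hv
    have hvL := (Finset.mem_filter.1 hv).2
    have h1 := (hp v hvL).2
    have h2 := mem_cylinder_append.1 h1
    have h3 := mem_cylinder_append.1 h2.1
    rw [indicator_of_mem h3.1, Pi.one_apply, mul_one,
      lowerWeight_of_mem hvL (h.subset_language hvL), ← Real.exp_add]
    refine Real.exp_le_exp.2 ?_
    have h4 := infBirkhoff_le_birkhoffSum (φ := φ) h1
    have h5 := infBirkhoff_add_le (φ := φ) ⟨_, h1⟩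
    have h6 := infBirkhoff_sub_le_append (φ := φ) ⟨_, h2.1⟩
    have hl : (w ++ u ++ List.ofFn v).length = n := by simp [hnm, add_assoc]
    rw [hl] at h4
    linarith
  · exact fun x _ => mul_nonneg (Real.exp_pos _).le (indicator_nonneg (fun _ _ => zero_le_one) _)

/-- The Gibbs property: an upper bound for all words of the language, and a lower bound for good
words. -/
def IsGibbs (X : Subshift (Fin b) ℕ) (φ : C(X.carrier, ℝ)) (Lp : Set (List (Fin b)))
    (μ : Measure X.carrier) (K' : ℝ) (K : ℕ → ℝ → ℝ) : Prop :=
  (∀ w ∈ language X, μ.real (cylinder X w) ≤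
    K' * Real.exp (-(w.length * pressure X φ) + supBirkhoff X φ w)) ∧
  ∀ (T : ℕ) (V : ℝ), ∀ w ∈ goodWords X φ Lp T V,
    K T V * Real.exp (-(w.length * pressure X φ) + supBirkhoff X φ w) ≤ μ.real (cylinder X w)

theorem periodicMeasure_real_cylinder {n : ℕ} (hn : 0 < n) (w : List (Fin b)) :
    (periodicMeasure X φ n).real (cylinder X w) =
      periodicSum X φ hn ((cylinder X w).indicator 1) / periodicSum X φ hn fun _ => 1 := by
  rw [← integral_indicator_one (measurableSet_cylinder w), integral_periodicMeasure hn]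

theorem supBirkhoff_nil [Nonempty X.carrier] : supBirkhoff X φ [] = 0 :=
  le_antisymm (by simpa using supBirkhoff_le_mul_norm (φ := φ) nil_mem_language)
    (le_trans (by simpa using neg_mul_norm_le_infBirkhoff (φ := φ) nil_mem_language)
      (infBirkhoff_le_supBirkhoff nil_mem_language))

theorem infBirkhoff_nil [Nonempty X.carrier] : infBirkhoff X φ [] = 0 :=
  le_antisymm ((infBirkhoff_le_supBirkhoff nil_mem_language).trans supBirkhoff_nil.le)
    (by simpa using neg_mul_norm_le_infBirkhoff (φ := φ) nil_mem_language)

/-- The periodic orbit measures satisfy the Gibbs bounds for every word, from some period on. -/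
theorem exists_eventually_gibbs [Nonempty X.carrier] (h : IsLoopSystem X Lp)
    (hT : TailSmall X φ Lp) :
    ∃ K' > 0, ∃ K : ℕ → ℝ → ℝ, (∀ T V, 0 < K T V) ∧
      (∀ w ∈ language X, ∀ᶠ n in atTop, (periodicMeasure X φ n).real (cylinder X w) ≤
        K' * Real.exp (-(w.length * pressure X φ) + supBirkhoff X φ w)) ∧
      ∀ (T : ℕ) (V : ℝ), ∀ w ∈ goodWords X φ Lp T V, ∀ᶠ n in atTop,
        K T V * Real.exp (-(w.length * pressure X φ) + supBirkhoff X φ w) ≤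
          (periodicMeasure X φ n).real (cylinder X w) := by
  obtain ⟨Q, hQ, hQn⟩ := exists_partitionSum_language_le h hT
  obtain ⟨c, hc, N, hcn⟩ := exists_le_loopSum h hT
  set P := pressure X φ with hP
  have hcyl : ((cylinder X ([] : List (Fin b))).indicator 1 : X.carrier → ℝ) = fun _ => 1 := by
    funext x
    rw [indicator_of_mem (by simp [cylinder])]
    rfl
  have hlow : ∀ n (hn : 0 < n), N ≤ n → c * Real.exp (n * P) ≤ periodicSum X φ hn fun _ => 1 := by
    intro n hn hNn
    have h1 := le_periodicSum_cylinder (φ := φ) h (w := []) (u := []) (by simpa using h.nil_mem) hn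
      (m := n) (by simp)
    rw [hcyl, infBirkhoff_nil] at h1
    simp only [List.length_nil, Nat.cast_zero, zero_mul, sub_zero, Real.exp_zero, one_mul] at h1
    exact (hcn n hNn).trans h1
  have hupp : ∀ n (hn : 0 < n), (periodicSum X φ hn fun _ => 1) ≤ Q * Real.exp (n * P) := by
    intro n hn
    have h1 := periodicSum_cylinder_le (φ := φ) [] (m := n) (by simpa using hn)
    rw [hcyl, supBirkhoff_nil, Real.exp_zero, one_mul] at h1
    simp only [List.length_nil, zero_add] at h1
    exact h1.trans (hQn n)
  -- The normalising sum lies between `c * exp (n P)` and `Q * exp (n P)`. Above, the free part of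
  -- the period contributes at most `Q * exp (m P)`. Below, loops contribute at least `c * exp (m
  -- P)`, where `T` letters are spent on the completion, and `V` is the loss from supremum to
  -- infimum on `[w]`.
  refine ⟨Q / c, by positivity, fun T V => Real.exp (-V - T * ‖φ‖ - T * P) * (c / Q),
    fun T V => by positivity, fun w hw => ?_, fun T V w hw => ?_⟩
  · refine eventually_atTop.2 ⟨w.length + N + 1, fun n hn => ?_⟩
    obtain ⟨m, rfl⟩ : ∃ m, n = w.length + m := ⟨n - w.length, by omega⟩
    have hn0 : 0 < w.length + m := by omega
    rw [periodicMeasure_real_cylinder hn0,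
      div_le_iff₀ ((by positivity : (0 : ℝ) < _).trans_le (hlow _ hn0 (by omega)))]
    refine (periodicSum_cylinder_le w hn0).trans ?_
    refine (mul_le_mul_of_nonneg_left (hQn m) (Real.exp_pos _).le).trans ?_
    refine le_trans (le_of_eq ?_) (mul_le_mul_of_nonneg_left (hlow _ hn0 (by omega))
      (by positivity))
    rw [show Q / c * Real.exp (-(w.length * P) + supBirkhoff X φ w) *
      (c * Real.exp ((w.length + m : ℕ) * P)) = Q * (c / c) *
      (Real.exp (-(w.length * P) + supBirkhoff X φ w) * Real.exp ((w.length + m : ℕ) * P)) by ring,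
      div_self hc.ne', ← Real.exp_add, mul_one, mul_left_comm, ← Real.exp_add]
    push_cast
    ring_nf
  · refine eventually_atTop.2 ⟨w.length + T + N + 1, fun n hn => ?_⟩
    obtain ⟨hL, ⟨u, hu, hwu⟩, hV⟩ := hw
    obtain ⟨m, hm⟩ : ∃ m, n = w.length + u.length + m := ⟨n - (w.length + u.length), by omega⟩
    have hn0 : 0 < n := by omega
    have hNn : N ≤ m := by omega
    rw [periodicMeasure_real_cylinder hn0,
      le_div_iff₀ ((by positivity : (0 : ℝ) < _).trans_le (hlow _ hn0 (by omega)))]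
    refine le_trans ?_ (le_periodicSum_cylinder h hwu hn0 hm)
    refine (mul_le_mul_of_nonneg_left (hupp n hn0) (by positivity)).trans ?_
    refine le_trans ?_ (mul_le_mul_of_nonneg_left (hcn m hNn) (Real.exp_pos _).le)
    rw [show Real.exp (-V - T * ‖φ‖ - T * P) * (c / Q) *
      Real.exp (-(w.length * P) + supBirkhoff X φ w) * (Q * Real.exp (n * P)) = c * (Q / Q) *
      (Real.exp (-V - T * ‖φ‖ - T * P) * Real.exp (-(w.length * P) + supBirkhoff X φ w) *
        Real.exp (n * P)) by ring, div_self hQ.ne', mul_one, mul_left_comm _ c,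
      ← Real.exp_add, ← Real.exp_add, ← Real.exp_add]
    refine mul_le_mul_of_nonneg_left (Real.exp_le_exp.2 ?_) hc.le
    rw [hm, hu]
    push_cast
    linarith

/-- Along every ultrafilter the periodic orbit measures converge to an invariant Gibbs measure. -/
theorem exists_gibbs_limit {z : X.carrier} (hz : shiftMap X z = z) {K' : ℝ} {K : ℕ → ℝ → ℝ}
    (hupp : ∀ w ∈ language X, ∀ᶠ n in atTop, (periodicMeasure X φ n).real (cylinder X w) ≤
        K' * Real.exp (-(w.length * pressure X φ) + supBirkhoff X φ w))
    (hlow : ∀ (T : ℕ) (V : ℝ), ∀ w ∈ goodWords X φ Lp T V, ∀ᶠ n in atTop,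
        K T V * Real.exp (-(w.length * pressure X φ) + supBirkhoff X φ w) ≤
          (periodicMeasure X φ n).real (cylinder X w))
    (U : Ultrafilter ℕ) (hU : (U : Filter ℕ) ≤ atTop) :
    ∃ μ : Measure X.carrier, IsInvariantProbability X μ ∧ IsGibbs X φ Lp μ K' K ∧
      ∀ g : C(X.carrier, ℝ),
        Tendsto (fun n => ∫ x, g x ∂(periodicMeasure X φ n)) U (𝓝 (∫ x, g x ∂μ)) := by
  classical
  have hprob : ∀ n, 0 < n → IsProbabilityMeasure (periodicMeasure X φ n) := fun n hn =>
    isProbabilityMeasure_periodicMeasure hn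
      ⟨z, mem_periodicFinset.2 (Function.iterate_fixed hz n)⟩
  -- Every point has period zero, so `periodicMeasure` need not be a probability at `n = 0`. A Dirac
  -- mass takes its place, invisible to `U`.
  set m : ℕ → ProbabilityMeasure X.carrier := fun n =>
    if hn : 0 < n then ⟨periodicMeasure X φ n, hprob n hn⟩ else ⟨Measure.dirac z, inferInstance⟩
    with hm
  have hmn : ∀ n, 0 < n → (m n : Measure X.carrier) = periodicMeasure X φ n := fun n hn => by
    simp [hm, hn]
  have hev : ∀ᶠ n in (U : Filter ℕ), 0 < n := hU (eventually_gt_atTop 0)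
  -- The probability measures on a compact space form a compact space, so every ultrafilter on them
  -- converges.
  obtain ⟨μ, hμ⟩ : ∃ μ : ProbabilityMeasure X.carrier, Tendsto m U (𝓝 μ) :=
    ⟨(U.map m).lim, (U.map m).le_nhds_lim⟩
  have hg : ∀ g : C(X.carrier, ℝ),
      Tendsto (fun n => ∫ x, g x ∂(periodicMeasure X φ n)) U (𝓝 (∫ x, g x ∂(μ : Measure _))) := by
    intro g
    have h1 := ProbabilityMeasure.tendsto_iff_forall_integral_tendsto.1 hμ
      (BoundedContinuousFunction.mkOfCompact g)
    refine h1.congr' ?_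
    filter_upwards [hev] with n hn
    rw [hmn n hn]
    rfl
  have hcyl : ∀ w : List (Fin b), Tendsto (fun n => (periodicMeasure X φ n).real (cylinder X w)) U
      (𝓝 ((μ : Measure X.carrier).real (cylinder X w))) := by
    intro w
    -- Cylinders are clopen, so their measures pass to the weak* limit.
    have h1 := ProbabilityMeasure.tendsto_measure_of_null_frontier_of_tendsto' hμ
      (E := cylinder X w) (by rw [(isClopen_cylinder w).frontier_eq, measure_empty])
    have h2 := (ENNReal.tendsto_toReal (measure_ne_top _ _)).comp h1
    refine h2.congr' ?_
    filter_upwards [hev] with n hn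
    rw [Function.comp_apply, hmn n hn]
    rfl
  refine ⟨μ, ⟨inferInstance, continuous_shiftMap.measurable, ?_⟩, ⟨fun w hw => ?_,
    fun T V w hw => ?_⟩, hg⟩
  · have : IsFiniteMeasure (Measure.map (shiftMap X) (μ : Measure X.carrier)) := inferInstance
    refine ext_of_forall_integral_eq_of_IsFiniteMeasure fun f => ?_
    rw [integral_map continuous_shiftMap.aemeasurable f.continuous.aestronglyMeasurable]
    have h1 := hg (f.toContinuousMap.comp ⟨shiftMap X, continuous_shiftMap⟩)
    have h2 := hg f.toContinuousMap
    refine tendsto_nhds_unique h1 (h2.congr' ?_)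
    filter_upwards [hev] with n hn
    rw [integral_periodicMeasure hn, integral_periodicMeasure hn]
    congr 1
    exact (periodicSum_comp_shiftMap hn _).symm
  · exact le_of_tendsto (hcyl w) (hU (hupp w hw))
  · exact ge_of_tendsto (hcyl w) (hU (hlow T V w hw))

end Periodic

end BetaShift

namespace BetaShift

/-! ### Oscillation of Birkhoff sums of continuous functions -/

section Oscillation

variable {b : ℕ} {X : Subshift (Fin b) ℕ} (φ : C(X.carrier, ℝ))

/-- Uniform continuity in terms of common initial letters. By compactness, counterexamples for every
`N` would leave a pair agreeing in all letters on which `φ` still differs by `ε`. -/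
theorem exists_initialWord_uniform {ε : ℝ} (hε : 0 < ε) :
    ∃ N, ∀ x y : X.carrier, (∀ i < N, x.1 i = y.1 i) → |φ x - φ y| < ε := by
  by_contra! hcon
  set F : ℕ → Set (X.carrier × X.carrier) := fun N =>
    (⋂ i ∈ Finset.range N, {p | p.1.1 i = p.2.1 i}) ∩ {p | ε ≤ |φ p.1 - φ p.2|} with hF
  have hclosed : ∀ N, IsClosed (F N) := by
    intro N
    refine IsClosed.inter (isClosed_biInter fun i _ => isClosed_eq ?_ ?_)
      (isClosed_le continuous_const ?_)
    · exact (continuous_apply (A := fun _ : ℕ => Fin b) i).comp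
        (continuous_subtype_val.comp continuous_fst)
    · exact (continuous_apply (A := fun _ : ℕ => Fin b) i).comp
        (continuous_subtype_val.comp continuous_snd)
    · fun_prop
  have hmem : ∀ N p, p ∈ F N ↔ (∀ i < N, p.1.1 i = p.2.1 i) ∧ ε ≤ |φ p.1 - φ p.2| := by
    intro N p
    simp [hF]
  obtain ⟨p, hp⟩ := IsCompact.nonempty_iInter_of_sequence_nonempty_isCompact_isClosed F
    (fun N p hp => by
      rw [hmem] at hp ⊢
      exact ⟨fun i hi => hp.1 i (by omega), hp.2⟩)
    (fun N => by
      obtain ⟨x, y, h1, h2⟩ := hcon N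
      exact ⟨(x, y), (hmem _ _).2 ⟨h1, h2⟩⟩)
    (hclosed 0).isCompact hclosed
  rw [mem_iInter] at hp
  have h1 : p.1 = p.2 := Subtype.ext (funext fun i =>
    ((hmem _ _).1 (hp (i + 1))).1 i (Nat.lt_succ_self i))
  have h2 := ((hmem _ _).1 (hp 0)).2
  rw [h1, sub_self, abs_zero] at h2
  linarith

/-- While at least `N` common letters remain ahead a term costs `ε`; the fewer than `N` terms at the
end are bounded by the norm. Continuity alone thus makes the oscillation on cylinders sublinear. -/
theorem abs_birkhoffSum_sub_le {n : ℕ} {x y : X.carrier} {ε : ℝ} {N : ℕ} (hε : 0 ≤ ε)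
    (hN : ∀ x y : X.carrier, (∀ i < N, x.1 i = y.1 i) → |φ x - φ y| ≤ ε)
    (h : ∀ i < n, x.1 i = y.1 i) :
    |birkhoffSum (shiftMap X) φ n x - birkhoffSum (shiftMap X) φ n y| ≤
      n * ε + 2 * N * ‖φ‖ := by
  induction n generalizing x y with
  | zero => simp only [birkhoffSum_zero, sub_self, abs_zero]; positivity
  | succ n ih =>
    rcases lt_or_ge n N with hn | hn
    · have h1 := abs_birkhoffSum_le φ (n + 1) x
      have h2 := abs_birkhoffSum_le φ (n + 1) y
      have h3 : ((n + 1 : ℕ) : ℝ) * ‖φ‖ ≤ N * ‖φ‖ :=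
        mul_le_mul_of_nonneg_right (by exact_mod_cast hn) (norm_nonneg _)
      have h4 : 0 ≤ ((n + 1 : ℕ) : ℝ) * ε := by positivity
      rw [abs_le] at *
      constructor <;> linarith
    · have h1 := ih (x := shiftMap X x) (y := shiftMap X y) fun i hi => by
        have := h (1 + i) (by omega)
        rwa [← shiftMap_iterate_apply, ← shiftMap_iterate_apply] at this
      have h2 := hN x y fun i hi => h i (by omega)
      rw [birkhoffSum_succ', birkhoffSum_succ']
      push_cast
      rw [abs_le] at *
      constructor <;> linarith

theorem exists_birkhoffSum_sub_le {ε : ℝ} (hε : 0 < ε) :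
    ∃ C, ∀ (n : ℕ) (x y : X.carrier), (∀ i < n, x.1 i = y.1 i) →
      |birkhoffSum (shiftMap X) φ n x - birkhoffSum (shiftMap X) φ n y| ≤ n * ε + C := by
  obtain ⟨N, hN⟩ := exists_initialWord_uniform φ hε
  exact ⟨2 * N * ‖φ‖, fun n x y h =>
    abs_birkhoffSum_sub_le φ hε.le (fun x y hxy => (hN x y hxy).le) h⟩

variable {φ}

theorem supBirkhoff_le_of_abs_sub_le {w : List (Fin b)} {x : X.carrier} (hx : x ∈ cylinder X w)
    {c : ℝ} (h : ∀ y ∈ cylinder X w, |birkhoffSum (shiftMap X) φ w.length y -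
      birkhoffSum (shiftMap X) φ w.length x| ≤ c) :
    supBirkhoff X φ w ≤ birkhoffSum (shiftMap X) φ w.length x + c :=
  supBirkhoff_le ⟨x, hx⟩ fun y hy => by linarith [(abs_le.1 (h y hy)).2]

end Oscillation

/-! ### Invariant Gibbs measures: equilibrium, ergodicity, uniqueness -/

section Gibbs

open scoped symmDiff

variable {b : ℕ} {X : Subshift (Fin b) ℕ} {φ : C(X.carrier, ℝ)} {Lp : Set (List (Fin b))}
  {μ : Measure X.carrier} {K' : ℝ} {K : ℕ → ℝ → ℝ}

/-- The free energy of a Gibbs measure is at least the pressure. -/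
theorem IsGibbs.pressure_le (hG : IsGibbs X φ Lp μ K' K) (hK' : 0 < K')
    (hμ : IsInvariantProbability X μ) :
    (pressure X φ : EReal) ≤ measureEntropy μ (shiftMap X) + ((∫ x, φ x ∂μ : ℝ) : EReal) := by
  have := hμ.1
  suffices h : ((pressure X φ - ∫ x, φ x ∂μ : ℝ) : EReal) ≤ measureEntropy μ (shiftMap X) by
    refine le_trans (le_of_eq ?_) (add_le_add_left h _)
    rw [← EReal.coe_add, sub_add_cancel]
  have hε : ∀ ε : ℝ, 0 < ε →
      ((pressure X φ - ∫ x, φ x ∂μ - ε : ℝ) : EReal) ≤ measureEntropy μ (shiftMap X) := by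
    intro ε hε
    obtain ⟨C, hC⟩ := exists_birkhoffSum_sub_le φ hε
    -- Only the upper Gibbs bound is needed: it gives `-log μ[w] ≥ n P - φ_n(w) - log K'`. Replacing
    -- `φ_n(w)` by `S_n φ(x)` costs `n ε + C`, and integration yields the entropy bound.
    refine le_measureEntropy hμ (C := C + Real.log K') fun n => ?_
    have hmeas := measurable_firstLetters (X := X) n
    rw [wordEntropy, finiteEntropy_eq_integral hmeas]
    have hint : Integrable (fun x => birkhoffSum (shiftMap X) φ n x) μ := by
      refine Continuous.integrable_of_hasCompactSupport ?_ (HasCompactSupport.of_compactSpace _)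
      exact continuous_finsetSum _ fun i _ => φ.continuous.comp (continuous_shiftMap.iterate i)
    have h1 : ∫ x, Real.log (law μ (firstLetters X n) (firstLetters X n x)) ∂μ ≤
        ∫ x, (birkhoffSum (shiftMap X) φ n x + (n * ε + C + Real.log K' - n * pressure X φ)) ∂μ := by
      refine integral_mono_ae
        (integrable_comp_finite hmeas fun u => Real.log (law μ (firstLetters X n) u))
        (hint.add (integrable_const _)) ?_
      filter_upwards [ae_law_ne_zero (μ := μ) (firstLetters X n)] with x hx
      rw [law_firstLetters, ofFn_firstLetters] at hx ⊢
      have h2 := hG.1 _ (initialWord_mem_language x n)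
      have h3 := Real.log_le_log (lt_of_le_of_ne measureReal_nonneg hx.symm) h2
      rw [Real.log_mul hK'.ne' (Real.exp_pos _).ne', Real.log_exp, length_initialWord] at h3
      have h4 : supBirkhoff X φ (initialWord x.1 n) ≤
          birkhoffSum (shiftMap X) φ n x + (n * ε + C) := by
        have h5 := supBirkhoff_le_of_abs_sub_le (φ := φ) (mem_cylinder_initialWord x n)
          (c := n * ε + C) (fun y hy => by
            rw [length_initialWord]
            refine hC n y x (initialWord_eq_iff.1 ?_)
            have := mem_cylinder_iff.1 hy
            rwa [length_initialWord] at this)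
        rwa [length_initialWord] at h5
      linarith
    rw [integral_add hint (integrable_const _), integral_birkhoffSum hμ] at h1
    simp only [integral_const, probReal_univ, one_smul] at h1
    linarith
  have h1 : Tendsto (fun ε : ℝ => ((pressure X φ - ∫ x, φ x ∂μ - ε : ℝ) : EReal)) (𝓝[>] 0)
      (𝓝 ((pressure X φ - ∫ x, φ x ∂μ - 0 : ℝ) : EReal)) := by
    refine (continuous_coe_real_ereal.tendsto _).comp ?_
    exact (tendsto_const_nhds.sub tendsto_id).mono_left nhdsWithin_le_nhds
  rw [sub_zero] at h1
  exact le_of_tendsto h1 (eventually_mem_nhdsWithin.mono fun ε hε' => hε ε hε')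

theorem sum_measureReal_cylinder [IsFiniteMeasure μ] {n : ℕ} (s : Finset (Fin n → Fin b)) :
    ∑ u ∈ s, μ.real (cylinder X (List.ofFn u)) = μ.real (firstLetters X n ⁻¹' s) := by
  rw [← sum_measureReal_preimage_singleton s fun u _ =>
    measurable_firstLetters n (measurableSet_singleton u)]
  simp only [preimage_firstLetters]

/-- Words that are not good for large parameters carry little mass. -/
theorem IsGibbs.measure_compl_goodWords_le [IsFiniteMeasure μ] (hG : IsGibbs X φ Lp μ K' K)
    (hK' : 0 < K')
    {T : ℕ} {V ε : ℝ} {n : ℕ} (h : partitionSum X φ (goodWords X φ Lp T V)ᶜ n ≤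
      ε * Real.exp (n * pressure X φ)) :
    μ.real {x | initialWord x.1 n ∉ goodWords X φ Lp T V} ≤ K' * ε := by
  classical
  have h1 := sum_measureReal_cylinder (μ := μ)
    (Finset.univ.filter fun u : Fin n → Fin b => List.ofFn u ∉ goodWords X φ Lp T V)
  have h2 : firstLetters X n ⁻¹' (Finset.univ.filter fun u : Fin n → Fin b =>
      List.ofFn u ∉ goodWords X φ Lp T V : Finset _) =
      {x | initialWord x.1 n ∉ goodWords X φ Lp T V} := by
    ext x
    simp [ofFn_firstLetters]
  rw [h2] at h1
  rw [← h1, Finset.sum_filter]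
  have h3 : ∀ u : Fin n → Fin b, (if List.ofFn u ∉ goodWords X φ Lp T V then
      μ.real (cylinder X (List.ofFn u)) else 0) ≤
      K' * Real.exp (-(n * pressure X φ)) *
        upperWeight X φ (goodWords X φ Lp T V)ᶜ (List.ofFn u) := by
    intro u
    split_ifs with hu
    · exact mul_nonneg (by positivity) (upperWeight_nonneg _ _)
    · by_cases hL : List.ofFn u ∈ language X
      · have := hG.1 _ hL
        rw [List.length_ofFn, Real.exp_add, ← mul_assoc] at this
        rwa [upperWeight_of_mem (by exact hu) hL]
      · rw [not_nonempty_iff_eq_empty.1 hL, measureReal_empty]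
        exact mul_nonneg (by positivity) (upperWeight_nonneg _ _)
  refine (Finset.sum_le_sum fun u _ => h3 u).trans ?_
  rw [← Finset.mul_sum]
  refine (mul_le_mul_of_nonneg_left h (by positivity)).trans (le_of_eq ?_)
  rw [show K' * Real.exp (-(n * pressure X φ)) * (ε * Real.exp (n * pressure X φ)) =
    K' * ε * (Real.exp (-(n * pressure X φ)) * Real.exp (n * pressure X φ)) by ring,
    ← Real.exp_add, neg_add_cancel, Real.exp_zero, mul_one]

/-- A mixing property of Gibbs measures on cylinders of good words. -/
theorem IsGibbs.exists_mixing (hG : IsGibbs X φ Lp μ K' K) (h : IsLoopSystem X Lp) (hK' : 0 < K')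
    (hK : ∀ T V, 0 < K T V) [IsFiniteMeasure μ] (T : ℕ) (V : ℝ) :
    ∃ κ > 0, ∀ u ∈ goodWords X φ Lp T V, ∀ v ∈ goodWords X φ Lp T V,
      κ * (μ.real (cylinder X u) * μ.real (cylinder X v)) ≤
        μ.real (cylinder X u ∩ (shiftMap X)^[u.length + T] ⁻¹' cylinder X v) := by
  set P := pressure X φ
  set K2 := K T (2 * V + 2 * (T * ‖φ‖))
  have hK2 : 0 < K2 := hK _ _
  -- The lower bound for the joined word is compared with the upper bounds for `u` and `v`. The
  -- exponent pays for the `T` joining letters and for passing from supremum to infimum in `u` and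
  -- in `v`.
  refine ⟨K2 * Real.exp (-(T * P) - 2 * V - T * ‖φ‖) / (K' * K'), by positivity,
    fun u hu v hv => ?_⟩
  obtain ⟨c, hc, huc⟩ := hu.2.1
  have h1 := hG.2 _ _ _ (goodWords_append h hu hc huc hv)
  have hL := h.append_mem_language _ huc v hv.1
  have hsub : cylinder X (u ++ c ++ v) ⊆
      cylinder X u ∩ (shiftMap X)^[u.length + T] ⁻¹' cylinder X v := by
    intro x hx
    have h2 := mem_cylinder_append.1 hx
    rw [List.length_append, hc] at h2
    exact ⟨(mem_cylinder_append.1 h2.1).1, h2.2⟩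
  refine le_trans ?_ (measureReal_mono hsub)
  refine le_trans ?_ h1
  have h2 := infBirkhoff_le_supBirkhoff (φ := φ) hL
  have h3 := infBirkhoff_add_le (φ := φ) hL
  have h4 := infBirkhoff_sub_le_append (φ := φ) (left_mem_language hL)
  have hu3 := hu.2.2
  have hv3 := hv.2.2
  rw [hc] at h4
  have h5 : μ.real (cylinder X u) * μ.real (cylinder X v) ≤
      (K' * Real.exp (-(u.length * P) + supBirkhoff X φ u)) *
      (K' * Real.exp (-(v.length * P) + supBirkhoff X φ v)) :=
    mul_le_mul (hG.1 u hu.1) (hG.1 v hv.1) measureReal_nonneg (by positivity)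
  refine (mul_le_mul_of_nonneg_left h5 (by positivity)).trans ?_
  rw [show K2 * Real.exp (-(T * P) - 2 * V - T * ‖φ‖) / (K' * K') *
      ((K' * Real.exp (-(u.length * P) + supBirkhoff X φ u)) *
      (K' * Real.exp (-(v.length * P) + supBirkhoff X φ v))) =
      K2 * (Real.exp (-(T * P) - 2 * V - T * ‖φ‖) *
        Real.exp (-(u.length * P) + supBirkhoff X φ u) *
        Real.exp (-(v.length * P) + supBirkhoff X φ v)) by field_simp,
    ← Real.exp_add, ← Real.exp_add]
  refine mul_le_mul_of_nonneg_left (Real.exp_le_exp.2 ?_) hK2.le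
  rw [List.length_append, List.length_append, hc]
  push_cast
  linarith

theorem measurableSet_preimage_firstLetters {n : ℕ} (E : Set (Fin n → Fin b)) :
    MeasurableSet (firstLetters X n ⁻¹' E) :=
  measurable_firstLetters n (Set.toFinite E).measurableSet

/-- Invariant Gibbs measures are ergodic. -/
theorem IsGibbs.ergodic (hG : IsGibbs X φ Lp μ K' K) (h : IsLoopSystem X Lp)
    (hT : TailSmall X φ Lp) (hK' : 0 < K') (hK : ∀ T V, 0 < K T V)
    (hμ : IsInvariantProbability X μ) : Ergodic (shiftMap X) μ := by
  classical
  have := hμ.1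
  refine ⟨hμ.2, ⟨fun s hs hinv => ?_⟩⟩
  by_contra hcon
  have hα : 0 < μ.real s := by
    refine lt_of_le_of_ne measureReal_nonneg fun h0 => hcon ?_
    refine eventuallyConst_set'.2 (Or.inl ?_)
    exact ae_eq_empty.2 ((measureReal_eq_zero_iff (measure_ne_top _ _)).1 h0.symm)
  have hβ : 0 < μ.real sᶜ := by
    refine lt_of_le_of_ne measureReal_nonneg fun h0 => hcon ?_
    refine eventuallyConst_set'.2 (Or.inr ?_)
    exact ae_eq_univ.2 ((measureReal_eq_zero_iff (measure_ne_top _ _)).1 h0.symm)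
  set α := μ.real s
  set β := μ.real sᶜ
  -- Bad words and the approximation error then take at most a quarter each of the smaller mass, so
  -- the good words approximating `s` or its complement keep half of its measure.
  obtain ⟨T, V, hTV⟩ := hT (min α β / 4 / K') (by positivity)
  obtain ⟨κ, hκ, hmix⟩ := hG.exists_mixing h hK' hK T V
  have hαβ : 0 < min α β := lt_min hα hβ
  -- The second condition makes the mixing estimate exceed `2 * δ`. By invariance of `s`, a point
  -- that is near `s` at time zero and near the complement at time `n + T` lies in one of two error
  -- sets of measure `δ`.
  obtain ⟨δ, hδ, hδ1, hδ2⟩ : ∃ δ > 0, δ ≤ min α β / 4 ∧ 2 * δ < κ * (α / 2 * (β / 2)) :=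
    ⟨min (min α β / 4) (κ * (α / 2 * (β / 2)) / 4), by positivity, min_le_left _ _, by
      have := min_le_right (min α β / 4) (κ * (α / 2 * (β / 2)) / 4)
      have : 0 < κ * (α / 2 * (β / 2)) := by positivity
      linarith⟩
  obtain ⟨m1, h1⟩ := exists_cylinder_approx (X := X) μ hs hδ
  obtain ⟨m2, h2⟩ := exists_cylinder_approx (X := X) μ hs.compl hδ
  set n := max m1 m2
  obtain ⟨D, hD⟩ := h1 n (le_max_left _ _)
  obtain ⟨F, hF⟩ := h2 n (le_max_right _ _)
  have htail := hG.measure_compl_goodWords_le hK' (hTV n)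
  rw [mul_div_cancel₀ _ hK'.ne'] at htail
  have hbig : ∀ (E : Set (Fin n → Fin b)) (B : Set X.carrier) (γ : ℝ), MeasurableSet B →
      min α β ≤ γ → γ = μ.real B → μ.real ((firstLetters X n ⁻¹' E) ∆ B) ≤ δ →
      γ / 2 ≤ μ.real (firstLetters X n ⁻¹' (Finset.univ.filter fun u : Fin n → Fin b =>
        u ∈ E ∧ List.ofFn u ∈ goodWords X φ Lp T V : Finset _)) := by
    intro E B γ hB hγ hγB hE
    have hsub : B ⊆ (firstLetters X n ⁻¹' (Finset.univ.filter fun u : Fin n → Fin b =>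
        u ∈ E ∧ List.ofFn u ∈ goodWords X φ Lp T V : Finset _)) ∪
        ((firstLetters X n ⁻¹' E) ∆ B ∪ {x | initialWord x.1 n ∉ goodWords X φ Lp T V}) := by
      intro x hx
      by_cases hxE : firstLetters X n x ∈ E
      · by_cases hxG : initialWord x.1 n ∈ goodWords X φ Lp T V
        · refine Or.inl ?_
          simp [hxE, ofFn_firstLetters, hxG]
        · exact Or.inr (Or.inr hxG)
      · exact Or.inr (Or.inl (Or.inr ⟨hx, hxE⟩))
    have h3 := (measureReal_mono (μ := μ) hsub).trans ((measureReal_union_le _ _).trans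
      (add_le_add le_rfl (measureReal_union_le _ _)))
    linarith
  set D' := Finset.univ.filter fun u : Fin n → Fin b =>
    u ∈ D ∧ List.ofFn u ∈ goodWords X φ Lp T V with hD'
  set F' := Finset.univ.filter fun u : Fin n → Fin b =>
    u ∈ F ∧ List.ofFn u ∈ goodWords X φ Lp T V with hF'
  have hD2 : α / 2 ≤ μ.real (firstLetters X n ⁻¹' D') :=
    hbig D s α hs (min_le_left _ _) rfl hD
  have hF2 : β / 2 ≤ μ.real (firstLetters X n ⁻¹' F') :=
    hbig F sᶜ β hs.compl (min_le_right _ _) rfl hF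
  set Y : X.carrier → (Fin n → Fin b) × (Fin n → Fin b) := fun x =>
    (firstLetters X n x, firstLetters X n ((shiftMap X)^[n + T] x))
  have hY : Measurable Y := (measurable_firstLetters n).prodMk
    ((measurable_firstLetters n).comp (hμ.2.measurable.iterate _))
  have hlow : κ * (μ.real (firstLetters X n ⁻¹' D') * μ.real (firstLetters X n ⁻¹' F')) ≤
      μ.real (Y ⁻¹' (D' ×ˢ F' : Finset _)) := by
    rw [← sum_measureReal_preimage_singleton (D' ×ˢ F') fun p _ => hY (measurableSet_singleton p),
      ← sum_measureReal_cylinder, ← sum_measureReal_cylinder, Finset.sum_mul_sum,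
      ← Finset.sum_product', Finset.mul_sum]
    refine Finset.sum_le_sum fun p hp => ?_
    obtain ⟨hp1, hp2⟩ := Finset.mem_product.1 hp
    refine (hmix _ (Finset.mem_filter.1 hp1).2.2 _ (Finset.mem_filter.1 hp2).2.2).trans
      (measureReal_mono fun x hx => ?_)
    rw [List.length_ofFn] at hx
    exact Prod.ext (mem_cylinder_ofFn.1 hx.1) (mem_cylinder_ofFn.1 hx.2)
  have hiter : (shiftMap X)^[n + T] ⁻¹' s = s := by
    have : ∀ k : ℕ, (shiftMap X)^[k] ⁻¹' s = s := by
      intro k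
      induction k with
      | zero => rfl
      | succ k ih => rw [Function.iterate_succ', preimage_comp, hinv, ih]
    exact this _
  have hupp : μ.real (Y ⁻¹' (D' ×ˢ F' : Finset _)) ≤ δ + δ := by
    have hsub : Y ⁻¹' (D' ×ˢ F' : Finset _) ⊆ ((firstLetters X n ⁻¹' D) ∆ s) ∪
        (shiftMap X)^[n + T] ⁻¹' ((firstLetters X n ⁻¹' F) ∆ sᶜ) := by
      intro x hx
      obtain ⟨hx1, hx2⟩ := Finset.mem_product.1 (show Y x ∈ D' ×ˢ F' from hx)
      have hx1 := (Finset.mem_filter.1 hx1).2.1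
      have hx2 := (Finset.mem_filter.1 hx2).2.1
      by_cases hxs : x ∈ s
      · refine Or.inr (Or.inl ⟨hx2, ?_⟩)
        rw [← hiter] at hxs
        exact fun h => h hxs
      · exact Or.inl (Or.inl ⟨hx1, hxs⟩)
    refine (measureReal_mono hsub).trans ((measureReal_union_le _ _).trans (add_le_add hD ?_))
    rw [(hμ.2.iterate _).measureReal_preimage
      ((measurableSet_preimage_firstLetters F).symmDiff hs.compl).nullMeasurableSet]
    exact hF
  have h3 : α / 2 * (β / 2) ≤ μ.real (firstLetters X n ⁻¹' D') *
      μ.real (firstLetters X n ⁻¹' F') := mul_le_mul hD2 hF2 (by positivity) measureReal_nonneg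
  have h4 := mul_le_mul_of_nonneg_left h3 hκ.le
  linarith

/-- The logarithm is monotone only on positive numbers, and `Real.log 0 = 0`. If `ν` charges the
words of `D` the partition sum is positive; otherwise both sides vanish. -/
theorem mul_log_partitionSum_le {ν : Measure X.carrier} [IsFiniteMeasure ν]
    {D : Set (List (Fin b))} {n : ℕ} {a : ℝ}
    (hle : partitionSum X φ D n ≤ a) :
    ν.real {x | initialWord x.1 n ∈ D} * Real.log (partitionSum X φ D n) ≤
      ν.real {x | initialWord x.1 n ∈ D} * Real.log a := by
  rcases (measureReal_nonneg (μ := ν) (s := {x | initialWord x.1 n ∈ D})).eq_or_lt with h0 | h0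
  · rw [← h0, zero_mul, zero_mul]
  · obtain ⟨x, hx⟩ : {x : X.carrier | initialWord x.1 n ∈ D}.Nonempty := by
      by_contra hne
      rw [not_nonempty_iff_eq_empty.1 hne, measureReal_empty] at h0
      exact lt_irrefl _ h0
    have h1 := le_wordSum (upperWeight_nonneg (φ := φ) D) (initialWord x.1 n)
    rw [upperWeight_of_mem (D := D) hx (initialWord_mem_language x n), length_initialWord] at h1
    exact mul_le_mul_of_nonneg_left
      (Real.log_le_log ((Real.exp_pos _).trans_le h1) hle) h0.le

/-- A measure whose free energy is the pressure is absolutely continuous with respect to every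
Gibbs measure. -/
theorem IsGibbs.absolutelyContinuous [Nonempty X.carrier] (hG : IsGibbs X φ Lp μ K' K)
    (h : IsLoopSystem X Lp) (hT : TailSmall X φ Lp) (hK : ∀ T V, 0 < K T V) [IsFiniteMeasure μ]
    {ν : Measure X.carrier} (hν : IsInvariantProbability X ν)
    (hP : (pressure X φ : EReal) ≤ measureEntropy ν (shiftMap X) + ((∫ x, φ x ∂ν : ℝ) : EReal)) :
    ν ≪ μ := by
  classical
  have := hν.1
  refine Measure.AbsolutelyContinuous.mk fun E hE hμE => ?_
  by_contra hνE
  have hs : 0 < ν.real E :=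
    lt_of_le_of_ne measureReal_nonneg fun h0 =>
      hνE ((measureReal_eq_zero_iff (measure_ne_top _ _)).1 h0.symm)
  set s := ν.real E
  set P := pressure X φ
  obtain ⟨Q, hQ, hQn⟩ := exists_partitionSum_language_le h hT
  -- Chosen so that `log (2 ε)` is negative enough: with mass at least `s / 2` on `D`, the gain
  -- there outweighs `|log Q|` from the complement and the error `2` of the entropy estimate.
  set ε := Real.exp (-(2 * (|Real.log Q| + 3) / s)) / 2 with hε
  have hε0 : 0 < ε := by positivity
  obtain ⟨T, V, hTV⟩ := hT ε hε0
  have hK0 := hK T V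
  obtain ⟨δ, hδ, hδ1, hδ2⟩ : ∃ δ > 0, δ ≤ s / 2 ∧ δ / K T V ≤ ε :=
    ⟨min (s / 2) (ε * K T V), by positivity, min_le_left _ _, by
      rw [div_le_iff₀ hK0]; exact min_le_right _ _⟩
  -- Approximation with respect to `μ + ν` gives one set of words that is small for `μ` and large
  -- for `ν`.
  obtain ⟨m, hm⟩ := exists_cylinder_approx (X := X) (μ + ν) hE hδ
  set n := m + 1
  have hn : 0 < n := Nat.succ_pos m
  have hn' : (0 : ℝ) < n := by exact_mod_cast hn
  obtain ⟨F, hF⟩ := hm n (Nat.le_succ m)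
  rw [measureReal_add_apply] at hF
  have hμF : μ.real ((firstLetters X n ⁻¹' F) ∆ E) ≤ δ := by
    linarith [measureReal_nonneg (μ := ν) (s := (firstLetters X n ⁻¹' F) ∆ E)]
  have hνF : ν.real ((firstLetters X n ⁻¹' F) ∆ E) ≤ δ := by
    linarith [measureReal_nonneg (μ := μ) (s := (firstLetters X n ⁻¹' F) ∆ E)]
  set D : Set (List (Fin b)) := List.ofFn '' F with hD
  have hDF : {x : X.carrier | initialWord x.1 n ∈ D} = firstLetters X n ⁻¹' F := by
    ext x
    simp only [mem_ofPred_eq, hD, mem_image, mem_preimage]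
    constructor
    · rintro ⟨u, hu, hux⟩
      rw [← ofFn_firstLetters] at hux
      rwa [← List.ofFn_injective hux]
    · intro hx
      exact ⟨_, hx, rfl⟩
  have hνD : s / 2 ≤ ν.real {x | initialWord x.1 n ∈ D} := by
    rw [hDF]
    have hsub : E ⊆ firstLetters X n ⁻¹' F ∪ (firstLetters X n ⁻¹' F) ∆ E := by
      intro x hx
      by_cases hxF : firstLetters X n x ∈ F
      · exact Or.inl hxF
      · exact Or.inr (Or.inr ⟨hx, hxF⟩)
    have := (measureReal_mono hsub).trans (measureReal_union_le (μ := ν) _ _)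
    linarith
  have hμD : μ.real (firstLetters X n ⁻¹' F) ≤ δ := by
    have hsub : firstLetters X n ⁻¹' F ⊆ E ∪ (firstLetters X n ⁻¹' F) ∆ E := by
      intro x hx
      by_cases hxE : x ∈ E
      · exact Or.inl hxE
      · exact Or.inr (Or.inl ⟨hx, hxE⟩)
    have h1 := (measureReal_mono hsub).trans (measureReal_union_le (μ := μ) _ _)
    have h2 : μ.real E = 0 := by simp [Measure.real, hμE]
    linarith
  -- Good words of `D` weigh at most `exp (n P) / K T V` times their `μ`-measure, by the lower Gibbs
  -- bound, and `μ` is small on `D`. The other words fall under the tail bound.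
  have hΛD : partitionSum X φ D n ≤ 2 * ε * Real.exp (n * P) := by
    have hsub : D ⊆ (D ∩ goodWords X φ Lp T V) ∪ (goodWords X φ Lp T V)ᶜ := by
      intro w hw
      by_cases hwG : w ∈ goodWords X φ Lp T V
      · exact Or.inl ⟨hw, hwG⟩
      · exact Or.inr hwG
    have h1 := (partitionSum_mono (φ := φ) hsub n).trans (partitionSum_union_le _ _ n)
    have h2 : partitionSum X φ (D ∩ goodWords X φ Lp T V) n ≤
        δ / K T V * Real.exp (n * P) := by
      have h3 : ∀ u : Fin n → Fin b, upperWeight X φ (D ∩ goodWords X φ Lp T V) (List.ofFn u) ≤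
          (if u ∈ F then μ.real (cylinder X (List.ofFn u)) else 0) *
            (Real.exp (n * P) / K T V) := by
        intro u
        by_cases hu : List.ofFn u ∈ D ∩ goodWords X φ Lp T V
        · have huF : u ∈ F := by
            obtain ⟨u', hu', he⟩ := hu.1
            rwa [← List.ofFn_injective he]
          have h4 := hG.2 T V _ hu.2
          rw [List.length_ofFn] at h4
          rw [upperWeight_of_mem hu hu.2.1, if_pos huF, mul_div_assoc', le_div_iff₀ hK0]
          refine le_trans (le_of_eq ?_) (mul_le_mul_of_nonneg_right h4 (Real.exp_pos _).le)
          rw [mul_assoc, ← Real.exp_add, mul_comm]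
          congr 2
          ring
        · rw [upperWeight_of_notMem fun h' => hu h'.1]
          refine mul_nonneg ?_ (by positivity)
          split_ifs
          · exact measureReal_nonneg
          · exact le_rfl
      have h4 := sum_measureReal_cylinder (μ := μ) (Finset.univ.filter (· ∈ F))
      have h5 : firstLetters X n ⁻¹' (Finset.univ.filter (· ∈ F) : Finset (Fin n → Fin b)) =
          firstLetters X n ⁻¹' F := by
        ext x
        simp
      rw [h5, Finset.sum_filter] at h4
      refine (Finset.sum_le_sum fun u _ => h3 u).trans ?_
      rw [← Finset.sum_mul, h4]
      calc μ.real (firstLetters X n ⁻¹' F) * (Real.exp (n * P) / K T V)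
          ≤ δ * (Real.exp (n * P) / K T V) := mul_le_mul_of_nonneg_right hμD (by positivity)
        _ = δ / K T V * Real.exp (n * P) := by ring
    have h6 := mul_le_mul_of_nonneg_right hδ2 (Real.exp_pos (n * P)).le
    have h7 := hTV n
    linarith
  have hΛDc : partitionSum X φ Dᶜ n ≤ Q * Real.exp (n * P) := by
    refine le_trans ?_ (hQn n)
    rw [← partitionSum_univ]
    exact partitionSum_mono (subset_univ _) n
  have hfree : n * P ≤ wordEntropy ν n + n * ∫ x, φ x ∂ν := by
    have h1 := hP.trans (add_le_add_left (measureEntropy_le hν hn) _)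
    rw [← EReal.coe_add, EReal.coe_le_coe_iff] at h1
    have h2 := mul_le_mul_of_nonneg_left h1 hn'.le
    rw [mul_add, mul_div_cancel₀ _ hn'.ne'] at h2
    exact h2
  have hmain := wordEntropy_add_integral_le (φ := φ) hν D n
  have h1 := mul_log_partitionSum_le (ν := ν) hΛD
  have h2 := mul_log_partitionSum_le (ν := ν) hΛDc
  have hsum : ν.real {x | initialWord x.1 n ∈ D} + ν.real {x | initialWord x.1 n ∈ Dᶜ} = 1 := by
    have hc : {x : X.carrier | initialWord x.1 n ∈ Dᶜ} =
        {x : X.carrier | initialWord x.1 n ∈ D}ᶜ := rfl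
    rw [hc, hDF]
    exact probReal_add_probReal_compl (measurableSet_preimage_firstLetters F)
  set d := ν.real {x | initialWord x.1 n ∈ D}
  set d' := ν.real {x | initialWord x.1 n ∈ Dᶜ}
  have hd' : 0 ≤ d' := measureReal_nonneg
  rw [Real.log_mul (by positivity) (Real.exp_pos _).ne', Real.log_exp] at h1 h2
  have hlogε : Real.log (2 * ε) = -(2 * (|Real.log Q| + 3) / s) := by
    rw [hε, mul_div_cancel₀ _ two_ne_zero, Real.log_exp]
  rw [hlogε] at h1
  have h3 : d' * Real.log Q ≤ |Real.log Q| := by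
    refine (mul_le_mul_of_nonneg_left (le_abs_self _) hd').trans ?_
    have : d' ≤ 1 := by linarith [measureReal_nonneg (μ := ν) (s := {x | initialWord x.1 n ∈ D})]
    exact mul_le_of_le_one_left (abs_nonneg _) this
  have h4 : |Real.log Q| + 3 ≤ d * (2 * (|Real.log Q| + 3) / s) := by
    calc |Real.log Q| + 3 = s / 2 * (2 * (|Real.log Q| + 3) / s) := by field_simp
      _ ≤ d * (2 * (|Real.log Q| + 3) / s) := mul_le_mul_of_nonneg_right hνD (by positivity)
  have h5 : d * (n * P) + d' * (n * P) = n * P := by rw [← add_mul, hsum, one_mul]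
  linarith

/-- Existence, uniqueness, Gibbs property and equidistribution of periodic orbits for the
equilibrium state of a potential with small tail. -/
theorem exists_unique_equilibriumState (h : IsLoopSystem X Lp) (hT : TailSmall X φ Lp)
    {z : X.carrier} (hz : shiftMap X z = z) :
    ∃ μ : Measure X.carrier, IsEquilibriumState X φ μ ∧
      (∀ ν : Measure X.carrier, IsEquilibriumState X φ ν → ν = μ) ∧
      (∃ K' > 0, ∃ K : ℕ → ℝ → ℝ, (∀ T V, 0 < K T V) ∧ IsGibbs X φ Lp μ K' K) ∧
      WeakStarTendsto X (periodicMeasure X φ) μ := by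
  have : Nonempty X.carrier := ⟨z⟩
  obtain ⟨K', hK', K, hK, hupp, hlow⟩ := exists_eventually_gibbs (φ := φ) h hT
  have huniq : ∀ μ : Measure X.carrier, IsInvariantProbability X μ → IsGibbs X φ Lp μ K' K →
      ∀ ν : Measure X.carrier, IsInvariantProbability X ν → (pressure X φ : EReal) ≤
        measureEntropy ν (shiftMap X) + ((∫ x, φ x ∂ν : ℝ) : EReal) → ν = μ := by
    intro μ hμ hG ν hν hP
    have := hμ.1
    have := hν.1
    exact (hG.ergodic h hT hK' hK hμ).eq_of_absolutelyContinuous hν.2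
      (hG.absolutelyContinuous h hT hK hν hP)
  obtain ⟨U, hU⟩ := Ultrafilter.exists_le (atTop : Filter ℕ)
  obtain ⟨μ, hμ, hG, -⟩ := exists_gibbs_limit hz hupp hlow U hU
  refine ⟨μ, ⟨hμ, fun ν hν => (measureEntropy_add_integral_le hν).trans (hG.pressure_le hK' hμ)⟩,
    fun ν hν => huniq μ hμ hG ν hν.1 ((hG.pressure_le hK' hμ).trans (hν.2 μ hμ)),
    ⟨K', hK', K, hK, hG⟩, fun g => ?_⟩
  -- Along each ultrafilter the limit is again an invariant Gibbs measure with the same constants,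
  -- so uniqueness identifies it with `μ`.
  refine tendsto_iff_ultrafilter _ _ _ |>.2 fun U' hU' => ?_
  obtain ⟨μ', hμ', hG', hg'⟩ := exists_gibbs_limit hz hupp hlow U' hU'
  rw [← huniq μ hμ hG μ' hμ' (hG'.pressure_le hK' hμ')]
  exact hg' g

end Gibbs

end BetaShift

namespace BetaShift

/-! ### Specification from loops -/

section Specification

variable {b : ℕ} {X : Subshift (Fin b) ℕ} {Lp : Set (List (Fin b))}

theorem IsLoopSystem.append_flatten_mem (h : IsLoopSystem X Lp) (m : ℕ)
    (w v : Fin (m + 1) → List (Fin b)) (hwv : ∀ i, w i ++ v i ∈ Lp) :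
    w 0 ++ (List.ofFn fun i : Fin m => v i.castSucc ++ w i.succ).flatten ++ v (Fin.last m) ∈ Lp := by
  induction m with
  | zero => simpa using hwv 0
  | succ m ih =>
    have h1 := h.append_mem _ (hwv 0) _ (ih (fun i => w i.succ) (fun i => v i.succ)
      fun i => hwv i.succ)
    rw [List.ofFn_succ, List.flatten_cons]
    simpa [List.append_assoc] using h1

/-- Completing every word to a loop makes their concatenation a loop. The last completion is dropped
from `x` but stays in the period, which explains `x.length + t`. -/
theorem IsLoopSystem.perSpecification [Nonempty X.carrier] (h : IsLoopSystem X Lp)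
    {D : Set (List (Fin b))} {t : ℕ} (ht : 0 < t)
    (hD : ∀ w ∈ D, ∃ u : List (Fin b), u.length = t ∧ w ++ u ∈ Lp) : PerSpecification X D := by
  refine ⟨t, fun m w hw => ?_⟩
  choose v hv hwv using fun i => hD (w i) (hw i)
  have hx := h.append_flatten_mem m w v hwv
  refine ⟨fun i => v i.castSucc, fun i =>
    ⟨right_mem_language (h.subset_language (hwv i.castSucc)), hv _⟩, _, rfl,
    left_mem_language (h.subset_language hx), ?_⟩
  obtain ⟨p, hp, hper⟩ := h.exists_periodic _ hx (by
    rw [← List.length_pos_iff_ne_nil, List.length_append, hv]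
    omega)
  refine ⟨p, (mem_cylinder_append.1 hp).1, ?_⟩
  rw [List.length_append, hv] at hper
  exact hper

end Specification

/-! ### Prepending words and the lexicographic order -/

section Prepend

variable {b : ℕ}

/-- The sequence that begins with the word `u` and continues with `y`. -/
def prepend : List (Fin b) → (ℕ → Fin b) → ℕ → Fin b
  | [], y => y
  | c :: u, y => fun n => n.casesOn c (prepend u y)

theorem prepend_apply_of_lt (u : List (Fin b)) (y : ℕ → Fin b) {i : ℕ} (hi : i < u.length) :
    prepend u y i = u[i] := by
  induction u generalizing i with
  | nil => simp at hi
  | cons c u ih =>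
    cases i with
    | zero => rfl
    | succ i => exact ih (by simpa using hi)

theorem prepend_apply_add (u : List (Fin b)) (y : ℕ → Fin b) (i : ℕ) :
    prepend u y (u.length + i) = y i := by
  induction u with
  | nil => simp [prepend]
  | cons c u ih =>
    rw [List.length_cons, add_right_comm]
    exact ih

theorem initialWord_prepend (u : List (Fin b)) (y : ℕ → Fin b) :
    initialWord (prepend u y) u.length = u := by
  refine List.ext_getElem (by simp) fun i h1 h2 => ?_
  simp [initialWord, prepend_apply_of_lt u y h2]

theorem shift_one_prepend_cons (c : Fin b) (u : List (Fin b)) (y : ℕ → Fin b) :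
    shift 1 (prepend (c :: u) y) = prepend u y := by
  funext i
  rw [SymbolicDynamics.FullShift.shift_apply, add_comm]
  rfl

theorem toLex_le_of_shift_one {x y : ℕ → Fin b} (h0 : x 0 = y 0)
    (h : toLex (shift 1 x) ≤ toLex (shift 1 y)) : toLex x ≤ toLex y := by
  rcases h.eq_or_lt with h | h
  · refine le_of_eq (congrArg toLex (funext fun i => ?_))
    cases i with
    | zero => exact h0
    | succ i =>
      have := congrFun (toLex_inj.1 h) i
      simpa [add_comm] using this
  · obtain ⟨n, h1, h2⟩ := h
    refine le_of_lt ⟨n + 1, fun i hi => ?_, ?_⟩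
    · cases i with
      | zero => exact h0
      | succ i =>
        have := h1 i (by simpa using hi)
        simpa [add_comm] using this
    · simpa [add_comm] using h2

theorem toLex_le_of_zero_lt {x y : ℕ → Fin b} (h0 : x 0 < y 0) : toLex x ≤ toLex y :=
  le_of_lt ⟨0, fun i hi => absurd hi (Nat.not_lt_zero i), h0⟩

theorem apply_le_of_toLex_le {x y : ℕ → Fin b} (h : toLex x ≤ toLex y) {n : ℕ}
    (hn : ∀ i < n, x i = y i) : x n ≤ y n := by
  by_contra! hlt
  exact absurd h (not_le.2 ⟨n, fun i hi => (hn i hi).symm, hlt⟩)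

end Prepend

/-! ### The expansion of one -/

section BetaExpansion

variable {β : ℝ}

theorem betaRemainder_succ (hβ : 1 < β) (n : ℕ) :
    betaRemainder β (n + 1) = β * betaRemainder β n - ((betaExpansion β n).val : ℝ) := by
  have h0 : 0 < β * betaRemainder β n := mul_pos (by linarith) (betaRemainder_pos β n)
  have h1 : 1 ≤ ⌈β * betaRemainder β n⌉₊ := Nat.one_le_ceil_iff.2 h0
  have h2 : (⌈β * betaRemainder β n⌉ : ℤ) = (⌈β * betaRemainder β n⌉₊ : ℤ) :=
    (Int.natCast_ceil_eq_ceil h0.le).symm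
  simp only [betaRemainder, betaExpansion]
  rw [h2]
  push_cast [Nat.cast_sub h1]
  ring

/-- The orbit of remainders starts at its largest possible value `1`. While digits agree, the same
increasing affine map acts on both remainders and keeps their order; the digit is monotone in the
remainder, so the first disagreement goes in the right direction. -/
theorem toLex_shift_betaExpansion_le (hβ : 1 < β) (k : ℕ) :
    toLex (shift k (betaExpansion β)) ≤ toLex (betaExpansion β) := by
  by_contra! hlt
  obtain ⟨n, h1, h2⟩ := hlt
  have h3 : ∀ i ≤ n, betaRemainder β (k + i) ≤ betaRemainder β i := by
    intro i
    induction i with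
    | zero => exact fun _ => betaRemainder_le_one β _
    | succ i ih =>
      intro hi
      have h4 := ih (by omega)
      have h5 : betaExpansion β i = betaExpansion β (k + i) := h1 i hi
      rw [← add_assoc, betaRemainder_succ hβ, betaRemainder_succ hβ, h5]
      nlinarith
  have h4 : betaExpansion β n < betaExpansion β (k + n) := h2
  have h5 : betaExpansion β (k + n) ≤ betaExpansion β n := by
    rw [Fin.le_def]
    simp only [betaExpansion]
    exact Nat.sub_le_sub_right (Nat.ceil_mono (mul_le_mul_of_nonneg_left (h3 n le_rfl)
      (by linarith))) 1
  exact absurd h4 (not_lt.2 h5)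

theorem betaExpansion_zero_pos (hβ : 1 < β) : 0 < betaExpansion β 0 := by
  rw [Fin.lt_def]
  have h : 1 < ⌈β⌉₊ := Nat.lt_ceil.2 (by simpa using hβ)
  simp only [betaExpansion, betaRemainder, mul_one, Fin.val_zero]
  omega

/-- Each digit zero multiplies the remainder by `β`, and remainders are positive and at most one. -/
theorem exists_betaExpansion_pos (hβ : 1 < β) (n : ℕ) : ∃ d, 0 < betaExpansion β (n + d) := by
  by_contra! h
  have h1 : ∀ d, betaRemainder β (n + d) = β ^ d * betaRemainder β n := by
    intro d
    induction d with
    | zero => simp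
    | succ d ih =>
      have h2 : betaExpansion β (n + d) = 0 := le_antisymm (h d) (Fin.zero_le _)
      rw [← add_assoc, betaRemainder_succ hβ, ih, h2, pow_succ]
      simp
      ring
  have h0 := betaRemainder_pos β n
  obtain ⟨d, hd⟩ := pow_unbounded_of_one_lt (betaRemainder β n)⁻¹ hβ
  have h2 := betaRemainder_le_one β (n + d)
  rw [h1] at h2
  rw [inv_lt_iff_one_lt_mul₀ h0] at hd
  linarith

/-- The point `w^β` of the `β`-shift, shifted `k` times. -/
theorem shift_betaExpansion_mem (hβ : 1 < β) (k : ℕ) :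
    shift k (betaExpansion β) ∈ (betaShift β).carrier := by
  intro l
  have : shift l (shift k (betaExpansion β)) = shift (k + l) (betaExpansion β) := by
    funext i; simp [add_assoc]
  rw [this]
  exact toLex_shift_betaExpansion_le hβ _

theorem mem_betaShift_of_shift_one {x : ℕ → BetaAlphabet β}
    (h : shift 1 x ∈ (betaShift β).carrier) (h0 : toLex x ≤ toLex (betaExpansion β)) :
    x ∈ (betaShift β).carrier := by
  intro k
  cases k with
  | zero => simpa using h0
  | succ k =>
    have : shift (k + 1) x = shift k (shift 1 x) := by
      funext i; simp only [SymbolicDynamics.FullShift.shift_apply]; congr 1; omega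
    rw [this]
    exact h k

end BetaExpansion

/-! ### Paths in the graph, loops and the decomposition of the language -/

section BetaPath

variable {β : ℝ}

theorem BetaPath.append {i j k : ℕ} {u v : List (BetaAlphabet β)} (h : BetaPath β i u j)
    (h' : BetaPath β j v k) : BetaPath β i (u ++ v) k := by
  induction h with
  | nil => exact h'
  | up _ ih => exact (ih h').up
  | back hc _ ih => exact (ih h').back hc

theorem BetaPath.split {i k : ℕ} {u v : List (BetaAlphabet β)} (h : BetaPath β i (u ++ v) k) :
    ∃ j, BetaPath β i u j ∧ BetaPath β j v k := by
  induction u generalizing i with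
  | nil => exact ⟨i, .nil i, h⟩
  | cons c u ih =>
    cases h with
    | up h =>
      obtain ⟨j, h1, h2⟩ := ih h
      exact ⟨j, h1.up, h2⟩
    | back hc h =>
      obtain ⟨j, h1, h2⟩ := ih h
      exact ⟨j, h1.back hc, h2⟩

/-- The graph is deterministic: at vertex `i` the label `w^β_i` goes up, and every other label is
strictly smaller and goes back. -/
theorem BetaPath.unique {i j : ℕ} {u : List (BetaAlphabet β)} (h : BetaPath β i u j) :
    ∀ {k : ℕ}, BetaPath β i u k → j = k := by
  induction h with
  | nil =>
    intro k h'
    cases h'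
    rfl
  | up _ ih =>
    intro k h'
    cases h' with
    | up h' => exact ih h'
    | back hc _ => exact absurd hc (lt_irrefl _)
  | back hc _ ih =>
    intro k h'
    cases h' with
    | up _ => exact absurd hc (lt_irrefl _)
    | back _ h' => exact ih h'

theorem BetaPath.le_add {i j : ℕ} {u : List (BetaAlphabet β)} (h : BetaPath β i u j) :
    j ≤ i + u.length := by
  induction h with
  | nil => simp
  | up _ ih => simp only [List.length_cons]; omega
  | back _ _ ih => simp only [List.length_cons]; omega

/-- The path is read backwards. An edge up keeps the comparison with the tail of `w^β` tight in its
first letter, and an edge back makes it strict, after which nothing is asked of what follows. The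
second conclusion is what carries the induction. -/
theorem BetaPath.prepend_mem (hβ : 1 < β) {i j : ℕ} {u : List (BetaAlphabet β)}
    (h : BetaPath β i u j) {y : ℕ → BetaAlphabet β} (hy : y ∈ (betaShift β).carrier)
    (hyj : toLex y ≤ toLex (shift j (betaExpansion β))) :
    prepend u y ∈ (betaShift β).carrier ∧
      toLex (prepend u y) ≤ toLex (shift i (betaExpansion β)) := by
  induction h with
  | nil => exact ⟨hy, hyj⟩
  | @up i j u h ih =>
    obtain ⟨h1, h2⟩ := ih hyj
    have h3 : toLex (prepend (betaExpansion β i :: u) y) ≤ toLex (shift i (betaExpansion β)) := by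
      refine toLex_le_of_shift_one rfl ?_
      rw [shift_one_prepend_cons]
      have : shift 1 (shift i (betaExpansion β)) = shift (i + 1) (betaExpansion β) := by
        funext n; simp [add_assoc]
      rwa [this]
    exact ⟨mem_betaShift_of_shift_one (by rwa [shift_one_prepend_cons])
      (h3.trans (toLex_shift_betaExpansion_le hβ i)), h3⟩
  | @back i j c u hc h ih =>
    obtain ⟨h1, h2⟩ := ih hyj
    have h3 : toLex (prepend (c :: u) y) ≤ toLex (shift i (betaExpansion β)) :=
      toLex_le_of_zero_lt hc
    exact ⟨mem_betaShift_of_shift_one (by rwa [shift_one_prepend_cons])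
      (h3.trans (toLex_shift_betaExpansion_le hβ i)), h3⟩

theorem BetaPath.mem_language (hβ : 1 < β) {i j : ℕ} {u : List (BetaAlphabet β)}
    (h : BetaPath β i u j) : u ∈ language (betaShift β) := by
  have h1 := (h.prepend_mem hβ (shift_betaExpansion_mem hβ j) le_rfl).1
  refine ⟨⟨_, h1⟩, ?_⟩
  rw [mem_cylinder_iff]
  exact initialWord_prepend _ _

theorem initialWord_succ {b : ℕ} (x : ℕ → Fin b) (n : ℕ) :
    initialWord x (n + 1) = initialWord x n ++ [x n] := by
  rw [initialWord_add]
  simp [initialWord]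

/-- The vertex `j` records that the last `j` letters spell the beginning of `w^β`. Admissibility of
the point shifted to where these letters begin bounds the next letter by `w^β_j`, so an edge with
that label exists. -/
theorem exists_betaPath_initialWord (x : (betaShift β).carrier) (n : ℕ) :
    ∃ j ≤ n, BetaPath β 0 (initialWord x.1 n) j ∧
      ∀ i < j, x.1 (n - j + i) = betaExpansion β i := by
  induction n with
  | zero => exact ⟨0, le_rfl, .nil 0, fun i hi => absurd hi (Nat.not_lt_zero i)⟩
  | succ n ih =>
    obtain ⟨j, hj, hp, hx⟩ := ih
    have h1 : x.1 n ≤ betaExpansion β j := by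
      have h2 := apply_le_of_toLex_le (x.2 (n - j)) (n := j) hx
      have h3 : n - j + j = n := by omega
      rwa [SymbolicDynamics.FullShift.shift_apply, h3] at h2
    rw [initialWord_succ]
    rcases h1.eq_or_lt with h1 | h1
    · refine ⟨j + 1, by omega, hp.append ?_, fun i hi => ?_⟩
      · rw [h1]
        exact (BetaPath.nil _).up
      · have h2 : n + 1 - (j + 1) = n - j := by omega
        rw [h2]
        rcases Nat.lt_succ_iff_lt_or_eq.1 hi with hi | rfl
        · exact hx i hi
        · rw [← h1, show n - i + i = n by omega]
    · exact ⟨0, by omega, hp.append ((BetaPath.nil _).back h1),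
        fun i hi => absurd hi (Nat.not_lt_zero i)⟩

theorem exists_betaPath_of_mem_language {u : List (BetaAlphabet β)}
    (hu : u ∈ language (betaShift β)) : ∃ j, BetaPath β 0 u j := by
  obtain ⟨x, hx⟩ := exists_of_mem_language hu
  obtain ⟨j, -, hj, -⟩ := exists_betaPath_initialWord x u.length
  exact ⟨j, by rwa [hx] at hj⟩

theorem betaPath_replicate (hβ : 1 < β) (n : ℕ) : BetaPath β 0 (List.replicate n 0) 0 := by
  induction n with
  | zero => exact .nil 0
  | succ n ih => exact ih.back (betaExpansion_zero_pos hβ)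

/-- Climb along `w^β` to the nonzero letter, go back with label `0`, and idle on the loop `0` at the
base vertex until length `t`. The idling lets all vertices use the same length. -/
theorem exists_betaPath_return_of_pos (hβ : 1 < β) (d : ℕ) : ∀ j, 0 < betaExpansion β (j + d) →
    ∀ t ≥ d + 1, ∃ u : List (BetaAlphabet β), u.length = t ∧ BetaPath β j u 0 := by
  induction d with
  | zero =>
    intro j hj t ht
    obtain ⟨s, rfl⟩ := Nat.exists_eq_add_of_le' ht
    exact ⟨0 :: List.replicate s 0, by simp, (betaPath_replicate hβ s).back hj⟩
  | succ d ih =>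
    intro j hj t ht
    obtain ⟨s, rfl⟩ : ∃ s, t = s + 1 := ⟨t - 1, by omega⟩
    obtain ⟨u, hu, hp⟩ := ih (j + 1) (by rwa [add_right_comm, add_assoc]) s (by omega)
    exact ⟨betaExpansion β j :: u, by simp [hu], hp.up⟩

/-- All vertices up to `M` are connected to the base vertex by paths of the same length. -/
theorem exists_betaPath_return (hβ : 1 < β) (M : ℕ) : ∃ t > 0, ∀ j ≤ M,
    ∃ u : List (BetaAlphabet β), u.length = t ∧ BetaPath β j u 0 := by
  choose d hd using exists_betaExpansion_pos hβ
  refine ⟨(Finset.range (M + 1)).sup d + 1, Nat.succ_pos _, fun j hj => ?_⟩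
  exact exists_betaPath_return_of_pos hβ (d j) j (hd j) _
    (Nat.succ_le_succ (Finset.le_sup (Finset.mem_range.2 (by omega))))

/-- The words labelling loops at the base vertex. -/
def betaLoops (β : ℝ) : Set (List (BetaAlphabet β)) := {u | BetaPath β 0 u 0}

theorem betaLoops_exists_periodic (hβ : 1 < β) {u : List (BetaAlphabet β)} (hu : u ∈ betaLoops β)
    (hne : u ≠ []) :
    ∃ p ∈ cylinder (betaShift β) u, (shiftMap (betaShift β))^[u.length] p = p := by
  have hl : 0 < u.length := List.length_pos_iff_ne_nil.2 hne
  set p : ℕ → BetaAlphabet β := fun i => u[i % u.length]'(Nat.mod_lt _ hl) with hp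
  have hpp : prepend u p = p := by
    funext i
    rcases lt_or_ge i u.length with hi | hi
    · rw [prepend_apply_of_lt u p hi]
      simp [hp, Nat.mod_eq_of_lt hi]
    · obtain ⟨k, rfl⟩ := Nat.exists_eq_add_of_le hi
      rw [prepend_apply_add]
      simp [hp]
  -- Finitely many copies of `u` followed by zeros are admissible. They converge to the periodic
  -- sequence, and a violation of the lexicographic bound would show in finitely many letters.
  set q : ℕ → ℕ → BetaAlphabet β := fun k => (prepend u)^[k] fun _ => 0 with hq
  have hqmem : ∀ k, q k ∈ (betaShift β).carrier := by
    intro k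
    induction k with
    | zero => exact (zeroPoint β).2
    | succ k ih =>
      simp only [hq, Function.iterate_succ_apply']
      refine (BetaPath.prepend_mem hβ hu ih ?_).1
      simpa using ih 0
  have hqp : ∀ k, ∀ i < k * u.length, q k i = p i := by
    intro k
    induction k with
    | zero => intro i hi; simp at hi
    | succ k ih =>
      intro i hi
      simp only [hq, Function.iterate_succ_apply']
      rw [← hpp]
      rcases lt_or_ge i u.length with hi' | hi'
      · rw [prepend_apply_of_lt u _ hi', prepend_apply_of_lt u _ hi']
      · obtain ⟨l, rfl⟩ := Nat.exists_eq_add_of_le hi'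
        rw [prepend_apply_add, prepend_apply_add]
        exact ih l (by rw [add_mul, one_mul] at hi; omega)
  have hmem : p ∈ (betaShift β).carrier := by
    intro k
    by_contra! hlt
    obtain ⟨n, h1, h2⟩ := hlt
    have h3 : ∀ i ≤ n, q (k + n + 1) (k + i) = p (k + i) := fun i hi =>
      hqp _ _ (by nlinarith)
    have h4 := apply_le_of_toLex_le (hqmem (k + n + 1) k) (n := n) fun i hi => by
      rw [SymbolicDynamics.FullShift.shift_apply, h3 i hi.le]
      exact (h1 i hi).symm
    rw [SymbolicDynamics.FullShift.shift_apply, h3 n le_rfl] at h4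
    exact absurd h2 (not_lt.2 h4)
  refine ⟨⟨p, hmem⟩, ?_, Subtype.ext ?_⟩
  · rw [mem_cylinder_iff]
    change initialWord p u.length = u
    rw [← hpp]
    exact initialWord_prepend u p
  · rw [shiftMap_iterate_val]
    funext i
    rw [SymbolicDynamics.FullShift.shift_apply]
    change p (u.length + i) = p i
    conv_lhs => rw [← hpp]
    rw [prepend_apply_add]

theorem isLoopSystem_betaLoops (hβ : 1 < β) : IsLoopSystem (betaShift β) (betaLoops β) where
  nil_mem := .nil 0
  append_mem _ hu _ hv := BetaPath.append hu hv
  append_mem_language _ hu _ hv :=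
    let ⟨_, hj⟩ := exists_betaPath_of_mem_language hv
    (BetaPath.append hu hj).mem_language hβ
  exists_periodic _ hu hne := betaLoops_exists_periodic hβ hu hne

/-- Cut at the last edge back: after it the path only climbs from the base vertex. If there is no
such edge, the path climbs from `i`. -/
theorem BetaPath.eq_append_or {i k : ℕ} {u : List (BetaAlphabet β)} (h : BetaPath β i u k) :
    (∃ v, BetaPath β i v 0 ∧ u = v ++ (List.range k).map (betaExpansion β)) ∨
      i ≤ k ∧ u = (List.range' i (k - i)).map (betaExpansion β) := by
  induction h with
  | nil => exact Or.inr ⟨le_rfl, by simp⟩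
  | @up i j u _ ih =>
    rcases ih with ⟨v, hv, rfl⟩ | ⟨hij, rfl⟩
    · exact Or.inl ⟨_, hv.up, rfl⟩
    · refine Or.inr ⟨by omega, ?_⟩
      obtain ⟨d, rfl⟩ := Nat.exists_eq_add_of_le hij
      rw [show i + 1 + d - i = d + 1 by omega, Nat.add_sub_cancel_left, List.range'_succ,
        List.map_cons]
  | @back i j c u hc _ ih =>
    rcases ih with ⟨v, hv, rfl⟩ | ⟨-, rfl⟩
    · exact Or.inl ⟨_, hv.back hc, rfl⟩
    · refine Or.inl ⟨[c], (BetaPath.nil 0).back hc, ?_⟩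
      rw [List.range_eq_range']
      rfl

/-- A path from the base vertex ends with a run along the initial segment of `w^β`. -/
theorem BetaPath.exists_eq_append {k : ℕ} {u : List (BetaAlphabet β)} (h : BetaPath β 0 u k) :
    ∃ v, BetaPath β 0 v 0 ∧ u = v ++ (List.range k).map (betaExpansion β) := by
  rcases h.eq_append_or with h | ⟨-, h⟩
  · exact h
  · refine ⟨[], .nil 0, ?_⟩
    rw [h, List.range_eq_range']
    rfl

theorem betaGood_subset_language (hβ : 1 < β) : betaGood β ⊆ language (betaShift β) := by
  rintro u (⟨h, -⟩ | h) <;> exact h.mem_language hβ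

/-- Words of `betaGood` are empty or end with a nonzero letter. -/
theorem getLast?_ne_of_mem_betaGood (hβ : 1 < β) {u : List (BetaAlphabet β)}
    (hu : u ∈ betaGood β) : u.getLast? ≠ some 0 := by
  rcases hu with ⟨-, h⟩ | h
  · exact h
  · obtain ⟨v, -, rfl⟩ := h.exists_eq_append
    have := (betaExpansion_zero_pos hβ).ne'
    simpa using this

theorem exists_eq_append_replicate {b : ℕ} [NeZero b] (u : List (Fin b)) :
    ∃ v l, u = v ++ List.replicate l 0 ∧ v.getLast? ≠ some 0 := by
  induction u using List.reverseRecOn with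
  | nil => exact ⟨[], 0, rfl, by simp⟩
  | append_singleton u c ih =>
    by_cases hc : c = 0
    · obtain ⟨v, l, rfl, hv⟩ := ih
      exact ⟨v, l + 1, by rw [hc, List.replicate_succ', List.append_assoc], hv⟩
    · exact ⟨u ++ [c], 0, by simp, by simpa using hc⟩

/-- Every word of the language is the concatenation of a good word and a suffix word. -/
theorem exists_betaGood_append_betaSuffix {u : List (BetaAlphabet β)}
    (hu : u ∈ language (betaShift β)) :
    ∃ v ∈ betaGood β, ∃ s ∈ betaSuffix β, u = v ++ s := by
  obtain ⟨u, l, rfl, hlast⟩ := exists_eq_append_replicate u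
  have hs := right_mem_language hu
  obtain ⟨k, hk⟩ := exists_betaPath_of_mem_language (left_mem_language hu)
  rcases k.eq_zero_or_pos with rfl | hk0
  · exact ⟨u, Or.inl ⟨hk, hlast⟩, _, ⟨hs, Or.inr (Or.inr ⟨l, rfl⟩)⟩, rfl⟩
  obtain ⟨v, hv, rfl⟩ := hk.exists_eq_append
  -- The final climb is cut after its first edge, so that the good word ends in the nonzero letter
  -- `w^β_0`. The rest of the climb and the stripped zeros form the suffix.
  have hgood : v ++ [betaExpansion β 0] ∈ betaGood β := Or.inr (hv.append (BetaPath.nil 1).up)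
  obtain ⟨k, rfl⟩ : ∃ m, k = m + 1 := ⟨k - 1, by omega⟩
  rw [List.range_succ_eq_map, List.map_cons] at hu ⊢
  rw [show v ++ betaExpansion β 0 :: List.map (betaExpansion β) (List.map Nat.succ (List.range k)) ++
    List.replicate l 0 = (v ++ [betaExpansion β 0]) ++
    (List.map (betaExpansion β) (List.map Nat.succ (List.range k)) ++ List.replicate l 0) by simp]
    at hu ⊢
  refine ⟨_, hgood, _, ⟨right_mem_language hu, ?_⟩, rfl⟩
  rcases k.eq_zero_or_pos with rfl | hk1
  · exact Or.inr (Or.inr ⟨l, by simp⟩)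
  -- The last letter of the climb takes the place of the free letter `c`.
  · refine Or.inr (Or.inl ⟨k, hk1, betaExpansion β k, l, ?_⟩)
    obtain ⟨k, rfl⟩ : ∃ m, k = m + 1 := ⟨k - 1, by omega⟩
    conv_rhs => rw [List.range_succ_eq_map, List.map_cons, List.tail_cons]
    rw [List.range_succ]
    simp

theorem concatWords_betaShift :
    concatWords (betaShift β) {[]} (betaGood β) (betaSuffix β) = language (betaShift β) := by
  refine Subset.antisymm (fun u hu => hu.1) fun u hu => ⟨hu, [], rfl, ?_⟩
  obtain ⟨v, hv, s, hs, rfl⟩ := exists_betaGood_append_betaSuffix hu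
  exact ⟨v, hv, s, hs, by simp⟩

/-- The words of `G(M)` are completed to loops by words of the same length. -/
theorem exists_completion (hβ : 1 < β) (M : ℕ) : ∃ t > 0,
    ∀ w ∈ fattened (betaShift β) {[]} (betaGood β) (betaSuffix β) M,
      ∃ u : List (BetaAlphabet β), u.length = t ∧ w ++ u ∈ betaLoops β := by
  -- A good word ends at vertex `0` or `1`, and each of the at most `M` letters of the suffix raises
  -- the vertex by at most one.
  obtain ⟨t, ht, h⟩ := exists_betaPath_return hβ (M + 1)
  refine ⟨t, ht, ?_⟩
  rintro w ⟨hw, c, hc, v, hv, s, -, rfl, -, hs⟩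
  rw [mem_singleton_iff] at hc
  subst hc
  rw [List.nil_append] at hw ⊢
  obtain ⟨k, hk⟩ := exists_betaPath_of_mem_language hw
  obtain ⟨j, h1, h2⟩ := hk.split
  have hj : j ≤ 1 := by
    rcases hv with ⟨hv, -⟩ | hv
    · exact (h1.unique hv).le.trans zero_le_one
    · exact (h1.unique hv).le
  obtain ⟨u, hu, hp⟩ := h k (by have := h2.le_add; omega)
  exact ⟨u, hu, hk.append hp⟩

instance nonempty_betaShift : Nonempty (betaShift β).carrier := ⟨zeroPoint β⟩

theorem perSpecification_fattened (hβ : 1 < β) (M : ℕ) :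
    PerSpecification (betaShift β) (fattened (betaShift β) {[]} (betaGood β) (betaSuffix β) M) :=
  let ⟨_, ht, h⟩ := exists_completion hβ M
  (isLoopSystem_betaLoops hβ).perSpecification ht h

theorem shiftMap_zeroPoint : shiftMap (betaShift β) (zeroPoint β) = zeroPoint β := rfl

end BetaPath

end BetaShift

namespace BetaShift

/-! ### Grid functions and the Bowen property -/

section Grid

variable {β : ℝ}

theorem getElem_eq_zero_of_mem_minimalForbidden {u : List (BetaAlphabet β)}
    (hu : u ∈ minimalForbidden (betaShift β) (zeroShift β)) {i : ℕ} (hi : i + 1 < u.length) :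
    u[i] = 0 := by
  obtain ⟨x, hx⟩ := hu.2.2
  have h1 : i < u.dropLast.length := by rw [List.length_dropLast]; omega
  have h2 := hx i h1
  rw [List.getElem_dropLast] at h2
  rw [← h2, (show x.1 = fun _ => 0 from x.2)]

/-- Minimal words have the form `0^n z`. One longer than `k + 1` would put a zero at position `k` of
`x`, and a shorter one only sees letters that `x` and `y` share. -/
theorem mem_cylinder_of_mem_minimalForbidden {u : List (BetaAlphabet β)}
    (hu : u ∈ minimalForbidden (betaShift β) (zeroShift β)) {x y : (betaShift β).carrier} {k : ℕ}
    (hxy : ∀ i ≤ k, x.1 i = y.1 i) (hk : x.1 k ≠ 0) (hx : x ∈ cylinder (betaShift β) u) :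
    y ∈ cylinder (betaShift β) u := by
  rcases le_or_gt u.length (k + 1) with h | h
  · intro i hi
    rw [← hxy i (by omega)]
    exact hx i hi
  · refine absurd ?_ hk
    rw [hx k (by omega)]
    exact getElem_eq_zero_of_mem_minimalForbidden hu h

/-- The grid function at `x` depends only on the letters up to the first nonzero one. -/
theorem gridFunction_congr (a : List (BetaAlphabet β) → ℝ) {x y : (betaShift β).carrier} {k : ℕ}
    (hxy : ∀ i ≤ k, x.1 i = y.1 i) (hk : x.1 k ≠ 0) :
    gridFunction (betaShift β) (zeroShift β) a x = gridFunction (betaShift β) (zeroShift β) a y := by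
  refine tsum_congr fun u => ?_
  have h : x ∈ cylinder (betaShift β) u.1 ↔ y ∈ cylinder (betaShift β) u.1 :=
    ⟨mem_cylinder_of_mem_minimalForbidden u.2 hxy hk,
      mem_cylinder_of_mem_minimalForbidden u.2 (fun i hi => (hxy i hi).symm)
        (by rwa [← hxy k le_rfl])⟩
  by_cases hx : x ∈ cylinder (betaShift β) u.1
  · rw [indicator_of_mem hx, indicator_of_mem (h.1 hx)]
  · rw [indicator_of_notMem hx, indicator_of_notMem fun hy => hx (h.2 hy)]

/-- A function on the `β`-shift that depends only on the letters up to the first nonzero one. -/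
def DependsOnFirstNonzero (φ : C((betaShift β).carrier, ℝ)) : Prop :=
  ∀ (x y : (betaShift β).carrier) (k : ℕ), (∀ i ≤ k, x.1 i = y.1 i) → x.1 k ≠ 0 → φ x = φ y

theorem DependsOnFirstNonzero.birkhoffSum_eq {φ : C((betaShift β).carrier, ℝ)}
    (h : DependsOnFirstNonzero φ) {n : ℕ} {x y : (betaShift β).carrier}
    (hxy : ∀ i ≤ n, x.1 i = y.1 i) (hn : x.1 n ≠ 0) :
    birkhoffSum (shiftMap (betaShift β)) φ (n + 1) x =
      birkhoffSum (shiftMap (betaShift β)) φ (n + 1) y := by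
  refine Finset.sum_congr rfl fun i hi => h _ _ (n - i) (fun j hj => ?_) ?_
  · rw [shiftMap_iterate_apply, shiftMap_iterate_apply]
    exact hxy _ (by have := Finset.mem_range.1 hi; omega)
  · rw [shiftMap_iterate_apply, show i + (n - i) = n by have := Finset.mem_range.1 hi; omega]
    exact hn

/-- A nonempty good word ends in a nonzero letter, which every earlier time sees ahead. The grid
part of the Birkhoff sum is thus constant on the cylinder, and only `φr` oscillates. -/
theorem bowenOn_betaGood (hβ : 1 < β) {φ φr φ0 : C((betaShift β).carrier, ℝ)}
    (hφ : φ = φr + φ0) (hφr : BowenOn (betaShift β) φr (language (betaShift β)))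
    (h0 : DependsOnFirstNonzero φ0) : BowenOn (betaShift β) φ (betaGood β) := by
  obtain ⟨V, hV⟩ := hφr
  refine ⟨V, fun w hw x hx y hy => ?_⟩
  have h1 : birkhoffSum (shiftMap (betaShift β)) φ0 w.length x =
      birkhoffSum (shiftMap (betaShift β)) φ0 w.length y := by
    have hlast := getLast?_ne_of_mem_betaGood hβ hw
    rcases List.eq_nil_or_concat w with rfl | ⟨v, c, rfl⟩
    · simp
    · have hc : c ≠ 0 := by simpa using hlast
      have hl : (v.concat c).length = v.length + 1 := by simp
      rw [hl]
      refine h0.birkhoffSum_eq (fun i hi => ?_) ?_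
      · rw [hx i (by omega), hy i (by omega)]
      · rw [hx v.length (by omega)]
        simpa using hc
  have h2 : ∀ z, birkhoffSum (shiftMap (betaShift β)) φ w.length z =
      birkhoffSum (shiftMap (betaShift β)) φr w.length z +
        birkhoffSum (shiftMap (betaShift β)) φ0 w.length z := by
    intro z
    rw [hφ]
    exact birkhoffSum_add' _ _ _ _ _
  rw [h2, h2, h1, add_sub_add_right_eq_sub]
  exact hV w (betaGood_subset_language hβ hw) x hx y hy

end Grid

/-! ### Lowering letters of `w^β`: the pressure gap -/

section Modification

variable {β : ℝ}

/-- The letter below `c`. -/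
def decLetter {b : ℕ} (c : Fin b) : Fin b := ⟨c.1 - 1, lt_of_le_of_lt (Nat.sub_le _ _) c.2⟩

theorem decLetter_le {b : ℕ} (c : Fin b) : decLetter c ≤ c := Nat.sub_le _ _

theorem decLetter_ne {b : ℕ} [NeZero b] {c : Fin b} (hc : c ≠ 0) : decLetter c ≠ c := by
  intro h
  have h1 : c.1 - 1 = c.1 := congrArg Fin.val h
  have h2 : c.1 ≠ 0 := fun h' => hc (Fin.ext (by simpa using h'))
  omega

/-- The sequence `w^β` as a point of the `β`-shift. -/
noncomputable def expansionPoint (hβ : 1 < β) : (betaShift β).carrier :=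
  ⟨betaExpansion β, by simpa using shift_betaExpansion_mem hβ 0⟩

/-- The point obtained from `w^β` by lowering the letters at the positions in `S`. -/
noncomputable def loweredPoint (hβ : 1 < β) (S : Finset ℕ) : (betaShift β).carrier :=
  ⟨fun i => if i ∈ S then decLetter (betaExpansion β i) else betaExpansion β i, fun k => by
    -- Lowering letters pointwise lowers every shift lexicographically, so the point stays
    -- admissible.
    refine le_trans (Pi.toLex_monotone fun i => ?_) (toLex_shift_betaExpansion_le hβ k)
    simp only [SymbolicDynamics.FullShift.shift_apply]
    split_ifs
    · exact decLetter_le _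
    · exact le_rfl⟩

theorem loweredPoint_apply (hβ : 1 < β) (S : Finset ℕ) (i : ℕ) :
    (loweredPoint hβ S).1 i =
      if i ∈ S then decLetter (betaExpansion β i) else betaExpansion β i := rfl

/-- The length of the run of zeros in `w^β` that ends before position `n`. -/
noncomputable def zeroRun (β : ℝ) : ℕ → ℕ
  | 0 => 0
  | n + 1 => if betaExpansion β n = 0 then zeroRun β n + 1 else 0

theorem sub_le_zeroRun {i j : ℕ} (h : ∀ k, i ≤ k → k < j → betaExpansion β k = 0) :
    j - i ≤ zeroRun β j := by
  induction j with
  | zero => simp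
  | succ j ih =>
    rcases le_or_gt i j with hij | hij
    · rw [zeroRun, if_pos (h j hij (Nat.lt_succ_self j))]
      have := ih fun k h1 h2 => h k h1 (by omega)
      omega
    · omega

/-- Lowering one more letter, before all the others, at bounded cost. -/
theorem birkhoffSum_lowered_insert (hβ : 1 < β) {φ φr φ0 : C((betaShift β).carrier, ℝ)}
    (hφ : φ = φr + φ0) {V : ℝ} (hV : ∀ w ∈ language (betaShift β),
      ∀ x ∈ cylinder (betaShift β) w, ∀ y ∈ cylinder (betaShift β) w,
      |birkhoffSum (shiftMap (betaShift β)) φr w.length x -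
        birkhoffSum (shiftMap (betaShift β)) φr w.length y| ≤ V)
    (h0 : DependsOnFirstNonzero φ0) {K n j : ℕ} {S : Finset ℕ} (hjn : j < n)
    (hjS : ∀ s ∈ S, j < s) (hrun : zeroRun β j ≤ K) :
    birkhoffSum (shiftMap (betaShift β)) φ n (loweredPoint hβ S) -
      (V + 2 * ‖φr‖ + 2 * (K + 1) * ‖φ0‖) ≤
      birkhoffSum (shiftMap (betaShift β)) φ n (loweredPoint hβ (insert j S)) := by
  set x := loweredPoint hβ S
  set y := loweredPoint hβ (insert j S)
  have hlt : ∀ i < j, y.1 i = x.1 i := by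
    intro i hi
    have h1 : i ∉ S := fun h => absurd (hjS i h) (by omega)
    have h2 : i ∉ insert j S := by
      rw [Finset.mem_insert, not_or]
      exact ⟨hi.ne, h1⟩
    rw [loweredPoint_apply, loweredPoint_apply, if_neg h1, if_neg h2]
  have hxlt : ∀ i < j, x.1 i = betaExpansion β i := by
    intro i hi
    rw [loweredPoint_apply, if_neg fun h => absurd (hjS i h) (by omega)]
  have hgt : (shiftMap (betaShift β))^[j + 1] y = (shiftMap (betaShift β))^[j + 1] x := by
    refine Subtype.ext (funext fun i => ?_)
    rw [shiftMap_iterate_apply, shiftMap_iterate_apply, loweredPoint_apply, loweredPoint_apply]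
    have h1 : j + 1 + i ∈ insert j S ↔ j + 1 + i ∈ S := by
      rw [Finset.mem_insert]
      exact or_iff_right (by omega)
    simp only [h1]
  obtain ⟨m, rfl⟩ : ∃ m, n = j + 1 + m := ⟨n - (j + 1), by omega⟩
  have hr : birkhoffSum (shiftMap (betaShift β)) φr (j + 1) x - (V + 2 * ‖φr‖) ≤
      birkhoffSum (shiftMap (betaShift β)) φr (j + 1) y := by
    rw [birkhoffSum_succ, birkhoffSum_succ]
    have h1 := hV _ (initialWord_mem_language x j) x (mem_cylinder_initialWord x j) y (by
      rw [mem_cylinder_iff, length_initialWord, initialWord_eq_iff]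
      exact hlt)
    rw [length_initialWord] at h1
    have h2 := (abs_le.1 (φr.norm_coe_le_norm ((shiftMap (betaShift β))^[j] x))).2
    have h3 := (abs_le.1 (φr.norm_coe_le_norm ((shiftMap (betaShift β))^[j] y))).1
    have h4 := (abs_le.1 h1).2
    linarith
  -- All lowered positions of `x` lie after `j`, so before `j` both points spell `w^β`. At a time
  -- earlier than `j - K` a nonzero letter lies ahead before `j`, and the two values of `φ0` agree;
  -- at most `K + 1` terms remain.
  have hz : birkhoffSum (shiftMap (betaShift β)) φ0 (j + 1) x - 2 * (K + 1) * ‖φ0‖ ≤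
      birkhoffSum (shiftMap (betaShift β)) φ0 (j + 1) y := by
    have h1 : ∀ i ∈ Finset.range (j + 1), φ0 ((shiftMap (betaShift β))^[i] x) -
        φ0 ((shiftMap (betaShift β))^[i] y) ≤ if j - K ≤ i then 2 * ‖φ0‖ else 0 := by
      intro i hi
      split_ifs with hiK
      · have h2 := (abs_le.1 (φ0.norm_coe_le_norm ((shiftMap (betaShift β))^[i] x))).2
        have h3 := (abs_le.1 (φ0.norm_coe_le_norm ((shiftMap (betaShift β))^[i] y))).1
        linarith
      · obtain ⟨k, hik, hkj, hk⟩ : ∃ k, i ≤ k ∧ k < j ∧ betaExpansion β k ≠ 0 := by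
          by_contra! hcon
          have := sub_le_zeroRun hcon
          omega
        refine (sub_eq_zero.2 (h0 _ _ (k - i) (fun l hl => ?_) ?_)).le
        · rw [shiftMap_iterate_apply, shiftMap_iterate_apply]
          exact (hlt _ (by omega)).symm
        · rw [shiftMap_iterate_apply, show i + (k - i) = k by omega, hxlt k hkj]
          exact hk
    have h2 := Finset.sum_le_sum h1
    rw [Finset.sum_sub_distrib, ← Finset.sum_filter, Finset.sum_const, nsmul_eq_mul] at h2
    have h3 : ((Finset.range (j + 1)).filter fun i => j - K ≤ i).card ≤ K + 1 := by
      refine (Finset.card_le_card (t := Finset.Ico (j - K) (j + 1)) fun i hi => ?_).trans ?_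
      · rw [Finset.mem_filter, Finset.mem_range] at hi
        exact Finset.mem_Ico.2 ⟨hi.2, hi.1⟩
      · rw [Nat.card_Ico]
        omega
    have h4 : (((Finset.range (j + 1)).filter fun i => j - K ≤ i).card : ℝ) * (2 * ‖φ0‖) ≤
        (K + 1) * (2 * ‖φ0‖) :=
      mul_le_mul_of_nonneg_right (by exact_mod_cast h3) (by positivity)
    simp only [birkhoffSum]
    linarith
  have hsplit : ∀ z, birkhoffSum (shiftMap (betaShift β)) φ (j + 1 + m) z =
      birkhoffSum (shiftMap (betaShift β)) φr (j + 1) z +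
      birkhoffSum (shiftMap (betaShift β)) φ0 (j + 1) z +
      birkhoffSum (shiftMap (betaShift β)) φ m ((shiftMap (betaShift β))^[j + 1] z) := by
    intro z
    rw [birkhoffSum_add]
    congr 1
    rw [hφ]
    exact birkhoffSum_add' _ _ _ _ _
  rw [hsplit, hsplit, hgt]
  linarith

/-- The positions before `n` of nonzero letters of `w^β` preceded by at most `K` zeros. -/
noncomputable def lowerable (β : ℝ) (K n : ℕ) : Finset ℕ :=
  (Finset.range n).filter fun j => betaExpansion β j ≠ 0 ∧ zeroRun β j ≤ K

/-- The partition sum is larger than `exp (S_n φ(w^β))` by a factor exponential in the number of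
positions that can be lowered. -/
theorem exists_exp_mul_pow_le_partitionSum (hβ : 1 < β) {φ φr φ0 : C((betaShift β).carrier, ℝ)}
    (hφ : φ = φr + φ0) (hφr : BowenOn (betaShift β) φr (language (betaShift β)))
    (h0 : DependsOnFirstNonzero φ0) (K : ℕ) : ∃ C : ℝ, ∀ n : ℕ,
      Real.exp (birkhoffSum (shiftMap (betaShift β)) φ n (expansionPoint hβ)) *
        (1 + Real.exp (-C)) ^ (lowerable β K n).card ≤
        partitionSum (betaShift β) φ (language (betaShift β)) n := by
  classical
  obtain ⟨V, hV⟩ := hφr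
  set C := V + 2 * ‖φr‖ + 2 * (K + 1) * ‖φ0‖ with hC
  refine ⟨C, fun n => ?_⟩
  have hS : ∀ S : Finset ℕ, S ⊆ lowerable β K n →
      birkhoffSum (shiftMap (betaShift β)) φ n (expansionPoint hβ) - S.card * C ≤
        birkhoffSum (shiftMap (betaShift β)) φ n (loweredPoint hβ S) := by
    intro S
    -- Positions are inserted from right to left, so each new one precedes all earlier ones as
    -- `birkhoffSum_lowered_insert` requires.
    induction S using Finset.induction_on_min with
    | empty =>
      intro _
      have : loweredPoint hβ ∅ = expansionPoint hβ := rfl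
      rw [this]
      simp
    | insert j S hj ih =>
      intro hsub
      have h1 := ih ((Finset.subset_insert _ _).trans hsub)
      have h2 := Finset.mem_filter.1 (hsub (Finset.mem_insert_self j S))
      have h3 := birkhoffSum_lowered_insert hβ hφ hV h0 (Finset.mem_range.1 h2.1) hj h2.2.2
      rw [Finset.card_insert_of_notMem fun h => lt_irrefl j (hj j h)]
      push_cast
      linarith
  -- The binomial expansion over subsets of positions. Different subsets give different words since
  -- only nonzero letters are lowered.
  have hsum : Real.exp (birkhoffSum (shiftMap (betaShift β)) φ n (expansionPoint hβ)) *
      (1 + Real.exp (-C)) ^ (lowerable β K n).card =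
      ∑ S ∈ (lowerable β K n).powerset,
        Real.exp (birkhoffSum (shiftMap (betaShift β)) φ n (expansionPoint hβ) - S.card * C) := by
    rw [add_comm 1, ← Finset.sum_pow_mul_eq_add_pow, Finset.mul_sum]
    refine Finset.sum_congr rfl fun S _ => ?_
    rw [one_pow, mul_one, ← Real.exp_nat_mul, ← Real.exp_add]
    ring_nf
  rw [hsum]
  refine sum_le_sum_of_injOn (e := fun S => firstLetters (betaShift β) n (loweredPoint hβ S)) ?_
    (fun _ _ => Finset.mem_univ _) ?_ fun u _ => upperWeight_nonneg _ _
  · intro S hS S' hS' hSS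
    have hS := Finset.mem_powerset.1 hS
    have hS' := Finset.mem_powerset.1 hS'
    have key : ∀ S S' : Finset ℕ, S ⊆ lowerable β K n →
        firstLetters (betaShift β) n (loweredPoint hβ S) =
          firstLetters (betaShift β) n (loweredPoint hβ S') → S ⊆ S' := by
      intro S S' hS hSS i hi
      have h1 := Finset.mem_filter.1 (hS hi)
      have h2 := congrFun hSS ⟨i, Finset.mem_range.1 h1.1⟩
      simp only [firstLetters, loweredPoint_apply, if_pos hi] at h2
      by_contra hi'
      rw [if_neg hi'] at h2
      exact decLetter_ne h1.2.1 h2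
    exact Finset.Subset.antisymm (key S S' hS hSS) (key S' S hS' hSS.symm)
  · intro S hS'
    have hw := initialWord_mem_language (loweredPoint hβ S) n
    rw [ofFn_firstLetters]
    change _ ≤ upperWeight _ _ _ _
    rw [upperWeight_of_mem hw hw]
    refine Real.exp_le_exp.2 ((hS S (Finset.mem_powerset.1 hS')).trans ?_)
    have h1 := birkhoffSum_le_supBirkhoff (φ := φ) (mem_cylinder_initialWord (loweredPoint hβ S) n)
    rwa [length_initialWord] at h1

/-- The number of nonzero letters of `w^β` before position `n`. -/
noncomputable def nonzeroCount (β : ℝ) (n : ℕ) : ℕ :=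
  ((Finset.range n).filter fun j => betaExpansion β j ≠ 0).card

/-- A nonzero letter that may not be lowered uses up `K + 1` zeros of its own, so there are at most
`n / (K + 1)` of them. The term with `zeroRun` keeps account of the current run in the induction. -/
theorem nonzeroCount_mul_le (β : ℝ) (K n : ℕ) :
    (K + 1) * nonzeroCount β n + min (zeroRun β n) (K + 1) ≤
      (K + 1) * (lowerable β K n).card + n := by
  induction n with
  | zero => simp [nonzeroCount, zeroRun]
  | succ n ih =>
    rw [nonzeroCount, lowerable, Finset.range_add_one, Finset.filter_insert, Finset.filter_insert]
    rw [nonzeroCount, lowerable] at ih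
    by_cases h : betaExpansion β n = 0
    · rw [if_neg (by simpa using h), if_neg (fun h' => h'.1 h), zeroRun, if_pos h]
      have : min (zeroRun β n + 1) (K + 1) ≤ min (zeroRun β n) (K + 1) + 1 := by omega
      omega
    · rw [if_pos h, Finset.card_insert_of_notMem (by simp), zeroRun, if_neg h, Nat.zero_min]
      by_cases h' : zeroRun β n ≤ K
      · rw [if_pos ⟨h, h'⟩, Finset.card_insert_of_notMem (by simp), mul_add, mul_add]
        omega
      · rw [if_neg fun h'' => h' h''.2, mul_add]
        have : min (zeroRun β n) (K + 1) = K + 1 := by omega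
        omega

theorem nonzeroCount_eq_sum (β : ℝ) (n : ℕ) :
    (nonzeroCount β n : ℝ) = ∑ i ∈ Finset.range n, if betaExpansion β i ≠ 0 then 1 else 0 := by
  rw [nonzeroCount, Finset.card_filter]
  push_cast
  rfl

theorem sum_shift_le (z : ℕ → ℝ) (hz0 : ∀ i, 0 ≤ z i) (hz1 : ∀ i, z i ≤ 1) (n d : ℕ) :
    ∑ i ∈ Finset.range n, z (i + d) ≤ ∑ i ∈ Finset.range n, z i + d := by
  induction d with
  | zero => simp
  | succ d ih =>
    have h1 := Finset.sum_range_succ' (fun i => z (i + d)) n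
    have h2 := Finset.sum_range_succ (fun i => z (i + d)) n
    have h3 : ∑ i ∈ Finset.range n, z (i + (d + 1)) = ∑ i ∈ Finset.range n, z (i + 1 + d) :=
      Finset.sum_congr rfl fun i _ => by congr 1; omega
    rw [h3]
    push_cast
    have h4 := hz0 (0 + d)
    have h5 := hz1 (n + d)
    linarith

/-- The Birkhoff sums along `w^β` are close to those at the fixed point if `w^β` has few nonzero
letters. -/
theorem exists_birkhoffSum_expansion_le (hβ : 1 < β) (φ : C((betaShift β).carrier, ℝ)) {ε : ℝ}
    (hε : 0 < ε) : ∃ N : ℕ, ∀ n : ℕ,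
      birkhoffSum (shiftMap (betaShift β)) φ n (expansionPoint hβ) ≤
        n * (φ (zeroPoint β) + ε) + 2 * ‖φ‖ * N * (nonzeroCount β n + N) := by
  obtain ⟨N, hN⟩ := exists_initialWord_uniform φ hε
  refine ⟨N, fun n => ?_⟩
  set z : ℕ → ℝ := fun i => if betaExpansion β i ≠ 0 then 1 else 0 with hz
  have hz0 : ∀ i, 0 ≤ z i := fun i => by simp only [hz]; split_ifs <;> norm_num
  have hz1 : ∀ i, z i ≤ 1 := fun i => by simp only [hz]; split_ifs <;> norm_num
  -- If the next `N` letters are zero, the value is within `ε` of `φ(0)`; otherwise the loss is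
  -- charged to a nonzero letter in this window. Each letter lies in at most `N` windows.
  have h1 : ∀ i, φ ((shiftMap (betaShift β))^[i] (expansionPoint hβ)) ≤
      φ (zeroPoint β) + ε + 2 * ‖φ‖ * ∑ d ∈ Finset.range N, z (i + d) := by
    intro i
    by_cases hi : ∀ d < N, betaExpansion β (i + d) = 0
    · have h2 := hN ((shiftMap (betaShift β))^[i] (expansionPoint hβ)) (zeroPoint β) fun d hd => by
        rw [shiftMap_iterate_apply]
        exact hi d hd
      have h3 := (abs_le.1 h2.le).2
      have h4 : 0 ≤ 2 * ‖φ‖ * ∑ d ∈ Finset.range N, z (i + d) :=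
        mul_nonneg (by positivity) (Finset.sum_nonneg fun d _ => hz0 _)
      linarith
    · push Not at hi
      obtain ⟨d, hd, hne⟩ := hi
      have h2 : 1 ≤ ∑ d ∈ Finset.range N, z (i + d) := by
        refine le_trans (le_of_eq ?_) (Finset.single_le_sum (f := fun d => z (i + d))
          (fun d _ => hz0 _) (Finset.mem_range.2 hd))
        simp only [hz, if_pos hne]
      have h3 := mul_le_mul_of_nonneg_left h2 (by positivity : 0 ≤ 2 * ‖φ‖)
      have h4 := (abs_le.1 (φ.norm_coe_le_norm
        ((shiftMap (betaShift β))^[i] (expansionPoint hβ)))).2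
      have h5 := (abs_le.1 (φ.norm_coe_le_norm (zeroPoint β))).1
      linarith
  have h2 : ∑ i ∈ Finset.range n, ∑ d ∈ Finset.range N, z (i + d) ≤
      N * (nonzeroCount β n + N) := by
    rw [Finset.sum_comm, nonzeroCount_eq_sum]
    have h3 : ∀ d ∈ Finset.range N, ∑ i ∈ Finset.range n, z (i + d) ≤
        ∑ i ∈ Finset.range n, z i + N := fun d hd =>
      (sum_shift_le z hz0 hz1 n d).trans (add_le_add le_rfl
        (by exact_mod_cast (Finset.mem_range.1 hd).le))
    refine (Finset.sum_le_sum h3).trans (le_of_eq ?_)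
    rw [Finset.sum_const, Finset.card_range, nsmul_eq_mul]
  refine (Finset.sum_le_sum fun i _ => h1 i).trans ?_
  rw [Finset.sum_add_distrib, ← Finset.mul_sum, Finset.sum_const, Finset.card_range, nsmul_eq_mul,
    mul_assoc (2 * ‖φ‖)]
  exact add_le_add le_rfl (mul_le_mul_of_nonneg_left h2 (by positivity))

/-- The pressure exceeds the exponential growth rate of the Birkhoff sums along `w^β`. -/
theorem exists_birkhoffSum_expansion_le_pressure (hβ : 1 < β)
    {φ φr φ0 : C((betaShift β).carrier, ℝ)}
    (hφ : φ = φr + φ0) (hφr : BowenOn (betaShift β) φr (language (betaShift β)))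
    (h0 : DependsOnFirstNonzero φ0) (hP : φ (zeroPoint β) < pressure (betaShift β) φ) :
    ∃ η > 0, ∃ C : ℝ, ∀ n : ℕ, birkhoffSum (shiftMap (betaShift β)) φ n (expansionPoint hβ) ≤
      n * (pressure (betaShift β) φ - η) + C := by
  set P := pressure (betaShift β) φ
  set ε := (P - φ (zeroPoint β)) / 4 with hε
  have hε0 : 0 < ε := by linarith
  obtain ⟨N, hN⟩ := exists_birkhoffSum_expansion_le hβ φ hε0
  set B := 2 * ‖φ‖ * N with hB
  have hB0 : 0 ≤ B := by positivity
  -- `θ` is the density threshold for nonzero letters. Below it the rate is at most `φ(0) + 2 ε = P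
  -- - 2 ε`. Above it, `1 / (K + 1) < θ / 2` leaves `θ n / 2` positions to lower, a gain of `2 δ n`;
  -- as log partition sums are eventually at most `n (P + δ)`, the rate is at most `P - δ`.
  set θ := ε / (B + 1) with hθ
  have hθ0 : 0 < θ := by positivity
  have hBθ : B * θ ≤ ε := by
    rw [hθ, mul_div_assoc', div_le_iff₀ (by positivity)]
    nlinarith
  obtain ⟨K, hK⟩ := exists_nat_one_div_lt (half_pos hθ0)
  obtain ⟨C, hC⟩ := exists_exp_mul_pow_le_partitionSum hβ hφ hφr h0 K
  set lam := Real.log (1 + Real.exp (-C)) with hlam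
  have hlam0 : 0 < lam := Real.log_pos (by linarith [Real.exp_pos (-C)])
  set δ := θ / 4 * lam with hδ
  have hδ0 : 0 < δ := by positivity
  have hev : ∀ᶠ n : ℕ in atTop, birkhoffSum (shiftMap (betaShift β)) φ n (expansionPoint hβ) ≤
      n * (P - min (2 * ε) δ) + B * N := by
    filter_upwards [(tendsto_log_partitionSum (φ := φ)).eventually_le_const
      (show P < P + δ by linarith), eventually_gt_atTop 0] with n hn hn0
    have hn' : (0 : ℝ) < n := by exact_mod_cast hn0
    rw [div_le_iff₀ hn'] at hn
    have hBN : 0 ≤ B * N := by positivity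
    rcases le_or_gt (nonzeroCount β n : ℝ) (θ * n) with hcase | hcase
    · have h1 := hN n
      have h2 : B * (nonzeroCount β n + N) ≤ ε * n + B * N := by
        have := mul_le_mul_of_nonneg_left hcase hB0
        have := mul_le_mul_of_nonneg_right hBθ hn'.le
        linarith
      have h3 : (n : ℝ) * min (2 * ε) δ ≤ n * (2 * ε) :=
        mul_le_mul_of_nonneg_left (min_le_left _ _) hn'.le
      have h4 : φ (zeroPoint β) = P - 4 * ε := by rw [hε]; ring
      rw [h4] at h1
      linarith
    · have h1 : θ / 2 * n ≤ (lowerable β K n).card := by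
        have h2 := nonzeroCount_mul_le β K n
        have h3 : ((K : ℝ) + 1) * nonzeroCount β n ≤ (K + 1) * (lowerable β K n).card + n := by
          have : (K + 1) * nonzeroCount β n ≤ (K + 1) * (lowerable β K n).card + n := by omega
          exact_mod_cast this
        have hK1 : (0 : ℝ) < K + 1 := by positivity
        rw [div_lt_iff₀ hK1] at hK
        have h4 : (n : ℝ) ≤ θ / 2 * (K + 1) * n := by
          have := mul_le_mul_of_nonneg_right hK.le hn'.le
          linarith
        have h5 := mul_lt_mul_of_pos_left hcase hK1
        refine le_of_mul_le_mul_left ?_ hK1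
        linarith
      have h2 := Real.log_le_log (by positivity) (hC n)
      rw [Real.log_mul (Real.exp_pos _).ne' (by positivity), Real.log_exp, Real.log_pow] at h2
      have h3 := mul_le_mul_of_nonneg_right h1 hlam0.le
      have h4 : (n : ℝ) * min (2 * ε) δ ≤ n * δ :=
        mul_le_mul_of_nonneg_left (min_le_right _ _) hn'.le
      have h5 : θ / 2 * n * lam = 2 * (n * δ) := by rw [hδ]; ring
      linarith
  obtain ⟨n0, hn0⟩ := eventually_atTop.1 hev
  refine ⟨min (2 * ε) δ, by positivity, B * N + n0 * (‖φ‖ + |P - min (2 * ε) δ|), fun n => ?_⟩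
  have hnn : 0 ≤ ‖φ‖ + |P - min (2 * ε) δ| := by positivity
  rcases le_or_gt n0 n with h | h
  · have h1 := hn0 n h
    have h2 : 0 ≤ n0 * (‖φ‖ + |P - min (2 * ε) δ|) := by positivity
    linarith
  · have h1 := (abs_le.1 (abs_birkhoffSum_le φ n (expansionPoint hβ))).2
    have h2 : (n : ℝ) * (‖φ‖ + |P - min (2 * ε) δ|) ≤ n0 * (‖φ‖ + |P - min (2 * ε) δ|) :=
      mul_le_mul_of_nonneg_right (by exact_mod_cast h.le) hnn
    have h3 : -(n * |P - min (2 * ε) δ|) ≤ n * (P - min (2 * ε) δ) := by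
      have := mul_le_mul_of_nonneg_left (neg_abs_le (P - min (2 * ε) δ)) n.cast_nonneg (α := ℝ)
      linarith
    have h4 : 0 ≤ B * N := by positivity
    linarith

end Modification

end BetaShift

namespace BetaShift

/-! ### Summability over suffix words -/

section SuffixWords

variable {β : ℝ}

/-- Suffix words have exponentially small weight relative to the pressure. -/
theorem exists_supBirkhoff_betaSuffix_le (hβ : 1 < β) {φ φr φ0 : C((betaShift β).carrier, ℝ)}
    (hφ : φ = φr + φ0) (hφr : BowenOn (betaShift β) φr (language (betaShift β)))
    (h0 : DependsOnFirstNonzero φ0) (hP : φ (zeroPoint β) < pressure (betaShift β) φ) :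
    ∃ η > 0, ∃ C : ℝ, ∀ u ∈ betaSuffix β, supBirkhoff (betaShift β) φ u ≤
      u.length * (pressure (betaShift β) φ - η) + C := by
  obtain ⟨η₀, hη₀, C₀, hC₀⟩ := exists_birkhoffSum_expansion_le_pressure hβ hφ hφr h0 hP
  set P := pressure (betaShift β) φ
  -- Half of the available gap is kept in reserve: passing from one point to the supremum over its
  -- cylinder costs `n η` by continuity, since no Bowen property is at hand on suffix words.
  set η := min η₀ (P - φ (zeroPoint β)) / 2 with hη
  have hmin : 0 < min η₀ (P - φ (zeroPoint β)) := lt_min hη₀ (by linarith)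
  have hηpos : 0 < η := by linarith
  have hη1 : 2 * η ≤ η₀ := by linarith [min_le_left η₀ (P - φ (zeroPoint β))]
  have hη2 : φ (zeroPoint β) ≤ P - 2 * η := by linarith [min_le_right η₀ (P - φ (zeroPoint β))]
  obtain ⟨C₁, hC₁⟩ := exists_birkhoffSum_sub_le φ hηpos
  have hpt : ∀ (x : (betaShift β).carrier) (n : ℕ) (c : ℝ),
      birkhoffSum (shiftMap (betaShift β)) φ n x ≤ n * (P - 2 * η) + c →
      supBirkhoff (betaShift β) φ (initialWord x.1 n) ≤ n * (P - η) + (c + C₁) := by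
    intro x n c hc
    have := supBirkhoff_le_of_abs_sub_le (φ := φ) (c := n * η + C₁) (mem_cylinder_initialWord x n)
      fun y hy => by
        rw [mem_cylinder_iff, length_initialWord, initialWord_eq_iff] at hy
        rw [length_initialWord]
        exact hC₁ n y x hy
    rw [length_initialWord] at this
    linarith
  have hexp : ∀ n : ℕ, birkhoffSum (shiftMap (betaShift β)) φ n (expansionPoint hβ) ≤
      n * (P - 2 * η) + C₀ := fun n => (hC₀ n).trans <| by
    have := mul_le_mul_of_nonneg_left (sub_le_sub_left hη1 P) n.cast_nonneg (α := ℝ)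
    linarith
  have hC₀0 : 0 ≤ C₀ := by simpa using hC₀ 0
  have hC₁0 : 0 ≤ C₁ := by
    simpa using hC₁ 0 (zeroPoint β) (zeroPoint β) fun i hi => absurd hi (by omega)
  have hzero : ∀ l : ℕ, supBirkhoff (betaShift β) φ (List.replicate l 0) ≤ l * (P - η) + C₁ := by
    intro l
    have h1 : List.replicate l 0 = initialWord (zeroPoint β).1 l := by
      rw [initialWord]
      exact (List.ofFn_const l 0).symm
    rw [h1]
    refine (hpt _ l 0 ?_).trans_eq (by ring)
    have h2 : birkhoffSum (shiftMap (betaShift β)) φ l (zeroPoint β) = l * φ (zeroPoint β) := by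
      rw [(show Function.IsFixedPt (shiftMap (betaShift β)) (zeroPoint β) from
        shiftMap_zeroPoint).birkhoffSum_eq, nsmul_eq_mul]
    rw [h2, add_zero]
    exact mul_le_mul_of_nonneg_left hη2 l.cast_nonneg
  have hrest : ∀ (x : (betaShift β).carrier) (n l : ℕ) (c : BetaAlphabet β) (d : ℝ),
      birkhoffSum (shiftMap (betaShift β)) φ n x ≤ n * (P - 2 * η) + d →
      initialWord x.1 n ++ c :: List.replicate l 0 ∈ language (betaShift β) →
      supBirkhoff (betaShift β) φ (initialWord x.1 n ++ c :: List.replicate l 0) ≤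
        (initialWord x.1 n ++ c :: List.replicate l 0).length * (P - η) +
          (d + 2 * C₁ + (‖φ‖ + |P - η|)) := by
    intro x n l c d hd hL
    have h1 := supBirkhoff_append_le (φ := φ) hL
    have hL' : [c] ++ List.replicate l 0 ∈ language (betaShift β) := right_mem_language hL
    have h2 : supBirkhoff (betaShift β) φ (c :: List.replicate l 0) ≤ _ :=
      supBirkhoff_append_le (φ := φ) hL'
    have h3 := supBirkhoff_le_mul_norm (φ := φ) (left_mem_language hL')
    have h4 := hpt x n d hd
    have h5 := hzero l
    have h6 := neg_abs_le (P - η)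
    simp only [List.length_append, length_initialWord, List.length_cons, List.length_replicate,
      List.length_nil] at h3 ⊢
    push_cast at h3 ⊢
    linarith
  refine ⟨η, hηpos, C₀ + |P - 2 * η| + ‖φ‖ + 2 * C₁ + (‖φ‖ + |P - η|), ?_⟩
  have hφ0 := norm_nonneg φ
  have hP1 := abs_nonneg (P - 2 * η)
  have hP2 := abs_nonneg (P - η)
  rintro u ⟨hL, ⟨m, hm, c, l, rfl⟩ | ⟨m, hm, c, l, rfl⟩ | ⟨l, rfl⟩⟩
  · have h1 : (List.range m).map (betaExpansion β) = initialWord (expansionPoint hβ).1 m := by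
      rw [initialWord, List.ofFn_eq_map, ← List.map_coe_finRange_eq_range, List.map_map]
      rfl
    rw [h1] at hL ⊢
    refine (hrest _ m l c C₀ (hexp m) hL).trans ?_
    linarith
  · obtain ⟨m, rfl⟩ : ∃ k, m = k + 1 := ⟨m - 1, by omega⟩
    have h1 : ((List.range (m + 1)).map (betaExpansion β)).tail =
        initialWord (shiftMap (betaShift β) (expansionPoint hβ)).1 m := by
      rw [List.range_succ_eq_map, List.map_cons, List.tail_cons, List.map_map, initialWord,
        List.ofFn_eq_map, ← List.map_coe_finRange_eq_range, List.map_map]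
      refine List.map_congr_left fun i _ => ?_
      simp only [Function.comp_apply]
      rw [← Function.iterate_one (shiftMap (betaShift β)), shiftMap_iterate_apply, add_comm 1]
      rfl
    rw [h1] at hL ⊢
    -- Without its first letter the run is a stretch of the orbit of `w^β` starting one step later;
    -- dropping one term costs at most `‖φ‖`.
    refine (hrest _ m l c (C₀ + |P - 2 * η| + ‖φ‖) ?_ hL).trans ?_
    · have h2 := hexp (m + 1)
      rw [birkhoffSum_succ'] at h2
      have h3 := (abs_le.1 (φ.norm_coe_le_norm (expansionPoint hβ))).1
      have h4 := le_abs_self (P - 2 * η)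
      push_cast at h2
      linarith
    · linarith
  · rw [List.length_replicate]
    linarith [hzero l]

theorem card_filter_betaSuffix_le (n : ℕ) [DecidablePred (· ∈ betaSuffix β)] :
    (Finset.univ.filter fun u : Fin n → BetaAlphabet β => List.ofFn u ∈ betaSuffix β).card ≤
      1 + 2 * ((n + 1) * Fintype.card (BetaAlphabet β)) := by
  classical
  -- A suffix word of length `n` is determined by its form, `m` and `c`. In the second form the tail
  -- has only `m - 1` letters, hence `n - m` zeros. Values of wrong length do no harm, as only the
  -- first `n` letters are read.
  let word : Option (Bool × Fin (n + 1) × BetaAlphabet β) → List (BetaAlphabet β)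
    | none => List.replicate n 0
    | some (true, m, c) =>
      (List.range m).map (betaExpansion β) ++ c :: List.replicate (n - m - 1) 0
    | some (false, m, c) =>
      ((List.range m).map (betaExpansion β)).tail ++ c :: List.replicate (n - m) 0
  have hsub : (Finset.univ.filter fun u : Fin n → BetaAlphabet β =>
      List.ofFn u ∈ betaSuffix β) ⊆ Finset.univ.image fun k => fun i : Fin n => (word k).getD i 0 := by
    intro u hu
    obtain ⟨k, hk⟩ : ∃ k, List.ofFn u = word k := by
      rcases (Finset.mem_filter.1 hu).2.2 with ⟨m, hm, c, l, h⟩ | ⟨m, hm, c, l, h⟩ | ⟨l, h⟩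
      · have hl := congrArg List.length h
        simp at hl
        exact ⟨some (true, ⟨m, by omega⟩, c), by
          rw [h]; simp only [word]; rw [show n - m - 1 = l by omega]⟩
      · have hl := congrArg List.length h
        simp at hl
        exact ⟨some (false, ⟨m, by omega⟩, c), by
          rw [h]; simp only [word]; rw [show n - m = l by omega]⟩
      · have hl := congrArg List.length h
        simp at hl
        exact ⟨none, by rw [h, ← hl]⟩
    refine Finset.mem_image.2 ⟨k, Finset.mem_univ _, funext fun i => ?_⟩
    rw [← hk]
    simp
  refine (Finset.card_le_card hsub).trans (Finset.card_image_le.trans ?_)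
  simp only [Finset.card_univ, Fintype.card_option, Fintype.card_prod, Fintype.card_bool,
    Fintype.card_fin]
  omega

/-- The number of suffix words grows linearly in `n`, while each has weight at most a constant times
`exp (-n η)` relative to `exp (n P)`. -/
theorem summable_partitionSum_betaSuffix (hβ : 1 < β) {φ φr φ0 : C((betaShift β).carrier, ℝ)}
    (hφ : φ = φr + φ0) (hφr : BowenOn (betaShift β) φr (language (betaShift β)))
    (h0 : DependsOnFirstNonzero φ0) (hP : φ (zeroPoint β) < pressure (betaShift β) φ) :
    Summable fun n : ℕ => partitionSum (betaShift β) φ (betaSuffix β) n *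
      Real.exp (-(n * pressure (betaShift β) φ)) := by
  classical
  obtain ⟨η, hη, C, hC⟩ := exists_supBirkhoff_betaSuffix_le hβ hφ hφr h0 hP
  set P := pressure (betaShift β) φ
  set B : ℝ := ((Fintype.card (BetaAlphabet β) : ℕ) : ℝ) with hB
  have hr : ‖Real.exp (-η)‖ < 1 := by
    rw [Real.norm_eq_abs, Real.abs_exp, Real.exp_lt_one_iff]
    linarith
  have hs : Summable fun n : ℕ => Real.exp C * (1 + 2 * B) * ((n : ℝ) ^ 0 * Real.exp (-η) ^ n) +
      Real.exp C * (2 * B) * ((n : ℝ) ^ 1 * Real.exp (-η) ^ n) :=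
    ((summable_pow_mul_geometric_of_norm_lt_one 0 hr).mul_left _).add
      ((summable_pow_mul_geometric_of_norm_lt_one 1 hr).mul_left _)
  refine Summable.of_nonneg_of_le (fun n => mul_nonneg (partitionSum_nonneg _ _)
    (Real.exp_pos _).le) (fun n => ?_) hs
  have h1 : partitionSum (betaShift β) φ (betaSuffix β) n ≤
      (1 + 2 * ((n + 1) * B)) * Real.exp (n * (P - η) + C) := by
    have h2 : ∀ u : Fin n → BetaAlphabet β,
        upperWeight (betaShift β) φ (betaSuffix β) (List.ofFn u) ≤
          if List.ofFn u ∈ betaSuffix β then Real.exp (n * (P - η) + C) else 0 := by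
      intro u
      split_ifs with h
      · rw [upperWeight_of_mem h h.1]
        refine Real.exp_le_exp.2 ((hC _ h).trans_eq ?_)
        rw [List.length_ofFn]
      · rw [upperWeight_of_notMem fun h' => h h'.1]
    refine (Finset.sum_le_sum fun u _ => h2 u).trans ?_
    rw [← Finset.sum_filter, Finset.sum_const, nsmul_eq_mul]
    refine mul_le_mul_of_nonneg_right ?_ (Real.exp_pos _).le
    rw [hB]
    exact_mod_cast card_filter_betaSuffix_le n
  refine (mul_le_mul_of_nonneg_right h1 (Real.exp_pos _).le).trans_eq ?_
  have h3 : Real.exp (n * (P - η) + C) * Real.exp (-(n * P)) = Real.exp C * Real.exp (-η) ^ n := by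
    rw [← Real.exp_add, ← Real.exp_nat_mul, ← Real.exp_add]
    ring_nf
  rw [mul_assoc, h3]
  ring

end SuffixWords

/-! ### From the decomposition to the tail condition -/

section Fattened

variable {β : ℝ} {φ : C((betaShift β).carrier, ℝ)}

theorem nil_mem_betaSuffix : [] ∈ betaSuffix β := ⟨nil_mem_language, Or.inr (Or.inr ⟨0, rfl⟩)⟩

theorem betaGood_subset_fattened (hβ : 1 < β) :
    betaGood β ⊆ fattened (betaShift β) {[]} (betaGood β) (betaSuffix β) 0 := fun v hv =>
  ⟨betaGood_subset_language hβ hv, [], rfl, v, hv, [], nil_mem_betaSuffix, by simp, le_rfl, le_rfl⟩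

/-- Words of `G(M)` are good for parameters that depend on `M`. -/
theorem exists_fattened_subset_goodWords (hβ : 1 < β)
    (hB : BowenOn (betaShift β) φ (betaGood β)) (M : ℕ) : ∃ (T : ℕ) (V : ℝ),
      fattened (betaShift β) {[]} (betaGood β) (betaSuffix β) M ⊆
        goodWords (betaShift β) φ (betaLoops β) T V := by
  obtain ⟨T, -, hT⟩ := exists_completion hβ M
  obtain ⟨V, hV⟩ := hB
  refine ⟨T, V + 2 * (M * ‖φ‖), fun w hw => ⟨hw.1, hT w hw, ?_⟩⟩
  obtain ⟨hL, c, hc, v, hv, s, -, rfl, -, hs⟩ := hw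
  rw [mem_singleton_iff] at hc
  subst hc
  rw [List.nil_append] at hL ⊢
  have h1 := supBirkhoff_append_le (φ := φ) hL
  have h2 := infBirkhoff_sub_le_append (φ := φ) hL
  have h3 := supBirkhoff_le_mul_norm (φ := φ) (right_mem_language hL)
  have h4 : (s.length : ℝ) * ‖φ‖ ≤ M * ‖φ‖ :=
    mul_le_mul_of_nonneg_right (by exact_mod_cast hs) (norm_nonneg φ)
  have h5 : supBirkhoff (betaShift β) φ v - V ≤ infBirkhoff (betaShift β) φ v := by
    refine le_infBirkhoff (left_mem_language hL) fun x hx => ?_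
    rw [sub_le_iff_le_add]
    refine supBirkhoff_le (left_mem_language hL) fun y hy => ?_
    linarith [(abs_le.1 (hV v hv x hx y hy)).1]
  linarith

/-- Words outside `G(M)` split into a good word and a suffix word of length larger than `M`. -/
theorem partitionSum_fattened_compl_le (M n : ℕ) :
    partitionSum (betaShift β) φ (fattened (betaShift β) {[]} (betaGood β) (betaSuffix β) M)ᶜ n ≤
      ∑ k ∈ Finset.Ioc M n, partitionSum (betaShift β) φ (betaGood β) (n - k) *
        partitionSum (betaShift β) φ (betaSuffix β) k := by
  set f : ℕ → List (BetaAlphabet β) → ℝ := fun k w =>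
    upperWeight (betaShift β) φ (betaGood β) (w.take (n - k)) *
      upperWeight (betaShift β) φ (betaSuffix β) (w.drop (n - k)) with hf
  have hf0 : ∀ k w, 0 ≤ f k w := fun k w =>
    mul_nonneg (upperWeight_nonneg _ _) (upperWeight_nonneg _ _)
  have h1 : ∀ k ∈ Finset.Ioc M n, partitionSum (betaShift β) φ (betaGood β) (n - k) *
      partitionSum (betaShift β) φ (betaSuffix β) k = wordSum n (f k) := by
    intro k hk
    have hkn : n - k + k = n := Nat.sub_add_cancel (Finset.mem_Ioc.1 hk).2
    have h2 : wordSum n (f k) = wordSum (n - k + k) (f k) := by rw [hkn]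
    rw [h2, wordSum_add, partitionSum_eq, partitionSum_eq, ← wordSum_mul_right]
    refine wordSum_congr fun u hu => ?_
    rw [← wordSum_mul_left]
    refine wordSum_congr fun v _ => ?_
    simp only [hf]
    rw [← hu, List.take_left, List.drop_left]
  rw [Finset.sum_congr rfl h1]
  simp only [wordSum]
  rw [Finset.sum_comm, partitionSum_eq, wordSum]
  refine Finset.sum_le_sum fun x _ => ?_
  set w := List.ofFn x with hw
  have hwn : w.length = n := by simp [hw]
  by_cases hmem : w ∉ fattened (betaShift β) {[]} (betaGood β) (betaSuffix β) M ∧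
      w ∈ language (betaShift β)
  · rw [upperWeight_of_mem hmem.1 hmem.2]
    obtain ⟨v, hv, s, hs, hvs⟩ := exists_betaGood_append_betaSuffix hmem.2
    have hL := hmem.2
    rw [hvs] at hL
    have hlen : v.length + s.length = n := by rw [← hwn, hvs, List.length_append]
    have hsM : M < s.length := by
      by_contra! hcon
      exact hmem.1 ⟨hmem.2, [], rfl, v, hv, s, hs, by simpa using hvs, Nat.zero_le _, hcon⟩
    refine le_trans ?_ (Finset.single_le_sum (fun k _ => hf0 k w)
      (Finset.mem_Ioc.2 ⟨hsM, by omega⟩ : s.length ∈ Finset.Ioc M n))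
    simp only [hf]
    rw [show n - s.length = v.length by omega, hvs, List.take_left, List.drop_left,
      upperWeight_of_mem hv (left_mem_language hL), upperWeight_of_mem hs (right_mem_language hL),
      ← Real.exp_add]
    exact Real.exp_le_exp.2 (supBirkhoff_append_le hL)
  · rw [upperWeight_of_notMem hmem]
    exact Finset.sum_nonneg fun k _ => hf0 k w

/-- The collection `G` consists of good words for fixed parameters, so its partition sums are `O(exp
(n P))`. Words outside `G(M)` are then bounded by `exp (n P)` times the tail beyond `M` of the
convergent suffix series. -/
theorem tailSmall_betaLoops (hβ : 1 < β) (hB : BowenOn (betaShift β) φ (betaGood β))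
    (hs : Summable fun n : ℕ => partitionSum (betaShift β) φ (betaSuffix β) n *
      Real.exp (-(n * pressure (betaShift β) φ))) : TailSmall (betaShift β) φ (betaLoops β) := by
  obtain ⟨T, V, hTV⟩ := exists_fattened_subset_goodWords hβ hB 0
  obtain ⟨C, hC, hG⟩ := partitionSum_goodWords_le (φ := φ) (isLoopSystem_betaLoops hβ) T V
  have hG' : ∀ n, partitionSum (betaShift β) φ (betaGood β) n ≤
      C * Real.exp (n * pressure (betaShift β) φ) := fun n =>
    (partitionSum_mono ((betaGood_subset_fattened hβ).trans hTV) n).trans (hG n)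
  intro ε hε
  obtain ⟨s, hsv⟩ := summable_iff_vanishing_norm.1 hs (ε / C) (by positivity)
  -- `M` is the maximum of the finite set from the Cauchy criterion, so all suffix lengths exceeding
  -- `M` avoid that set.
  obtain ⟨T', V', hTV'⟩ := exists_fattened_subset_goodWords hβ hB (s.sup id)
  refine ⟨T', V', fun n => (partitionSum_mono (compl_subset_compl.2 hTV') n).trans
    ((partitionSum_fattened_compl_le _ n).trans ?_)⟩
  have h1 : ∀ k ∈ Finset.Ioc (s.sup id) n, partitionSum (betaShift β) φ (betaGood β) (n - k) *
      partitionSum (betaShift β) φ (betaSuffix β) k ≤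
      C * Real.exp (n * pressure (betaShift β) φ) *
        (partitionSum (betaShift β) φ (betaSuffix β) k *
          Real.exp (-(k * pressure (betaShift β) φ))) := by
    intro k hk
    refine (mul_le_mul_of_nonneg_right (hG' _) (partitionSum_nonneg _ _)).trans_eq ?_
    have h2 : Real.exp ((n - k : ℕ) * pressure (betaShift β) φ) =
        Real.exp (n * pressure (betaShift β) φ) * Real.exp (-(k * pressure (betaShift β) φ)) := by
      rw [← Real.exp_add, Nat.cast_sub (Finset.mem_Ioc.1 hk).2]
      ring_nf
    rw [h2]
    ring
  refine (Finset.sum_le_sum h1).trans ?_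
  rw [← Finset.mul_sum]
  have h3 : Disjoint (Finset.Ioc (s.sup id) n) s := Finset.disjoint_left.2 fun k hk hks =>
    absurd (Finset.le_sup (f := id) hks) (not_le.2 (Finset.mem_Ioc.1 hk).1)
  have h4 := (le_abs_self _).trans (hsv _ h3).le
  refine (mul_le_mul_of_nonneg_left h4 (by positivity)).trans_eq ?_
  field_simp

theorem weakGibbs_of_isGibbs (hβ : 1 < β) (hB : BowenOn (betaShift β) φ (betaGood β))
    {μ : Measure (betaShift β).carrier} {K' : ℝ} {K : ℕ → ℝ → ℝ} (hK' : 0 < K')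
    (hK : ∀ T V, 0 < K T V) (h : IsGibbs (betaShift β) φ (betaLoops β) μ K' K) :
    WeakGibbs (betaShift β) φ μ {[]} (betaGood β) (betaSuffix β) := by
  choose T V hTV using exists_fattened_subset_goodWords hβ hB
  refine ⟨K', fun M => K (T M) (V M), hK', fun M => hK _ _, fun M w hw => ?_⟩
  rw [le_div_iff₀ (Real.exp_pos _), div_le_iff₀ (Real.exp_pos _)]
  exact ⟨h.2 _ _ w (hTV M hw), h.1 w hw.1⟩

end Fattened

end BetaShift
theorem mainTheorem6 (β : ℝ) (hβ : 1 < β)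
    (φ φr : C((betaShift β).carrier, ℝ)) (a : List (BetaAlphabet β) → ℝ)
    (hφr : BowenOn (betaShift β) φr (language (betaShift β)))
    (ha : GridCoefficients (betaShift β) (zeroShift β) a)
    (halen : ∀ u ∈ minimalForbidden (betaShift β) (zeroShift β),
      ∀ v ∈ minimalForbidden (betaShift β) (zeroShift β), u.length = v.length → a u = a v)
    (hφ : ∀ x, φ x = φr x + gridFunction (betaShift β) (zeroShift β) a x)
    (hP : φ (zeroPoint β) < pressure (betaShift β) φ) :
    IsGoodDecomposition (betaShift β) φ {[]} (betaGood β) (betaSuffix β) ∧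
      ∃ μ : Measure (betaShift β).carrier,
        IsEquilibriumState (betaShift β) φ μ ∧
        (∀ ν : Measure (betaShift β).carrier, IsEquilibriumState (betaShift β) φ ν → ν = μ) ∧
        WeakGibbs (betaShift β) φ μ {[]} (betaGood β) (betaSuffix β) ∧
        WeakStarTendsto (betaShift β) (periodicMeasure (betaShift β) φ) μ := by
  -- The grid part is taken as the difference `φ - φr`, which is continuous and agrees pointwise
  -- with the grid function.
  obtain ⟨φ0, h0eq⟩ : ∃ φ0, φ0 = φ - φr := ⟨_, rfl⟩
  have hsum : φ = φr + φ0 := by rw [h0eq]; abel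
  have h0 : DependsOnFirstNonzero φ0 := by
    intro x y k hxy hk
    have h : ∀ z, φ0 z = gridFunction (betaShift β) (zeroShift β) a z := fun z => by
      rw [h0eq, ContinuousMap.sub_apply, hφ, add_sub_cancel_left]
    rw [h, h]
    exact gridFunction_congr a hxy hk
  have hB := bowenOn_betaGood hβ hsum hφr h0
  have hs := summable_partitionSum_betaSuffix hβ hsum hφr h0 hP
  obtain ⟨μ, hμ, huniq, ⟨K', hK', K, hK, hG⟩, hper⟩ := exists_unique_equilibriumState
    (isLoopSystem_betaLoops hβ) (tailSmall_betaLoops hβ hB hs) (shiftMap_zeroPoint (β := β))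
  refine ⟨⟨?_, betaGood_subset_language hβ, fun u hu => hu.1, concatWords_betaShift,
    perSpecification_fattened hβ, hB, ?_⟩, μ, hμ, huniq, weakGibbs_of_isGibbs hβ hB hK' hK hG, hper⟩
  · rintro u rfl
    exact nil_mem_language
  -- The only prefix, the empty word, is already a suffix word.
  · rw [singleton_union, insert_eq_of_mem nil_mem_betaSuffix]
    exact (summable_nat_add_iff 1).2 hs
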